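/- **Setting.** Let $\mathbf{Man}$ be the category of finite-dimensional (Hausdorff, second countable) smooth manifolds. All prestacks below are pseudofunctors $\mathbf{Man}^{\mathrm{op}}\to\mathbf{Cat}$, and a *stack morphism* is a pseudonatural transformation of these pseudofunctors: functors $F_U$ for all $U$, together with natural isomorphisms $F_h:h^\ast F_{U'}\Rightarrow F_U h^\ast$ for all smooth maps $h:U\to U'$, compatible with identities and compositions. Write $C^\infty_{\mathbb C,U}$ for the sheaf of complex-valued smooth functions on $U$. * $\mathbf{Loc}_1^\infty(U)$: objects are smooth fiber bundles $\pi:M\to U$ whose typical fiber is an open interval, with a smooth, nowhere vanishing vertical one-form $E$; morphisms are smooth bundle maps over $\mathrm{id}_U$ that are open embeddings $f$ with $f^\ast E'=E$. Pullback along $h$ is the pullback bundle $h^\ast M$ with the pulled back form; $\overline h:h^\ast M\to M$ denotes the canonical map. * $\mathbf{IPVec}_{\mathbb C}^\infty(U)$: objects are sheaves $V$ of $C^\infty_{\mathbb C,U}$-modules with an antilinear involution $\ast$ and a symmetric bilinear pairing $\langle\cdot,\cdot\rangle:V\times V\to C^\infty_{\mathbb C,U}$ such that $\langle v,w\rangle^\ast=\langle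 v^\ast,w^\ast\rangle$; morphisms preserve $\ast$ and $\langle\cdot,\cdot\rangle$. ${}^\ast\mathbf{Alg}_{\mathbb C}^\infty(U)$: sheaves of associative unital $\ast$-algebras over $C^\infty_{\mathbb C,U}$. Pullback is the pullback of sheaves of modules with the induced structure. For $(\pi:M\to U,E)$ and $W\subseteq U$ open, $E$ orients the fibers, and $J_{\mathrm v}^{\pm}(A)\subseteq M$ is the set of points reached from $A\subseteq M$ by future/past directed vertical curves. A smooth function (or $\mathbb C^2$-valued function) on $M|_W$ is *vertically past/future compactly supported* if every $x\in W$ has an open neighbourhood $W_x\subseteq W$ and a smooth section $\sigma$ of $\pi$ over $W_x$ such that the support of its restriction to $M|_{W_x}$ lies in $J_{\mathrm v}^{\pm}(\sigma(W_x))$; it is *vertically compactly supported* if both hold. These form sheaves $C^\infty_{\mathrm{vpc}}$, $C^\infty_{\mathrm{vfc}}$, $C^\infty_{\mathrm{vc}}$ of modules on $U$. Let $$D=\begin{pmatrix} i\ast_{\mathrm v}\mathrm d_{\mathrm v}&0\\0&-i\ast_{\mathrm v}\mathrm d_{\mathrm v}\end{pmatrix},\qquad \mathrm d_{\mathrm v}\varphi=(\ast_{\mathrm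 v}\mathrm d_{\mathrm v}\varphi)\,E .$$ **Proposition.** 1. For every $(\pi:M\to U,E)$ the operator $D$ has retarded and advanced Green operators $S^\pm$: morphisms of sheaves of $C^\infty_{\mathbb C,U}$-modules on $C^\infty_{\mathrm{vpc}/\mathrm{vfc}}\otimes\mathbb C^2$ that are inverse to the restriction of $D$ and satisfy $\mathrm{supp}(S^\pm\varphi)\subseteq J_{\mathrm v}^\pm(\mathrm{supp}\,\varphi)$. Put $S=S^+-S^-$ on $C^\infty_{\mathrm{vc}}\otimes\mathbb C^2$. 2. There is a stack morphism $\mathfrak L^{\mathsf f}:\mathbf{Loc}_1^\infty\to\mathbf{IPVec}_{\mathbb C}^\infty$ with $$\mathfrak L^{\mathsf f}_U(\pi,E)=\Big(\frac{C^\infty_{\mathrm{vc}}\otimes\mathbb C^2}{D(C^\infty_{\mathrm{vc}}\otimes\mathbb C^2)},\ \ast,\ \langle\cdot,\cdot\rangle\Big),$$ where the quotient sheaf has sections $\big(C^\infty_{\mathrm{vc}}(W)\otimes\mathbb C^2\big)/D\big(C^\infty_{\mathrm{vc}}(W)\otimes\mathbb C^2\big)$ over each open $W\subseteq U$; the involution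 is induced by $(\psi,\overline\psi)\mapsto(\overline\psi^{\,\ast},\psi^\ast)$ (swap and complex conjugation); and the pairing is induced by $$\Big\langle\begin{pmatrix}\psi\\\overline\psi\end{pmatrix},\begin{pmatrix}\psi'\\\overline\psi'\end{pmatrix}\Big\rangle=\int_\pi\begin{pmatrix}\psi&\overline\psi\end{pmatrix}\begin{pmatrix}0&i\\-i&0\end{pmatrix}S\begin{pmatrix}\psi'\\\overline\psi'\end{pmatrix}E ,$$ with $\int_\pi(-)E$ the integration over the fibers oriented by $E$. On a morphism $f$, $\mathfrak L^{\mathsf f}_U(f)$ is induced by the pushforward (extension by zero) $f_\ast$. For $h:U\to U'$ the isomorphism $\mathfrak L^{\mathsf f}_h:h^\ast\mathfrak L^{\mathsf f}_{U'}(\pi,E)\to\mathfrak L^{\mathsf f}_U(h^\ast(\pi,E))$ corresponds, under the adjunction between pullback and pushforward of sheaves of modules, to the pullback of functions along $\overline h$. 3. There is a stack morphism $\mathfrak{CAR}:\mathbf{IPVec}_{\mathbb C}^\infty\to{}^\ast\mathbf{Alg}_{\mathbb C}^\infty$ for which $\mathfrak{CAR}_U(V)$ is the sheaf of $\ast$-algebras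 generated by $V$, via a $\ast$-preserving morphism $j_V:V\to\mathfrak{CAR}_U(V)$ of sheaves of modules, subject to the relations $j_V(v)\,j_V(w)+j_V(w)\,j_V(v)=\langle v,w\rangle\,1$ (it is universal with this property), whose action on morphisms and whose coherence isomorphisms are the ones compatible with the $j_V$. Hence the composite $\mathfrak A^{\mathsf f}=\mathfrak{CAR}\circ\mathfrak L^{\mathsf f}:\mathbf{Loc}_1^\infty\to{}^\ast\mathbf{Alg}_{\mathbb C}^\infty$ is a stack morphism, i.e. a smooth $1$-dimensional AQFT. -/

import Mathlib

open CategoryTheory Opposite TopologicalSpace Bundle Topology Manifold ContDiff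

noncomputable section

namespace SmoothAQFT

/-- A finite-dimensional smooth manifold (Hausdorff, second countable, without boundary). -/
structure Man where
  carrier : Type
  dim : ℕ
  [top : TopologicalSpace carrier]
  [charted : ChartedSpace (EuclideanSpace ℝ (Fin dim)) carrier]
  [smooth : IsManifold (𝓡 dim) ∞ carrier]
  [t2 : T2Space carrier]
  [sc : SecondCountableTopology carrier]

attribute [instance] Man.top Man.charted Man.smooth Man.t2 Man.sc


namespace Man

instance : CoeSort Man Type := ⟨Man.carrier⟩

/-- Smooth maps of manifolds. -/
abbrev Map (U U' : Man) : Type := C^∞⟮𝓡 U.dim, U; 𝓡 U'.dim, U'⟯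

instance : Category Man where
  Hom U U' := Map U U'
  id U := ContMDiffMap.id
  comp f g := ContMDiffMap.comp g f

/-- The underlying smooth map. -/
def Hom.fn {U U' : Man} (h : U ⟶ U') : U → U' := fun x => (show Map U U' from h) x

theorem Hom.smooth {U U' : Man} (h : U ⟶ U') : ContMDiff (𝓡 U.dim) (𝓡 U'.dim) ∞ (Hom.fn h) :=
  (show Map U U' from h).contMDiff

theorem Hom.cont {U U' : Man} (h : U ⟶ U') : Continuous (Hom.fn h) := (Hom.smooth h).continuous

/-- The preimage functor on open subsets. -/
abbrev pre {U U' : Man} (h : U ⟶ U') : Opens U' ⥤ Opens U :=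
  Opens.map (TopCat.ofHom ⟨Hom.fn h, Hom.cont h⟩)

end Man

instance : ContMDiffRing 𝓘(ℝ, ℂ) ∞ ℂ where
  contMDiff_add := by
    rw [← modelWithCornersSelf_prod, chartedSpaceSelf_prod]
    exact contDiff_add.contMDiff
  contMDiff_mul := by
    rw [← modelWithCornersSelf_prod, chartedSpaceSelf_prod]
    exact contDiff_mul.contMDiff


/-- The sheaf of complex-valued smooth functions. -/
abbrev O (U : Man) : Sheaf (Opens.grothendieckTopology U) RingCat.{0} :=
  smoothSheafRing (𝓡 U.dim) 𝓘(ℝ, ℂ) U ℂ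

/-- Sections of the structure sheaf. -/
abbrev Fn (U : Man) (W : Opens U) : Type := (O U).obj.obj (op W)

namespace Fn
variable {U : Man} {W : Opens U}

def ev (a : Fn U W) (x : W) : ℂ := a.1 x

theorem ext {a b : Fn U W} (h : ∀ x, a.ev x = b.ev x) : a = b := Subtype.ext (funext h)

theorem ev_add (a b : Fn U W) (x : W) : (a + b).ev x = a.ev x + b.ev x := rfl
theorem ev_mul (a b : Fn U W) (x : W) : (a * b).ev x = a.ev x * b.ev x := rfl
theorem ev_one (x : W) : (1 : Fn U W).ev x = 1 := rfl
theorem ev_zero (x : W) : (0 : Fn U W).ev x = 0 := rfl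

theorem smooth (a : Fn U W) : ContMDiff (𝓡 U.dim) 𝓘(ℝ, ℂ) ∞ a.ev :=
  smoothSheaf.contMDiff_section a

end Fn

namespace Man

instance {U U' : Man} (h : U ⟶ U') : (pre h).IsContinuous (Opens.grothendieckTopology U')
    (Opens.grothendieckTopology U) :=
  Functor.isContinuous_of_coverPreserving
    (compatiblePreserving_opens_map (TopCat.ofHom (⟨Hom.fn h, Hom.cont h⟩ : C(U, U'))))
    (coverPreserving_opens_map (TopCat.ofHom (⟨Hom.fn h, Hom.cont h⟩ : C(U, U'))))

end Man

/-- Sheaves of modules over the sheaf of complex-valued smooth functions. -/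
abbrev Mod (U : Man) := SheafOfModules.{0} (O U)

/-- Sections over an open subset. -/
abbrev Sec {U : Man} (V : Mod U) (W : Opens U) : Type := V.val.obj (op W)

/-- Restriction of sections. -/
def res {U : Man} (V : Mod U) {W W' : Opens U} (i : W' ≤ W) (v : Sec V W) : Sec V W' :=
  V.val.map (homOfLE i).op v

/-- Restriction of functions. -/
def Fn.rs {U : Man} {W W' : Opens U} (i : W' ≤ W) (a : Fn U W) : Fn U W' :=
  (O U).obj.map (homOfLE i).op a

theorem Fn.ev_rs {U : Man} {W W' : Opens U} (i : W' ≤ W) (a : Fn U W) (x : W') :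
    Fn.ev (Fn.rs i a) x = Fn.ev a ⟨x, i x.2⟩ := rfl

section
variable {U : Man} (V : Mod U) {W W' W'' : Opens U}

theorem res_add (i : W' ≤ W) (v w : Sec V W) : res V i (v + w) = res V i v + res V i w :=
  map_add (V.val.map (homOfLE i).op).hom v w

theorem res_smul (i : W' ≤ W) (a : Fn U W) (v : Sec V W) :
    res V i (a • v) = Fn.rs i a • res V i v :=
  V.val.map_smul (homOfLE i).op a v

theorem res_res (i : W' ≤ W) (j : W'' ≤ W') (v : Sec V W) :
    res V j (res V i v) = res V (j.trans i) v := by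
  have := V.val.map_comp (homOfLE i).op (homOfLE j).op
  exact (congrArg (fun f => f v) this).symm

theorem res_refl (i : W ≤ W) (v : Sec V W) : res V i v = v := by
  have := V.val.map_id (op W)
  exact congrArg (fun f => f v) this

end

/-- The action of a morphism of sheaves on sections. -/
def act {U : Man} {V N : Mod U} (f : V ⟶ N) {W : Opens U} (v : Sec V W) : Sec N W :=
  f.val.app (op W) v

section
variable {U : Man} {V N : Mod U} {W W' : Opens U}
theorem act_add (f : V ⟶ N) (v w : Sec V W) : act f (v + w) = act f v + act f w := map_add _ _ _
theorem act_smul (f : V ⟶ N) (a : Fn U W) (v : Sec V W) : act f (a • v) = a • act f v :=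
  map_smul _ _ _
theorem act_res (f : V ⟶ N) (i : W' ≤ W) (v : Sec V W) : act f (res V i v) = res N i (act f v) :=
  PresheafOfModules.naturality_apply f.val (homOfLE i).op v
theorem act_id (v : Sec V W) : act (𝟙 V) v = v := rfl
theorem act_comp {P : Mod U} (f : V ⟶ N) (g : N ⟶ P) (v : Sec V W) :
   act (f ≫ g) v = act g (act f v) := rfl
theorem act_ext {f g : V ⟶ N} (H : ∀ W (v : Sec V W), act f v = act g v) : f = g := by
  apply SheafOfModules.hom_ext
  ext W v
  exact H _ _

/-- A morphism of sheaves from its action on sections. -/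
def mkHom (f : ∀ W, Sec V W → Sec N W) (add : ∀ W v w, f W (v + w) = f W v + f W w)
    (smul : ∀ W (a : Fn U W) v, f W (a • v) = a • f W v)
    (nat : ∀ W W' (i : W' ≤ W) v, f W' (res V i v) = res N i (f W v)) : V ⟶ N where
  val :=
    { app := fun W => ModuleCat.ofHom
        { toFun := f W.unop
          map_add' := add _
          map_smul' := smul _ }
      naturality := by
        intro W W' i
        ext v
        exact nat _ _ i.unop.le v }

theorem act_mkHom (f : ∀ W, Sec V W → Sec N W) (add smul nat) (v : Sec V W) :
    act (mkHom f add smul nat) v = f W v := rfl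
end


namespace Man

/-- Pullback of functions along a smooth map. -/
def Hom.fnPull {U U' : Man} (h : U ⟶ U') (W : Opens U') : Fn U' W →+* Fn U ((pre h).obj W) where
  toFun a := ⟨fun x => Fn.ev a ⟨Hom.fn h x, x.2⟩, by
    have h1 : ContMDiff (𝓡 U.dim) 𝓘(ℝ, ℂ) ∞ (fun x : (pre h).obj W => Fn.ev a ⟨Hom.fn h x, x.2⟩) := by
      have h2 : ContMDiff (𝓡 U.dim) (𝓡 U'.dim) ∞
          (fun x : (pre h).obj W => (⟨Hom.fn h x, x.2⟩ : W)) := by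
        rw [← ContMDiff.subtypeVal_comp_iff]
        exact (Hom.smooth h).comp contMDiff_subtype_val
      exact (Fn.smooth a).comp h2
    exact h1⟩
  map_one' := rfl
  map_mul' _ _ := rfl
  map_zero' := rfl
  map_add' _ _ := rfl

/-- The comorphism of structure sheaves. -/
def phi {U U' : Man} (h : U ⟶ U') : O U' ⟶
  ((pre h).sheafPushforwardContinuous RingCat.{0} (Opens.grothendieckTopology U')
    (Opens.grothendieckTopology U)).obj (O U) where
  hom := { app := fun W => RingCat.ofHom (Hom.fnPull h W.unop) }

theorem isRightAdjoint_aux (C D : Type) [SmallCategory C] [SmallCategory D] {F : C ⥤ D}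
    {R : Dᵒᵖ ⥤ RingCat.{0}} {S : Cᵒᵖ ⥤ RingCat.{0}} (φ : S ⟶ F.op ⋙ R) :
    (PresheafOfModules.pushforward.{0} φ).IsRightAdjoint := inferInstance

instance isRightAdjoint {U U' : Man} (h : U ⟶ U') :
    (SheafOfModules.pushforward.{0} (phi h)).IsRightAdjoint :=
  haveI : (PresheafOfModules.pushforward.{0} (phi h).hom).IsRightAdjoint :=
    isRightAdjoint_aux _ _ (phi h).hom
  inferInstance

end Man

open Man

/-- Pushforward of sheaves of modules. -/
abbrev push {U U' : Man} (h : U ⟶ U') : Mod U ⥤ Mod U' := SheafOfModules.pushforward.{0} (phi h)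

/-- Pullback of sheaves of modules. -/
def pull {U U' : Man} (h : U ⟶ U') (V : Mod U') : Mod U := (SheafOfModules.pullback.{0} (phi h)).obj V

/-- The unit on sections. -/
def eta {U U' : Man} (h : U ⟶ U') {V : Mod U'} {W : Opens U'} (v : Sec V W) :
    Sec (pull h V) ((pre h).obj W) :=
  act (N := (push h).obj (pull h V))
    ((SheafOfModules.pullbackPushforwardAdjunction (phi h)).unit.app V) v

section
variable {U U' : Man} (h : U ⟶ U') {V : Mod U'} {N : Mod U} {W W' : Opens U'}
theorem eta_add (v w : Sec V W) : eta h (v + w) = eta h v + eta h w := act_add _ _ _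
theorem eta_smul (a : Fn U' W) (v : Sec V W) : eta h (a • v) = Hom.fnPull h W a • eta h v :=
  act_smul _ _ _
theorem eta_res (i : W' ≤ W) (v : Sec V W) :
    eta h (res V i v) = res _ ((pre h).map (homOfLE i)).le (eta h v) := act_res _ _ _

theorem pull_hom_ext {f g : pull h V ⟶ N}
    (H : ∀ W (v : Sec V W), act f (eta h v) = act g (eta h v)) : f = g := by
  apply ((SheafOfModules.pullbackPushforwardAdjunction (phi h)).homEquiv V N).injective
  refine (Adjunction.homEquiv_unit _ _ _ f).trans (Eq.trans ?_
    (Adjunction.homEquiv_unit _ _ _ g).symm)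
  exact act_ext H

theorem pull_exists (f : ∀ W, Sec V W → Sec N ((pre h).obj W))
    (add : ∀ W v w, f W (v + w) = f W v + f W w)
    (smul : ∀ W (a : Fn U' W) v, f W (a • v) = Hom.fnPull h W a • f W v)
    (nat : ∀ W W' (i : W' ≤ W) v,
      f W' (res V i v) = res N ((pre h).map (homOfLE i)).le (f W v)) :
    ∃ g : pull h V ⟶ N, ∀ W (v : Sec V W), act g (eta h v) = f W v := by
  let k : V ⟶ (push h).obj N := mkHom (N := (push h).obj N) f add smul nat
  refine ⟨((SheafOfModules.pullbackPushforwardAdjunction (phi h)).homEquiv V N).symm k, ?_⟩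
  intro W v
  have := ((SheafOfModules.pullbackPushforwardAdjunction (phi h)).homEquiv V N).apply_symm_apply k
  rw [Adjunction.homEquiv_unit] at this
  exact congrArg (fun f => act f v) this
end

/-- Intersection with a fixed open subset. -/
def meetF {U : Man} (Q : Opens U) : Opens U ⥤ Opens U where
  obj R := R ⊓ Q
  map i := homOfLE (inf_le_inf_right Q i.le)

instance {U : Man} (Q : Opens U) : (meetF Q).IsContinuous (Opens.grothendieckTopology U)
    (Opens.grothendieckTopology U) := by
  let j := Opens.inclusion' (X := TopCat.of U) Q
  have hj : IsOpenEmbedding j := Opens.isOpenEmbedding (X := TopCat.of U) Q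
  have c1 : (Opens.map j).IsContinuous (Opens.grothendieckTopology (TopCat.of U))
      (Opens.grothendieckTopology _) :=
    Functor.isContinuous_of_coverPreserving (compatiblePreserving_opens_map j)
      (coverPreserving_opens_map j)
  have c2 := hj.functor_isContinuous
  have e : Opens.map j ⋙ hj.functor ≅ meetF Q := NatIso.ofComponents
    (fun R => eqToIso (by
      ext x
      simp only [Functor.comp_obj]
      constructor
      · rintro ⟨y, hy, rfl⟩
        exact ⟨hy, y.2⟩
      · rintro ⟨h1, h2⟩
        exact ⟨⟨x, h2⟩, h1, rfl⟩)) (fun _ => Subsingleton.elim _ _)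
  exact Functor.isContinuous_comp' e (Opens.grothendieckTopology (TopCat.of U))
      (Opens.grothendieckTopology _) (Opens.grothendieckTopology (TopCat.of U))

def rho {U : Man} (Q : Opens U) : O U ⟶
  ((meetF Q).sheafPushforwardContinuous RingCat.{0} (Opens.grothendieckTopology U)
    (Opens.grothendieckTopology U)).obj (O U) where
  hom := { app := fun W => (O U).obj.map (homOfLE (inf_le_left : W.unop ⊓ Q ≤ W.unop)).op
           naturality := fun _ _ _ => rfl }

/-- The sheaf of sections over the intersection with a fixed open subset. -/
def near {U : Man} (T : Mod U) (Q : Opens U) : Mod U := (SheafOfModules.pushforward.{0} (rho Q)).obj T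

def conjFn {U : Man} (W : Opens U) : Fn U W →+* Fn U W where
  toFun a := ⟨fun x => starRingEnd ℂ (Fn.ev a x), by
    have h1 : ContMDiff (𝓡 U.dim) 𝓘(ℝ, ℂ) ∞ (fun x : W => Complex.conjCLE (Fn.ev a x)) :=
      Complex.conjCLE.contDiff.contMDiff.comp (Fn.smooth a)
    exact h1⟩
  map_one' := Fn.ext fun _ => map_one (starRingEnd ℂ)
  map_mul' a b := Fn.ext fun x => map_mul (starRingEnd ℂ) (Fn.ev a x) (Fn.ev b x)
  map_zero' := Fn.ext fun _ => map_zero (starRingEnd ℂ)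
  map_add' a b := Fn.ext fun x => map_add (starRingEnd ℂ) (Fn.ev a x) (Fn.ev b x)

theorem conjFn_conjFn {U : Man} {W : Opens U} (a : Fn U W) : conjFn W (conjFn W a) = a :=
  Fn.ext fun x => Complex.conj_conj (Fn.ev a x)

def conjPhi (U : Man) : O U ⟶
  ((𝟭 (Opens U)).sheafPushforwardContinuous RingCat.{0} (Opens.grothendieckTopology U)
    (Opens.grothendieckTopology U)).obj (O U) where
  hom := { app := fun W => RingCat.ofHom (conjFn W.unop) }

/-- The complex conjugate sheaf of modules. -/
def cj {U : Man} (T : Mod U) : Mod U := (SheafOfModules.pushforward.{0} (conjPhi U)).obj T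

section
variable {U U' : Man} {h : U ⟶ U'}

theorem cj_exists {V : Mod U'} {N : Mod U} (f : ∀ W, Sec V W → Sec N ((pre h).obj W))
    (add : ∀ W v w, f W (v + w) = f W v + f W w)
    (smul : ∀ W (a : Fn U' W) v, f W (a • v) = conjFn _ (Hom.fnPull h W a) • f W v)
    (nat : ∀ W W' (i : W' ≤ W) v,
      f W' (res V i v) = res N ((pre h).map (homOfLE i)).le (f W v)) :
    ∃ g : ∀ R, Sec (pull h V) R → Sec N R,
      (∀ R v w, g R (v + w) = g R v + g R w) ∧
      (∀ R (a : Fn U R) v, g R (a • v) = conjFn _ a • g R v) ∧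
      (∀ R R' (i : R' ≤ R) v, g R' (res _ i v) = res N i (g R v)) ∧
      ∀ W (v : Sec V W), g _ (eta h v) = f W v := by
  obtain ⟨g, hg⟩ := pull_exists (N := cj N) h f add smul nat
  exact ⟨fun R v => act g v, fun R v w => act_add g v w, fun R a v => act_smul g a v,
    fun R R' i v => act_res g i v, hg⟩

theorem cj_unique {V : Mod U'} {N : Mod U} (f g : ∀ R, Sec (pull h V) R → Sec N R)
      (f1 : ∀ R v w, f R (v + w) = f R v + f R w)
      (f2 : ∀ R (a : Fn U R) v, f R (a • v) = conjFn _ a • f R v)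
      (f3 : ∀ R R' (i : R' ≤ R) v, f R' (res _ i v) = res N i (f R v))
      (g1 : ∀ R v w, g R (v + w) = g R v + g R w)
      (g2 : ∀ R (a : Fn U R) v, g R (a • v) = conjFn _ a • g R v)
      (g3 : ∀ R R' (i : R' ≤ R) v, g R' (res _ i v) = res N i (g R v))
      (H : ∀ W (v : Sec V W), f _ (eta h v) = g _ (eta h v)) : f = g := by
  have := pull_hom_ext (h := h) (f := mkHom (N := cj N) f f1 f2 f3) (g := mkHom (N := cj N) g g1 g2 g3) H
  funext R v
  exact congrArg (fun k => act k v) this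

end

theorem rs_rs {U : Man} {W W' W'' : Opens U} (i : W' ≤ W) (j : W'' ≤ W') (a : Fn U W) :
    Fn.rs j (Fn.rs i a) = Fn.rs (j.trans i) a := rfl

theorem rs_refl {U : Man} {W : Opens U} (i : W ≤ W) (a : Fn U W) : Fn.rs i a = a := rfl

theorem smul_smul_comm {U : Man} {V : Mod U} {W : Opens U} (a b : Fn U W) (v : Sec V W) :
    a • b • v = b • a • v := by
  rw [smul_smul, smul_smul]
  congr 1
  exact Fn.ext fun x => mul_comm _ _

/-- Morphisms of sheaves of modules as families of maps on sections. -/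
structure IsLin {U : Man} {V N : Mod U} (f : ∀ R, Sec V R → Sec N R) : Prop where
  add : ∀ R v w, f R (v + w) = f R v + f R w
  smul : ∀ R (a : Fn U R) v, f R (a • v) = a • f R v
  nat : ∀ R R' (i : R' ≤ R) v, f R' (res _ i v) = res N i (f R v)

/-- Bilinear maps of sheaves of modules. -/
structure IsBil {U : Man} {V₁ V₂ T : Mod U} (B : ∀ R, Sec V₁ R → Sec V₂ R → Sec T R) : Prop where
  add_left : ∀ R v w u, B R (v + w) u = B R v u + B R w u
  add_right : ∀ R v w u, B R u (v + w) = B R u v + B R u w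
  smul_left : ∀ R (a : Fn U R) v u, B R (a • v) u = a • B R v u
  smul_right : ∀ R (a : Fn U R) v u, B R u (a • v) = a • B R u v
  nat : ∀ R R' (i : R' ≤ R) v w, B R' (res _ i v) (res _ i w) = res T i (B R v w)

/-- Bilinear maps over a smooth map of the bases. -/
structure IsBilOver {U U' : Man} (h : U ⟶ U') {V₁ V₂ : Mod U'} {T : Mod U}
    (B : ∀ W, Sec V₁ W → Sec V₂ W → Sec T ((pre h).obj W)) : Prop where
  add_left : ∀ R v w u, B R (v + w) u = B R v u + B R w u
  add_right : ∀ R v w u, B R u (v + w) = B R u v + B R u w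
  smul_left : ∀ R (a : Fn U' R) v u, B R (a • v) u = Hom.fnPull h R a • B R v u
  smul_right : ∀ R (a : Fn U' R) v u, B R u (a • v) = Hom.fnPull h R a • B R u v
  nat : ∀ R R' (i : R' ≤ R) v w,
    B R' (res _ i v) (res _ i w) = res T ((pre h).map (homOfLE i)).le (B R v w)

section
variable {U : Man} {T : Mod U} {Q R R' : Opens U}

def toN (t : Sec T (R ⊓ Q)) : Sec (near T Q) R := t
def ofN (t : Sec (near T Q) R) : Sec T (R ⊓ Q) := t
theorem ofN_toN (t : Sec T (R ⊓ Q)) : ofN (toN t) = t := rfl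
theorem toN_inj {s t : Sec (near T Q) R} (h : ofN s = ofN t) : s = t := h
theorem toN_add (s t : Sec T (R ⊓ Q)) : toN (s + t) = toN s + toN t := rfl
theorem toN_smul (a : Fn U R) (t : Sec T (R ⊓ Q)) : toN (Fn.rs (inf_le_left : R ⊓ Q ≤ R) a • t) = a • toN t := rfl
theorem toN_res (i : R' ≤ R) (t : Sec T (R ⊓ Q)) :
    toN (res T (inf_le_inf_right Q i) t) = res (near T Q) i (toN t) := rfl
theorem ofN_add (s t : Sec (near T Q) R) : ofN (s + t) = ofN s + ofN t := rfl
theorem ofN_smul (a : Fn U R) (t : Sec (near T Q) R) :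
    ofN (a • t) = Fn.rs (inf_le_left : R ⊓ Q ≤ R) a • ofN t := rfl
theorem ofN_res (i : R' ≤ R) (t : Sec (near T Q) R) :
    ofN (res (near T Q) i t) = res T (inf_le_inf_right Q i) (ofN t) := rfl

theorem IsBil.lin_left {V₁ V₂ T : Mod U} {B : ∀ R, Sec V₁ R → Sec V₂ R → Sec T R} (hB : IsBil B)
    {Q : Opens U} (w : Sec V₂ Q) : IsLin (V := V₁) (N := near T Q) fun R v =>
      toN (B (R ⊓ Q) (res V₁ inf_le_left v) (res V₂ inf_le_right w)) where
  add R v v' := by rw [res_add, hB.add_left, toN_add]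
  smul R a v := by rw [res_smul, hB.smul_left, toN_smul]
  nat R R' i v := by
    rw [← toN_res, ← hB.nat, res_res, res_res, res_res]

theorem IsBil.lin_right {V₁ V₂ T : Mod U} {B : ∀ R, Sec V₁ R → Sec V₂ R → Sec T R} (hB : IsBil B)
    {Q : Opens U} (w : Sec V₁ Q) : IsLin (V := V₂) (N := near T Q) fun R v =>
      toN (B (R ⊓ Q) (res V₁ inf_le_right w) (res V₂ inf_le_left v)) where
  add R v v' := by rw [res_add, hB.add_right, toN_add]
  smul R a v := by rw [res_smul, hB.smul_right, toN_smul]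
  nat R R' i v := by
    rw [← toN_res, ← hB.nat, res_res, res_res, res_res]
end

section
variable {U U' : Man} {h : U ⟶ U'}

theorem pull_unique {V : Mod U'} {N : Mod U} {f g : ∀ R, Sec (pull h V) R → Sec N R}
    (hf : IsLin f) (hg : IsLin g) (H : ∀ W (v : Sec V W), f _ (eta h v) = g _ (eta h v)) :
    f = g := by
  have := pull_hom_ext (h := h) (f := mkHom f hf.1 hf.2 hf.3) (g := mkHom g hg.1 hg.2 hg.3) H
  funext R v
  exact congrArg (fun k => act k v) this

theorem bil_unique {V₁ V₂ : Mod U'} {T : Mod U}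
    {B C : ∀ R, Sec (pull h V₁) R → Sec (pull h V₂) R → Sec T R} (hB : IsBil B) (hC : IsBil C)
    (H : ∀ W (v : Sec V₁ W) (w : Sec V₂ W), B _ (eta h v) (eta h w) = C _ (eta h v) (eta h w)) :
    B = C := by
  have s1 : ∀ W (v : Sec V₁ W) (P : Opens U) (i : P ≤ (pre h).obj W) (w : Sec (pull h V₂) P),
      B P (res _ i (eta h v)) w = C P (res _ i (eta h v)) w := by
    intro W v P i w
    have := pull_unique (hB.lin_right (eta h v)) (hC.lin_right (eta h v)) (by
      intro W' v'
      have := H (W' ⊓ W) (res _ inf_le_right v) (res _ inf_le_left v')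
      rw [eta_res, eta_res] at this
      exact this)
    have := congrArg (res T (le_inf le_rfl i)) (congrArg ofN (congrFun (congrFun this P) w))
    rw [ofN_toN, ofN_toN, ← hB.nat, ← hC.nat, res_res, res_res, res_refl] at this
    exact this
  funext R v w
  have := pull_unique (hB.lin_left w) (hC.lin_left w) (by
    intro W' v'
    exact s1 _ _ _ _ _)
  have := congrArg (res T (le_inf le_rfl le_rfl)) (congrArg ofN (congrFun (congrFun this R) v))
  rw [ofN_toN, ofN_toN, ← hB.nat, ← hC.nat, res_res, res_res, res_refl, res_refl] at this
  exact this

theorem lin_exists {V : Mod U'} {N : Mod U} (f : ∀ W, Sec V W → Sec N ((pre h).obj W))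
    (add : ∀ W v w, f W (v + w) = f W v + f W w)
    (smul : ∀ W (a : Fn U' W) v, f W (a • v) = Hom.fnPull h W a • f W v)
    (nat : ∀ W W' (i : W' ≤ W) v,
      f W' (res V i v) = res N ((pre h).map (homOfLE i)).le (f W v)) :
    ∃ g : ∀ R, Sec (pull h V) R → Sec N R, IsLin g ∧ ∀ W (v : Sec V W), g _ (eta h v) = f W v := by
  obtain ⟨g, hg⟩ := pull_exists h f add smul nat
  exact ⟨fun R v => act g v, ⟨fun R => act_add g, fun R => act_smul g, fun R R' i => act_res g i⟩, hg⟩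

theorem rs_fnPull {W W' : Opens U'} (i : W' ≤ W) (a : Fn U' W) :
    Hom.fnPull h W' (Fn.rs i a) = Fn.rs ((pre h).map (homOfLE i)).le (Hom.fnPull h W a) := rfl

theorem pre_inf (W W' : Opens U') : (pre h).obj W ⊓ (pre h).obj W' ≤ (pre h).obj (W ⊓ W') :=
  fun _ hx => hx

theorem bil_exists {V₁ V₂ : Mod U'} {T : Mod U}
    {β : ∀ W, Sec V₁ W → Sec V₂ W → Sec T ((pre h).obj W)} (hβ : IsBilOver h β) :
    ∃ B : ∀ R, Sec (pull h V₁) R → Sec (pull h V₂) R → Sec T R, IsBil B ∧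
      ∀ W v w, B _ (eta h v) (eta h w) = β W v w := by
  have s1 : ∀ W (v : Sec V₁ W), ∃ g : ∀ R, Sec (pull h V₂) R → Sec (near T ((pre h).obj W)) R,
      IsLin g ∧ ∀ W' (w : Sec V₂ W'), g _ (eta h w) =
        toN (res T (pre_inf _ _) (β (W' ⊓ W) (res _ inf_le_right v) (res _ inf_le_left w))) := by
    intro W v
    apply lin_exists
    · intro W' w w'
      rw [res_add, hβ.add_right, res_add, toN_add]
    · intro W' a w
      rw [res_smul, hβ.smul_right, res_smul, rs_fnPull, rs_rs, toN_smul]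
    · intro W' W'' i w
      rw [← toN_res, res_res]
      have := hβ.nat _ _ (inf_le_inf_right W i) (res _ inf_le_right v) (res _ inf_le_left w)
      rw [res_res, res_res] at this
      rw [res_res, this, res_res]
  choose G hG hG' using s1
  have G_add : ∀ W v v', G W (v + v') = fun R w => G W v R w + G W v' R w := by
    intro W v v'
    apply pull_unique (hG _ _)
    · constructor
      · intro R a b
        rw [(hG _ _).add, (hG _ _).add]; abel
      · intro R a b
        rw [(hG _ _).smul, (hG _ _).smul, smul_add]
      · intro R R' i b
        rw [(hG _ _).nat, (hG _ _).nat, res_add]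
    · intro W' w
      rw [hG', hG', hG', res_add, hβ.add_left, res_add, toN_add]
  have G_smul : ∀ W (a : Fn U' W) v, G W (a • v) = fun R w =>
      toN (Fn.rs (inf_le_right : R ⊓ (pre h).obj W ≤ _) (Hom.fnPull h W a) • ofN (G W v R w)) := by
    intro W a v
    apply pull_unique (hG _ _)
    · constructor
      · intro R b c
        rw [(hG _ _).add, ofN_add, smul_add, toN_add]
      · intro R b c
        rw [(hG _ _).smul, ofN_smul, smul_smul_comm, toN_smul]
      · intro R R' i b
        rw [(hG _ _).nat, ofN_res, ← toN_res, res_smul, rs_rs]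
    · intro W' w
      rw [hG', hG', res_smul, hβ.smul_left, ofN_toN, res_smul, rs_fnPull, rs_rs]
  have G_res : ∀ W W' (i : W' ≤ W) v, G W' (res _ i v) = fun R w =>
      toN (res T (inf_le_inf_left R ((pre h).map (homOfLE i)).le) (ofN (G W v R w))) := by
    intro W W' i v
    apply pull_unique (hG _ _)
    · constructor
      · intro R b c
        rw [(hG _ _).add, ofN_add, res_add, toN_add]
      · intro R b c
        rw [(hG _ _).smul, ofN_smul, res_smul, rs_rs, toN_smul]
      · intro R R' j b
        rw [(hG _ _).nat, ofN_res, ← toN_res, res_res, res_res]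
    · intro W'' w
      rw [hG', hG', ofN_toN, res_res]
      have := hβ.nat _ _ (inf_le_inf_left W'' i) (res _ inf_le_right v) (res _ inf_le_left w)
      rw [res_res, res_res] at this
      rw [res_res, this, res_res]
  have s2 : ∀ Q (w : Sec (pull h V₂) Q), ∃ k : ∀ R, Sec (pull h V₁) R → Sec (near T Q) R,
      IsLin k ∧ ∀ W (v : Sec V₁ W), k _ (eta h v) =
        toN (res T (le_inf inf_le_right inf_le_left) (ofN (G W v Q w))) := by
    intro Q w
    apply lin_exists
    · intro W v v'
      rw [G_add, ofN_add, res_add, toN_add]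
    · intro W a v
      rw [G_smul, ofN_toN, res_smul, rs_rs, toN_smul]
    · intro W W' i v
      rw [G_res, ofN_toN, ← toN_res, res_res, res_res]
  choose K hK hK' using s2
  have K_add : ∀ Q w w', K Q (w + w') = fun R v => K Q w R v + K Q w' R v := by
    intro Q w w'
    apply pull_unique (hK _ _)
    · constructor
      · intro R a b
        rw [(hK _ _).add, (hK _ _).add]; abel
      · intro R a b
        rw [(hK _ _).smul, (hK _ _).smul, smul_add]
      · intro R R' i b
        rw [(hK _ _).nat, (hK _ _).nat, res_add]
    · intro W v
      rw [hK', hK', hK', (hG _ _).add, ofN_add, res_add, toN_add]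
  have K_smul : ∀ Q (a : Fn U Q) w, K Q (a • w) = fun R v =>
      toN (Fn.rs (inf_le_right : R ⊓ Q ≤ Q) a • ofN (K Q w R v)) := by
    intro Q a w
    apply pull_unique (hK _ _)
    · constructor
      · intro R b c
        rw [(hK _ _).add, ofN_add, smul_add, toN_add]
      · intro R b c
        rw [(hK _ _).smul, ofN_smul, smul_smul_comm, toN_smul]
      · intro R R' i b
        rw [(hK _ _).nat, ofN_res, ← toN_res, res_smul, rs_rs]
    · intro W v
      rw [hK', hK', (hG _ _).smul, ofN_smul, res_smul, rs_rs, ofN_toN]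
  have K_res : ∀ Q Q' (i : Q' ≤ Q) w, K Q' (res _ i w) = fun R v =>
      toN (res T (inf_le_inf_left R i) (ofN (K Q w R v))) := by
    intro Q Q' i w
    apply pull_unique (hK _ _)
    · constructor
      · intro R b c
        rw [(hK _ _).add, ofN_add, res_add, toN_add]
      · intro R b c
        rw [(hK _ _).smul, ofN_smul, res_smul, rs_rs, toN_smul]
      · intro R R' j b
        rw [(hK _ _).nat, ofN_res, ← toN_res, res_res, res_res]
    · intro W v
      rw [hK', hK', (hG _ _).nat, ofN_res, ofN_toN, res_res, res_res]
  refine ⟨fun R v w => res T (le_inf le_rfl le_rfl) (ofN (K R w R v)), ?_, ?_⟩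
  · constructor
    · intro R v v' w
      rw [(hK _ _).add, ofN_add, res_add]
    · intro R v v' w
      rw [K_add, ofN_add, res_add]
    · intro R a v w
      rw [(hK _ _).smul, ofN_smul, res_smul, rs_rs, rs_refl]
    · intro R a v w
      rw [K_smul, ofN_toN, res_smul, rs_rs, rs_refl]
    · intro R R' i v w
      rw [K_res, ofN_toN, (hK _ _).nat, ofN_res, res_res, res_res, res_res]
  · intro W v w
    dsimp only
    rw [hK', hG', ofN_toN, ofN_toN, res_res, res_res]
    have := hβ.nat _ _ (le_inf le_rfl le_rfl : W ≤ W ⊓ W) (res V₁ inf_le_right v)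
      (res V₂ inf_le_left w)
    rw [res_res, res_res, res_refl, res_refl] at this
    exact this.symm

end

/-! Coherence of pullbacks of sheaves of modules. -/
section
variable {U U' U'' : Man}

theorem pullMap_exists (h : U ⟶ U') {V N : Mod U'} (f : V ⟶ N) :
    ∃ g : pull h V ⟶ pull h N, ∀ W (v : Sec V W), act g (eta h v) = eta h (act f v) :=
  pull_exists h (fun _ v => eta h (act f v)) (fun _ v w => by rw [act_add, eta_add])
    (fun _ a v => by rw [act_smul, eta_smul]) (fun _ _ i v => by rw [act_res, eta_res])

/-- Functoriality of the pullback. -/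
def pullMap (h : U ⟶ U') {V N : Mod U'} (f : V ⟶ N) : pull h V ⟶ pull h N :=
  (pullMap_exists h f).choose

theorem pullMap_eta (h : U ⟶ U') {V N : Mod U'} (f : V ⟶ N) {W} (v : Sec V W) :
    act (pullMap h f) (eta h v) = eta h (act f v) :=
  (pullMap_exists h f).choose_spec W v

theorem pullId_exists (V : Mod U) : ∃ g : pull (𝟙 U) V ⟶ V,
    ∀ W (v : Sec V W), act g (eta (𝟙 U) v) = v :=
  pull_exists (𝟙 U) (fun _ v => v) (fun _ _ _ => rfl) (fun _ _ _ => rfl) (fun _ _ _ _ => rfl)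

/-- The unit isomorphism for pullbacks. -/
def pullId (V : Mod U) : pull (𝟙 U) V ≅ V where
  hom := (pullId_exists V).choose
  inv := mkHom (fun W v => (eta (𝟙 U) v : Sec (pull (𝟙 U) V) W))
    (fun _ => eta_add _) (fun _ => eta_smul _) (fun _ _ => eta_res _)
  hom_inv_id := pull_hom_ext _ fun W v => by
    rw [act_comp, (pullId_exists V).choose_spec]; rfl
  inv_hom_id := act_ext fun W v => (pullId_exists V).choose_spec W v

theorem pullId_eta (V : Mod U) {W} (v : Sec V W) : act (pullId V).hom (eta (𝟙 U) v) = v :=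
  (pullId_exists V).choose_spec W v

theorem pullComp_exists (h : U ⟶ U') (k : U' ⟶ U'') (V : Mod U'') :
    ∃ g : pull (h ≫ k) V ⟶ pull h (pull k V),
      ∀ W (v : Sec V W), act g (eta (h ≫ k) v) = eta h (eta k v) :=
  pull_exists (h ≫ k) (fun _ v => eta h (eta k v)) (fun _ v w => by rw [eta_add, eta_add]; rfl)
    (fun _ a v => by rw [eta_smul, eta_smul]; rfl) (fun _ _ i v => by rw [eta_res, eta_res]; rfl)

theorem pullComp_exists' (h : U ⟶ U') (k : U' ⟶ U'') (V : Mod U'') :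
    ∃ g : pull h (pull k V) ⟶ pull (h ≫ k) V,
      ∀ W (v : Sec V W), act g (eta h (eta k v)) = eta (h ≫ k) v := by
  obtain ⟨p, hp⟩ := pull_exists (N := (push h).obj (pull (h ≫ k) V)) k
    (fun W v => (eta (h ≫ k) v : Sec (pull (h ≫ k) V) ((pre (h ≫ k)).obj W)))
    (fun _ => eta_add _) (fun _ => eta_smul _) (fun _ _ => eta_res _)
  obtain ⟨g, hg⟩ := pull_exists (N := pull (h ≫ k) V) h (fun W v => act p v)
    (fun _ => act_add _) (fun _ => act_smul _) (fun _ _ => act_res _)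
  refine ⟨g, fun W v => ?_⟩
  exact (hg _ _).trans (hp _ _)

theorem pull_hom_ext₂ (h : U ⟶ U') (k : U' ⟶ U'') {V : Mod U''} {N : Mod U}
    {f g : pull h (pull k V) ⟶ N}
    (H : ∀ W (v : Sec V W), act f (eta h (eta k v)) = act g (eta h (eta k v))) : f = g := by
  have : mkHom (V := pull k V) (N := (push h).obj N) (fun W v => act f (eta h v))
      (fun _ v w => by rw [eta_add, act_add]; rfl) (fun _ a v => by rw [eta_smul, act_smul]; rfl)
      (fun _ _ i v => by rw [eta_res, act_res]; rfl) =
    mkHom (V := pull k V) (N := (push h).obj N) (fun W v => act g (eta h v))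
      (fun _ v w => by rw [eta_add, act_add]; rfl) (fun _ a v => by rw [eta_smul, act_smul]; rfl)
      (fun _ _ i v => by rw [eta_res, act_res]; rfl) := pull_hom_ext k H
  exact pull_hom_ext h fun W v => congrArg (fun p => act p v) this

/-- The composition isomorphism for pullbacks. -/
def pullComp (h : U ⟶ U') (k : U' ⟶ U'') (V : Mod U'') : pull (h ≫ k) V ≅ pull h (pull k V) where
  hom := (pullComp_exists h k V).choose
  inv := (pullComp_exists' h k V).choose
  hom_inv_id := pull_hom_ext _ fun W v => by
    rw [act_comp, (pullComp_exists h k V).choose_spec]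
    exact (pullComp_exists' h k V).choose_spec W v
  inv_hom_id := pull_hom_ext₂ _ _ fun W v => by
    rw [act_comp, (pullComp_exists' h k V).choose_spec]
    exact (pullComp_exists h k V).choose_spec W v

theorem pullComp_eta (h : U ⟶ U') (k : U' ⟶ U'') (V : Mod U'') {W} (v : Sec V W) :
    act (pullComp h k V).hom (eta (h ≫ k) v) = eta h (eta k v) :=
  (pullComp_exists h k V).choose_spec W v

theorem pullComp_inv_eta (h : U ⟶ U') (k : U' ⟶ U'') (V : Mod U'') {W} (v : Sec V W) :
    act (pullComp h k V).inv (eta h (eta k v)) = eta (h ≫ k) v :=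
  (pullComp_exists' h k V).choose_spec W v

end

/-- Pullback functors with coherent unit and composition isomorphisms. -/
structure Pullbacks (C : Man → Type 1) [∀ U, Category.{0} (C U)] where
  pb : ∀ {U U' : Man}, (U ⟶ U') → C U' ⥤ C U
  pbId : ∀ U : Man, pb (𝟙 U) ≅ 𝟭 (C U)
  pbComp : ∀ {U U' U'' : Man} (h : U ⟶ U') (k : U' ⟶ U''), pb (h ≫ k) ≅ pb k ⋙ pb h
  assoc : ∀ {U U' U'' U''' : Man} (h : U ⟶ U') (k : U' ⟶ U'') (l : U'' ⟶ U''') (X : C U'''),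
    (pbComp (h ≫ k) l).hom.app X ≫ (pbComp h k).hom.app ((pb l).obj X) =
      (pbComp h (k ≫ l)).hom.app X ≫ (pb h).map ((pbComp k l).hom.app X)
  left_unit : ∀ {U U' : Man} (h : U ⟶ U') (X : C U'),
    (pbComp (𝟙 U) h).hom.app X ≫ (pbId U).hom.app ((pb h).obj X) = 𝟙 ((pb h).obj X)
  right_unit : ∀ {U U' : Man} (h : U ⟶ U') (X : C U'),
    (pbComp h (𝟙 U')).hom.app X ≫ (pb h).map ((pbId U').hom.app X) = 𝟙 ((pb h).obj X)

theorem cancel_aux {D : Type*} [Category D] {A B B' C : D} (p : A ≅ B) (q : B ≅ C) (r : A ⟶ B')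
    (s : B' ⟶ C) (H : p.hom ≫ q.hom = r ≫ s) : r ≫ s ≫ 𝟙 C ≫ q.inv ≫ p.inv = 𝟙 A := by
  rw [← Category.assoc, ← H]
  simp

theorem unit_aux {D : Type*} [Category D] {A B : D} (p : A ⟶ B) (q : B ⟶ A) (H : p ≫ q = 𝟙 A) :
    p ≫ q ≫ 𝟙 A = 𝟙 A := by
  rw [Category.comp_id, H]

/-- The associated pseudofunctor. -/
def Pullbacks.toPseudofunctor {C : Man → Type 1} [∀ U, Category.{0} (C U)] (P : Pullbacks C) :
    Pseudofunctor (LocallyDiscrete Manᵒᵖ) Cat.{0, 1} :=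
  LocallyDiscrete.mkPseudofunctor
    (fun U => Cat.of (C U.unop))
    (fun h => (P.pb h.unop).toCatHom)
    (fun U => Cat.Hom.isoMk (P.pbId U.unop))
    (fun h k => Cat.Hom.isoMk (P.pbComp k.unop h.unop))
    (by
      intro a b c d f g h
      apply Cat.Hom₂.ext
      ext X
      have H := P.assoc h.unop g.unop f.unop X
      change (P.pbComp h.unop (g.unop ≫ f.unop)).hom.app X ≫
        (P.pb h.unop).map ((P.pbComp g.unop f.unop).hom.app X) ≫ 𝟙 _ ≫
        (P.pbComp h.unop g.unop).inv.app ((P.pb f.unop).obj X) ≫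
        (P.pbComp (h.unop ≫ g.unop) f.unop).inv.app X = 𝟙 _
      exact cancel_aux ((P.pbComp (h.unop ≫ g.unop) f.unop).app X)
        ((P.pbComp h.unop g.unop).app ((P.pb f.unop).obj X)) _ _ H)
    (by
      intro a b f
      apply Cat.Hom₂.ext
      ext X
      change (P.pbComp f.unop (𝟙 a.unop)).hom.app X ≫
        (P.pb f.unop).map ((P.pbId a.unop).hom.app X) ≫ 𝟙 _ = 𝟙 _
      exact unit_aux _ _ (P.right_unit f.unop X))
    (by
      intro a b f
      apply Cat.Hom₂.ext
      ext X
      change (P.pbComp (𝟙 b.unop) f.unop).hom.app X ≫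
        (P.pbId b.unop).hom.app ((P.pb f.unop).obj X) ≫ 𝟙 _ = 𝟙 _
      exact unit_aux _ _ (P.left_unit f.unop X))

/-- Antilinear maps of sheaves of modules. -/
structure IsConj {U : Man} {V N : Mod U} (f : ∀ R, Sec V R → Sec N R) : Prop where
  add : ∀ R v w, f R (v + w) = f R v + f R w
  smul : ∀ R (a : Fn U R) v, f R (a • v) = conjFn R a • f R v
  nat : ∀ R R' (i : R' ≤ R) v, f R' (res _ i v) = res N i (f R v)

/-- The structure sheaf as a sheaf of modules. -/
abbrev unitMod (U : Man) : Mod U := SheafOfModules.unit.{0} (O U)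

theorem rs_conjFn {U : Man} {W W' : Opens U} (i : W' ≤ W) (a : Fn U W) :
    conjFn W' (Fn.rs i a) = Fn.rs i (conjFn W a) := rfl

section
variable {U U' : Man} {h : U ⟶ U'}

theorem IsConj.comp {V N P : Mod U} {f : ∀ R, Sec V R → Sec N R} {g : ∀ R, Sec N R → Sec P R}
    (hg : IsConj g) (hf : IsConj f) : IsLin fun R v => g R (f R v) where
  add R v w := by rw [hf.add, hg.add]
  smul R a v := by rw [hf.smul, hg.smul, conjFn_conjFn]
  nat R R' i v := by rw [hf.nat, hg.nat]

theorem isLin_id {V : Mod U} : IsLin fun R (v : Sec V R) => v := ⟨fun _ _ _ => rfl, fun _ _ _ => rfl, fun _ _ _ _ => rfl⟩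
theorem isLin_act {V N : Mod U} (f : V ⟶ N) : IsLin fun R (v : Sec V R) => act f v :=
  ⟨fun _ => act_add f, fun _ => act_smul f, fun _ _ => act_res f⟩

theorem IsConj.act_left {V N P : Mod U} {f : ∀ R, Sec V R → Sec N R} (hf : IsConj f) (g : N ⟶ P) :
    IsConj fun R v => act g (f R v) where
  add R v w := by rw [hf.add, act_add]
  smul R a v := by rw [hf.smul, act_smul]
  nat R R' i v := by rw [hf.nat, act_res]

theorem IsConj.act_right {V N P : Mod U} {f : ∀ R, Sec N R → Sec P R} (hf : IsConj f) (g : V ⟶ N) :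
    IsConj fun R v => f R (act g v) where
  add R v w := by rw [act_add, hf.add]
  smul R a v := by rw [act_smul, hf.smul]
  nat R R' i v := by rw [act_res, hf.nat]

theorem IsBil.act_left {V₁ V₂ T T' : Mod U} {B : ∀ R, Sec V₁ R → Sec V₂ R → Sec T R} (hB : IsBil B)
    (g : T ⟶ T') : IsBil fun R v w => act g (B R v w) where
  add_left R v w u := by rw [hB.add_left, act_add]
  add_right R v w u := by rw [hB.add_right, act_add]
  smul_left R a v u := by rw [hB.smul_left, act_smul]
  smul_right R a v u := by rw [hB.smul_right, act_smul]
  nat R R' i v w := by rw [hB.nat, act_res]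

theorem IsBil.act_right {V₁ V₂ N₁ N₂ T : Mod U} {B : ∀ R, Sec V₁ R → Sec V₂ R → Sec T R}
    (hB : IsBil B) (f : N₁ ⟶ V₁) (g : N₂ ⟶ V₂) : IsBil fun R v w => B R (act f v) (act g w) where
  add_left R v w u := by rw [act_add, hB.add_left]
  add_right R v w u := by rw [act_add, hB.add_right]
  smul_left R a v u := by rw [act_smul, hB.smul_left]
  smul_right R a v u := by rw [act_smul, hB.smul_right]
  nat R R' i v w := by rw [act_res, act_res, hB.nat]

theorem IsBil.swap {V₁ V₂ T : Mod U} {B : ∀ R, Sec V₁ R → Sec V₂ R → Sec T R} (hB : IsBil B) :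
    IsBil fun R v w => B R w v where
  add_left R v w u := by rw [hB.add_right]
  add_right R v w u := by rw [hB.add_left]
  smul_left R a v u := by rw [hB.smul_right]
  smul_right R a v u := by rw [hB.smul_left]
  nat R R' i v w := by rw [hB.nat]

theorem IsBil.conj {V₁ V₂ N₁ N₂ T T' : Mod U} {B : ∀ R, Sec V₁ R → Sec V₂ R → Sec T R}
    {f : ∀ R, Sec N₁ R → Sec V₁ R} {g : ∀ R, Sec N₂ R → Sec V₂ R} {k : ∀ R, Sec T R → Sec T' R}
    (hB : IsBil B) (hk : IsConj k) (hf : IsConj f) (hg : IsConj g) :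
    IsBil fun R v w => k R (B R (f R v) (g R w)) where
  add_left R v w u := by rw [hf.add, hB.add_left, hk.add]
  add_right R v w u := by rw [hg.add, hB.add_right, hk.add]
  smul_left R a v u := by rw [hf.smul, hB.smul_left, hk.smul, conjFn_conjFn]
  smul_right R a v u := by rw [hg.smul, hB.smul_right, hk.smul, conjFn_conjFn]
  nat R R' i v w := by rw [hf.nat, hg.nat, hB.nat, hk.nat]

theorem conj_exists {V : Mod U'} {σ : ∀ W, Sec V W → Sec V W} (hσ : IsConj σ) :
    ∃ g : ∀ R, Sec (pull h V) R → Sec (pull h V) R, IsConj g ∧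
      ∀ W (v : Sec V W), g _ (eta h v) = eta h (σ W v) := by
  obtain ⟨g, g1, g2, g3, g4⟩ := cj_exists (h := h) (N := pull h V) (fun W v => eta h (σ W v))
    (fun W v w => by rw [hσ.add, eta_add]) (fun W a v => by rw [hσ.smul, eta_smul]; rfl)
    (fun W W' i v => by rw [hσ.nat, eta_res])
  exact ⟨g, ⟨g1, g2, g3⟩, g4⟩

theorem conj_unique {V : Mod U'} {N : Mod U} {f g : ∀ R, Sec (pull h V) R → Sec N R}
    (hf : IsConj f) (hg : IsConj g)
    (H : ∀ W (v : Sec V W), f _ (eta h v) = g _ (eta h v)) : f = g :=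
  cj_unique f g hf.1 hf.2 hf.3 hg.1 hg.2 hg.3 H

theorem isConj_conjFn : IsConj (V := unitMod U) (N := unitMod U) (fun R v => conjFn R v) where
  add R v w := map_add (conjFn R) v w
  smul R v w := map_mul (conjFn R) v w
  nat _ _ _ _ := rfl

end

/-- An inner product vector space over the base: a sheaf of modules over the sheaf of
complex-valued smooth functions, with an antilinear involution and a compatible symmetric
bilinear pairing valued in smooth functions. -/
structure IPVec (U : Man) where
  sh : Mod U
  star : ∀ W, Sec sh W → Sec sh W
  pair : ∀ W, Sec sh W → Sec sh W → Fn U W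
  star_conj : IsConj star
  star_star : ∀ W v, star W (star W v) = v
  pair_bil : IsBil (T := unitMod U) pair
  pair_symm : ∀ W v w, pair W v w = pair W w v
  pair_star : ∀ W v w, conjFn W (pair W v w) = pair W (star W v) (star W w)

/-- Morphisms preserve the involution and the pairing. -/
@[ext] structure IPVec.Hom {U : Man} (X Y : IPVec U) where
  hom : X.sh ⟶ Y.sh
  star : ∀ W (v : Sec X.sh W), act hom (X.star W v) = Y.star W (act hom v)
  pair : ∀ W (v w : Sec X.sh W), Y.pair W (act hom v) (act hom w) = X.pair W v w

instance (U : Man) : Category (IPVec U) where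
  Hom := IPVec.Hom
  id X := ⟨𝟙 _, fun _ _ => rfl, fun _ _ _ => rfl⟩
  comp f g := ⟨f.hom ≫ g.hom, fun W v => by rw [act_comp, f.star, g.star, act_comp],
    fun W v w => by rw [act_comp, act_comp, g.pair, f.pair]⟩

/-- A sheaf of unital associative star-algebras over the sheaf of complex-valued smooth
functions. -/
structure StarAlg (U : Man) where
  sh : Mod U
  mul : ∀ W, Sec sh W → Sec sh W → Sec sh W
  one : ∀ W, Sec sh W
  star : ∀ W, Sec sh W → Sec sh W
  mul_bil : IsBil mul
  mul_assoc : ∀ W a b c, mul W (mul W a b) c = mul W a (mul W b c)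
  one_res : ∀ W W' (i : W' ≤ W), res sh i (one W) = one W'
  one_mul : ∀ W a, mul W (one W) a = a
  mul_one : ∀ W a, mul W a (one W) = a
  star_conj : IsConj star
  star_star : ∀ W v, star W (star W v) = v
  star_mul : ∀ W a b, star W (mul W a b) = mul W (star W b) (star W a)

/-- Morphisms of sheaves of unital star-algebras. -/
@[ext] structure StarAlg.Hom {U : Man} (X Y : StarAlg U) where
  hom : X.sh ⟶ Y.sh
  mul : ∀ W (a b : Sec X.sh W), act hom (X.mul W a b) = Y.mul W (act hom a) (act hom b)
  one : ∀ W, act hom (X.one W) = Y.one W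
  star : ∀ W (v : Sec X.sh W), act hom (X.star W v) = Y.star W (act hom v)

instance (U : Man) : Category (StarAlg U) where
  Hom := StarAlg.Hom
  id X := ⟨𝟙 _, fun _ _ _ => rfl, fun _ => rfl, fun _ _ => rfl⟩
  comp f g := ⟨f.hom ≫ g.hom, fun W a b => by rw [act_comp, f.mul, g.mul, act_comp, act_comp],
    fun W => by rw [act_comp, f.one, g.one], fun W v => by rw [act_comp, f.star, g.star, act_comp]⟩

namespace IPVec
variable {U U' U'' : Man}

theorem star_exists (h : U ⟶ U') (X : IPVec U') :
    ∃ g : ∀ R, Sec (pull h X.sh) R → Sec (pull h X.sh) R, IsConj g ∧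
      ∀ W (v : Sec X.sh W), g _ (eta h v) = eta h (X.star W v) := conj_exists X.star_conj

theorem pair_exists (h : U ⟶ U') (X : IPVec U') :
    ∃ B : ∀ R, Sec (pull h X.sh) R → Sec (pull h X.sh) R → Fn U R, IsBil (T := unitMod U) B ∧
      ∀ W v w, B _ (eta h v) (eta h w) = Hom.fnPull h W (X.pair W v w) :=
  bil_exists (T := unitMod U) (β := fun W v w => Hom.fnPull h W (X.pair W v w))
    { add_left := fun W v w u => by rw [X.pair_bil.add_left]; exact map_add (Hom.fnPull h W) _ _
      add_right := fun W v w u => by rw [X.pair_bil.add_right]; exact map_add (Hom.fnPull h W) _ _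
      smul_left := fun W v w u => by rw [X.pair_bil.smul_left]; exact map_mul (Hom.fnPull h W) _ _
      smul_right := fun W v w u => by rw [X.pair_bil.smul_right]; exact map_mul (Hom.fnPull h W) _ _
      nat := fun W W' i v w => by rw [X.pair_bil.nat]; rfl }

/-- Pullback along a smooth map, with the induced involution and pairing. -/
abbrev pb (h : U ⟶ U') (X : IPVec U') : IPVec U where
  sh := pull h X.sh
  star := (star_exists h X).choose
  pair := (pair_exists h X).choose
  star_conj := (star_exists h X).choose_spec.1
  star_star W v := congrFun (congrFun (pull_unique
    ((star_exists h X).choose_spec.1.comp (star_exists h X).choose_spec.1) isLin_id (by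
      intro W v
      rw [(star_exists h X).choose_spec.2, (star_exists h X).choose_spec.2, X.star_star])) W) v
  pair_bil := (pair_exists h X).choose_spec.1
  pair_symm W v w := congrFun (congrFun (congrFun (bil_unique (pair_exists h X).choose_spec.1
    (pair_exists h X).choose_spec.1.swap (by
      intro W v w
      rw [(pair_exists h X).choose_spec.2, (pair_exists h X).choose_spec.2, X.pair_symm])) W) v) w
  pair_star W v w := by
    have hs := (star_exists h X).choose_spec
    have hp := (pair_exists h X).choose_spec
    have := congrFun (congrFun (congrFun (bil_unique hp.1
      (hp.1.conj isConj_conjFn hs.1 hs.1) (by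
        intro W v w
        refine (hp.2 W v w).trans (Eq.trans ?_ (congrArg (conjFn _)
          ((congrArg₂ _ (hs.2 W v) (hs.2 W w)).trans (hp.2 W _ _))).symm)
        rw [← X.pair_star]
        exact Fn.ext fun x => (Complex.conj_conj _).symm)) W) v) w
    exact (congrArg (conjFn W) this).trans (conjFn_conjFn (U := U) _)

theorem pb_star (h : U ⟶ U') (X : IPVec U') {W} (v : Sec X.sh W) :
    (pb h X).star _ (eta h v) = eta h (X.star W v) := (star_exists h X).choose_spec.2 W v

theorem pb_pair (h : U ⟶ U') (X : IPVec U') {W} (v w : Sec X.sh W) :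
    (pb h X).pair _ (eta h v) (eta h w) = Hom.fnPull h W (X.pair W v w) :=
  (pair_exists h X).choose_spec.2 W v w

@[ext] theorem hom_ext {X Y : IPVec U} {f g : X ⟶ Y} (H : f.hom = g.hom) : f = g := Hom.ext H

/-- A morphism out of a pullback, from its values on pulled back sections. -/
def mkPb {h : U ⟶ U'} {X : IPVec U'} {Y : IPVec U} (f : pull h X.sh ⟶ Y.sh)
    (star : ∀ W (v : Sec X.sh W), act f (eta h (X.star W v)) = Y.star _ (act f (eta h v)))
    (pair : ∀ W (v w : Sec X.sh W),
      Y.pair _ (act f (eta h v)) (act f (eta h w)) = Hom.fnPull h W (X.pair W v w)) :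
    pb h X ⟶ Y where
  hom := f
  star W v := congrFun (congrFun (conj_unique ((pb h X).star_conj.act_left f)
    (Y.star_conj.act_right f) (by
      intro W v
      rw [pb_star, star])) W) v
  pair W v w := congrFun (congrFun (congrFun (bil_unique (Y.pair_bil.act_right f f)
    (pb h X).pair_bil (by
      intro W v w
      rw [pb_pair, pair])) W) v) w

/-- An isomorphism from a structure-preserving map that is invertible on sheaves. -/
def mkIso {X Y : IPVec U} (e : X.sh ≅ Y.sh) (f : X ⟶ Y) (hf : f.hom = e.hom) : X ≅ Y where
  hom := f
  inv :=
    { hom := e.inv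
      star := fun W v => by
        have h1 : ∀ W (v : Sec Y.sh W), act f.hom (act e.inv v) = v := fun W v => by
          rw [hf, ← act_comp, e.inv_hom_id, act_id]
        have h2 : ∀ W (v : Sec X.sh W), act e.inv (act f.hom v) = v := fun W v => by
          rw [hf, ← act_comp, e.hom_inv_id, act_id]
        conv_lhs => rw [← h1 W v]
        rw [← f.star, h2]
      pair := fun W v w => by
        have h1 : ∀ W (v : Sec Y.sh W), act f.hom (act e.inv v) = v := fun W v => by
          rw [hf, ← act_comp, e.inv_hom_id, act_id]
        rw [← f.pair, h1, h1] }
  hom_inv_id := hom_ext (by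
    change f.hom ≫ e.inv = 𝟙 _
    rw [hf, e.hom_inv_id])
  inv_hom_id := hom_ext (by
    change e.inv ≫ f.hom = 𝟙 _
    rw [hf, e.inv_hom_id])

/-- The pullback functor. -/
def pbFunctor (h : U ⟶ U') : IPVec U' ⥤ IPVec U where
  obj X := pb h X
  map {X Y} f := mkPb (Y := pb h Y) (pullMap h f.hom)
    (fun W v => by rw [pullMap_eta, pullMap_eta, f.star, pb_star])
    (fun W v w => by rw [pullMap_eta, pullMap_eta, pb_pair, f.pair])
  map_id X := hom_ext (pull_hom_ext h fun W v => pullMap_eta h (𝟙 _) v)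
  map_comp {X Y Z} f g := hom_ext (pull_hom_ext h fun W v => by
    refine (pullMap_eta h (f.hom ≫ g.hom) v).trans ?_
    refine Eq.trans ?_ (congrArg (act (pullMap h g.hom)) (pullMap_eta h f.hom v)).symm
    exact (pullMap_eta h g.hom _).symm)

def pbId (X : IPVec U) : pb (𝟙 U) X ≅ X :=
  mkIso (pullId X.sh) (mkPb (pullId X.sh).hom
    (fun W v => by rw [pullId_eta, pullId_eta]; rfl)
    (fun W v w => by rw [pullId_eta, pullId_eta]; rfl)) rfl

def pbComp (h : U ⟶ U') (k : U' ⟶ U'') (X : IPVec U'') : pb (h ≫ k) X ≅ pb h (pb k X) :=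
  mkIso (Y := pb h (pb k X)) (pullComp h k X.sh) (mkPb (pullComp h k X.sh).hom
    (fun W v => by
      rw [pullComp_eta, pullComp_eta]
      refine Eq.trans ?_ (pb_star h (pb k X) (W := (pre k).obj W) (eta k v)).symm
      rw [pb_star])
    (fun W v w => by
      rw [pullComp_eta, pullComp_eta]
      refine Eq.trans (pb_pair h (pb k X) (W := (pre k).obj W) (eta k v) (eta k w)) ?_
      rw [pb_pair]; rfl)) rfl


theorem hom_act {X Y Z : IPVec U} (f : X ⟶ Y) (g : Y ⟶ Z) {W} (v : Sec X.sh W) :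
    act (f ≫ g).hom v = act g.hom (act f.hom v) := rfl

theorem map_eta (h : U ⟶ U') {X Y : IPVec U'} (f : X ⟶ Y) {W} (v : Sec X.sh W) :
    act ((pbFunctor h).map f).hom (eta h v) = eta h (act f.hom v) := pullMap_eta h f.hom v

theorem pbId_eta (X : IPVec U) {W} (v : Sec X.sh W) :
    act (pbId X).hom.hom (eta (𝟙 U) v) = v := pullId_eta X.sh v

theorem pbComp_eta (h : U ⟶ U') (k : U' ⟶ U'') (X : IPVec U'') {W} (v : Sec X.sh W) :
    act (pbComp h k X).hom.hom (eta (h ≫ k) v) = eta h (eta k v) := pullComp_eta h k X.sh v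

theorem pb_hom_ext {h : U ⟶ U'} {X : IPVec U'} {Y : IPVec U} {f g : pb h X ⟶ Y}
    (H : ∀ W (v : Sec X.sh W), act f.hom (eta h v) = act g.hom (eta h v)) : f = g :=
  hom_ext (pull_hom_ext h H)

/-- The coherent system of pullback functors. -/
def pullbacks : Pullbacks IPVec where
  pb h := pbFunctor h
  pbId U := NatIso.ofComponents (F := pbFunctor (𝟙 U)) (G := 𝟭 _) (fun X => pbId X)
    (fun {X Y} f => pb_hom_ext (h := 𝟙 U) fun W v => by
      refine (congrArg (act (pbId Y).hom.hom) (map_eta (𝟙 U) f v)).trans ?_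
      refine (pbId_eta Y _).trans ?_
      exact (congrArg (act f.hom) (pbId_eta X v)).symm)
  pbComp h k := NatIso.ofComponents (F := pbFunctor (h ≫ k)) (G := pbFunctor k ⋙ pbFunctor h)
    (fun X => pbComp h k X)
    (fun {X Y} f => pb_hom_ext (h := h ≫ k) fun W v => by
      refine (congrArg (act (pbComp h k Y).hom.hom) (map_eta (h ≫ k) f v)).trans ?_
      refine (pbComp_eta h k Y _).trans ?_
      refine Eq.trans ?_ (congrArg (act ((pbFunctor h).map ((pbFunctor k).map f)).hom)
        (pbComp_eta h k X v)).symm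
      refine Eq.trans ?_ (map_eta h ((pbFunctor k).map f) (W := (pre k).obj W) (eta k v)).symm
      exact (congrArg (eta h) (map_eta k f v)).symm)
  assoc h k l X := pb_hom_ext (h := (h ≫ k) ≫ l) fun W v => by
    refine (congrArg (act (pbComp h k (pb l X)).hom.hom) (pbComp_eta (h ≫ k) l X v)).trans ?_
    refine (pbComp_eta h k (pb l X) (W := (pre l).obj W) (eta l v)).trans ?_
    refine Eq.trans ?_ (congrArg (act ((pbFunctor h).map (pbComp k l X).hom).hom)
        (pbComp_eta h (k ≫ l) X v)).symm
    refine Eq.trans ?_ (map_eta h (pbComp k l X).hom (W := (pre (k ≫ l)).obj W)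
      (eta (k ≫ l) v)).symm
    exact (congrArg (eta h) (pbComp_eta k l X v)).symm
  left_unit {U U'} h X := pb_hom_ext (h := 𝟙 U ≫ h) fun W v => by
    refine (congrArg (act (pbId (pb h X)).hom.hom) (pbComp_eta (𝟙 U) h X v)).trans ?_
    exact pbId_eta (pb h X) (W := (pre h).obj W) (eta h v)
  right_unit {U U'} h X := pb_hom_ext (h := h ≫ 𝟙 U') fun W v => by
    refine (congrArg (act ((pbFunctor h).map (pbId X).hom).hom) (pbComp_eta h (𝟙 U') X v)).trans ?_
    refine (map_eta h (pbId X).hom (W := (pre (𝟙 U')).obj W) (eta (𝟙 U') v)).trans ?_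
    exact congrArg (eta h) (pbId_eta X v)

/-- Inner product vector spaces form a pseudofunctor on manifolds. -/
def prestack : Pseudofunctor (LocallyDiscrete Manᵒᵖ) Cat.{0, 1} := pullbacks.toPseudofunctor

end IPVec

namespace StarAlg
variable {U U' U'' : Man}

theorem star_exists (h : U ⟶ U') (X : StarAlg U') :
    ∃ g : ∀ R, Sec (pull h X.sh) R → Sec (pull h X.sh) R, IsConj g ∧
      ∀ W (v : Sec X.sh W), g _ (eta h v) = eta h (X.star W v) := conj_exists X.star_conj

theorem mul_exists (h : U ⟶ U') (X : StarAlg U') :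
    ∃ B : ∀ R, Sec (pull h X.sh) R → Sec (pull h X.sh) R → Sec (pull h X.sh) R, IsBil B ∧
      ∀ W v w, B _ (eta h v) (eta h w) = eta h (X.mul W v w) :=
  bil_exists (T := pull h X.sh) (β := fun W v w => eta h (X.mul W v w))
    { add_left := fun W v w u => by rw [X.mul_bil.add_left, eta_add]
      add_right := fun W v w u => by rw [X.mul_bil.add_right, eta_add]
      smul_left := fun W v w u => by rw [X.mul_bil.smul_left, eta_smul]
      smul_right := fun W v w u => by rw [X.mul_bil.smul_right, eta_smul]
      nat := fun W W' i v w => by rw [X.mul_bil.nat, eta_res] }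

theorem lin_mul_right {V : Mod U} {B : ∀ R, Sec V R → Sec V R → Sec V R} (hB : IsBil B)
    {Q : Opens U} (c : Sec V Q) : IsBil (T := near V Q) fun R a b =>
      toN (B (R ⊓ Q) (res V inf_le_left (B R a b)) (res V inf_le_right c)) where
  add_left R v w u := by rw [hB.add_left, res_add, hB.add_left, toN_add]
  add_right R v w u := by rw [hB.add_right, res_add, hB.add_left, toN_add]
  smul_left R a v u := by rw [hB.smul_left, res_smul, hB.smul_left, toN_smul]
  smul_right R a v u := by rw [hB.smul_right, res_smul, hB.smul_left, toN_smul]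
  nat R R' i v w := by simp only [← toN_res, ← hB.nat, res_res]

theorem lin_mul_left {V : Mod U} {B : ∀ R, Sec V R → Sec V R → Sec V R} (hB : IsBil B)
    {Q : Opens U} (c : Sec V Q) : IsBil (T := near V Q) fun R a b =>
      toN (B (R ⊓ Q) (res V inf_le_left a) (B _ (res V inf_le_left b) (res V inf_le_right c))) where
  add_left R v w u := by rw [res_add, hB.add_left, toN_add]
  add_right R v w u := by rw [res_add, hB.add_left, hB.add_right, toN_add]
  smul_left R a v u := by rw [res_smul, hB.smul_left, toN_smul]
  smul_right R a v u := by rw [res_smul, hB.smul_left, hB.smul_right, toN_smul]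
  nat R R' i v w := by
    rw [← toN_res, ← hB.nat, ← hB.nat, res_res, res_res, res_res, res_res, res_res]

theorem assoc_aux (h : U ⟶ U') (X : StarAlg U')
    {B : ∀ R, Sec (pull h X.sh) R → Sec (pull h X.sh) R → Sec (pull h X.sh) R} (hB : IsBil B)
    (H : ∀ W v w, B _ (eta h v) (eta h w) = eta h (X.mul W v w)) (Q) (a b c : Sec (pull h X.sh) Q) :
    B Q (B Q a b) c = B Q a (B Q b c) := by
  have s1 : ∀ W (a b : Sec X.sh W) (P : Opens U) (i : P ≤ (pre h).obj W) (c : Sec (pull h X.sh) P),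
      B P (B P (res _ i (eta h a)) (res _ i (eta h b))) c =
        B P (res _ i (eta h a)) (B P (res _ i (eta h b)) c) := by
    intro W a b P i c
    have h1 : IsLin (N := near (pull h X.sh) ((pre h).obj W)) fun R (c : Sec (pull h X.sh) R) =>
        toN (B _ (res _ inf_le_right (B _ (eta h a) (eta h b))) (res _ inf_le_left c)) :=
      hB.lin_right _
    have h2 : IsLin (N := near (pull h X.sh) ((pre h).obj W)) fun R (c : Sec (pull h X.sh) R) =>
        toN (B _ (res _ inf_le_right (eta h a))
          (B _ (res _ inf_le_right (eta h b)) (res _ inf_le_left c))) := by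
      constructor
      · intro R v w
        rw [res_add, hB.add_right, hB.add_right, toN_add]
      · intro R a v
        rw [res_smul, hB.smul_right, hB.smul_right, toN_smul]
      · intro R R' i v
        rw [← toN_res, ← hB.nat, ← hB.nat, res_res, res_res, res_res, res_res]
    have := pull_unique h1 h2 (by
      intro W' c
      have e1 := H (W' ⊓ W) (X.mul _ (res _ inf_le_right a) (res _ inf_le_right b))
        (res _ inf_le_left c)
      rw [X.mul_assoc, ← H, ← H, ← H, eta_res, eta_res, eta_res] at e1
      rw [← hB.nat]
      exact e1)
    have := congrArg (res _ (le_inf le_rfl i)) (congrArg ofN (congrFun (congrFun this P) c))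
    simp only [ofN_toN, ← hB.nat, res_res, res_refl] at this
    exact this
  have := bil_unique (lin_mul_right hB c) (lin_mul_left hB c) (by
    intro W a b
    rw [← hB.nat]
    exact congrArg toN (s1 _ _ _ _ _ _))
  have := congrArg (res _ (le_inf le_rfl le_rfl))
    (congrArg ofN (congrFun (congrFun (congrFun this Q) a) b))
  simp only [ofN_toN, ← hB.nat, res_res, res_refl] at this
  exact this

theorem le_pre_top (h : U ⟶ U') (R : Opens U) : R ≤ (pre h).obj ⊤ := fun _ _ => Set.mem_univ _

/-- The unit section of a pullback. -/
def pbOne (h : U ⟶ U') (X : StarAlg U') (R : Opens U) : Sec (pull h X.sh) R :=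
  res _ (le_pre_top h R) (eta h (X.one ⊤))

theorem pbOne_eta (h : U ⟶ U') (X : StarAlg U') (W) : pbOne h X ((pre h).obj W) = eta h (X.one W) := by
  rw [← X.one_res ⊤ W le_top, eta_res]
  rfl

theorem pbOne_res (h : U ⟶ U') (X : StarAlg U') {W W'} (i : W' ≤ W) :
    res _ i (pbOne h X W) = pbOne h X W' := res_res _ _ _ _

/-- Pullback along a smooth map, with the induced star-algebra structure. -/
abbrev pb (h : U ⟶ U') (X : StarAlg U') : StarAlg U where
  sh := pull h X.sh
  mul := (mul_exists h X).choose
  one := pbOne h X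
  star := (star_exists h X).choose
  mul_bil := (mul_exists h X).choose_spec.1
  mul_assoc := assoc_aux h X (mul_exists h X).choose_spec.1 (mul_exists h X).choose_spec.2
  one_res _ _ i := pbOne_res h X i
  one_mul W a := by
    have hm := (mul_exists h X).choose_spec
    have hl : IsLin (V := pull h X.sh) (N := pull h X.sh) fun R a =>
        (mul_exists h X).choose R (pbOne h X R) a :=
      ⟨fun R => hm.1.add_right R |> fun f v w => f v w _, fun R a v => hm.1.smul_right R a v _,
        fun R R' i v => by rw [← pbOne_res h X i, hm.1.nat]⟩
    exact congrFun (congrFun (pull_unique hl isLin_id (by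
      intro W a
      rw [pbOne_eta, hm.2, X.one_mul])) W) a
  mul_one W a := by
    have hm := (mul_exists h X).choose_spec
    have hl : IsLin (V := pull h X.sh) (N := pull h X.sh) fun R a =>
        (mul_exists h X).choose R a (pbOne h X R) :=
      ⟨fun R => hm.1.add_left R |> fun f v w => f v w _, fun R a v => hm.1.smul_left R a v _,
        fun R R' i v => by rw [← pbOne_res h X i, hm.1.nat]⟩
    exact congrFun (congrFun (pull_unique hl isLin_id (by
      intro W a
      rw [pbOne_eta, hm.2, X.mul_one])) W) a
  star_conj := (star_exists h X).choose_spec.1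
  star_star W v := congrFun (congrFun (pull_unique
    ((star_exists h X).choose_spec.1.comp (star_exists h X).choose_spec.1) isLin_id (by
      intro W v
      rw [(star_exists h X).choose_spec.2, (star_exists h X).choose_spec.2, X.star_star])) W) v
  star_mul W a b := by
    have hs := (star_exists h X).choose_spec
    have hm := (mul_exists h X).choose_spec
    have hss : ∀ W v, (star_exists h X).choose W ((star_exists h X).choose W v) = v := fun W v =>
      congrFun (congrFun (pull_unique (hs.1.comp hs.1) isLin_id (by
        intro W v
        rw [hs.2, hs.2, X.star_star])) W) v
    have := congrFun (congrFun (congrFun (bil_unique hm.1 (hm.1.swap.conj hs.1 hs.1 hs.1) (by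
      intro W v w
      rw [hs.2, hs.2, hm.2, hm.2, hs.2, X.star_mul, X.star_star, X.star_star])) W) a) b
    rw [this, hss]

theorem pb_star (h : U ⟶ U') (X : StarAlg U') {W} (v : Sec X.sh W) :
    (pb h X).star _ (eta h v) = eta h (X.star W v) := (star_exists h X).choose_spec.2 W v

theorem pb_mul (h : U ⟶ U') (X : StarAlg U') {W} (v w : Sec X.sh W) :
    (pb h X).mul _ (eta h v) (eta h w) = eta h (X.mul W v w) :=
  (mul_exists h X).choose_spec.2 W v w

theorem pb_one (h : U ⟶ U') (X : StarAlg U') (W) :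
    (pb h X).one ((pre h).obj W) = eta h (X.one W) := pbOne_eta h X W

@[ext] theorem hom_ext {X Y : StarAlg U} {f g : X ⟶ Y} (H : f.hom = g.hom) : f = g := Hom.ext H

/-- A morphism out of a pullback, from its values on pulled back sections. -/
def mkPb {h : U ⟶ U'} {X : StarAlg U'} {Y : StarAlg U} (f : pull h X.sh ⟶ Y.sh)
    (star : ∀ W (v : Sec X.sh W), act f (eta h (X.star W v)) = Y.star _ (act f (eta h v)))
    (mul : ∀ W (v w : Sec X.sh W),
      act f (eta h (X.mul W v w)) = Y.mul _ (act f (eta h v)) (act f (eta h w)))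
    (one : act f (eta h (X.one ⊤)) = Y.one _) :
    pb h X ⟶ Y where
  hom := f
  star W v := congrFun (congrFun (conj_unique ((pb h X).star_conj.act_left f)
    (Y.star_conj.act_right f) (by
      intro W v
      rw [pb_star, star])) W) v
  mul W v w := congrFun (congrFun (congrFun (bil_unique ((pb h X).mul_bil.act_left f)
    (Y.mul_bil.act_right f f) (by
      intro W v w
      rw [pb_mul, mul])) W) v) w
  one W := by
    change act f (res _ _ _) = _
    rw [act_res, one, Y.one_res]

/-- An isomorphism from a structure-preserving map that is invertible on sheaves. -/
def mkIso {X Y : StarAlg U} (e : X.sh ≅ Y.sh) (f : X ⟶ Y) (hf : f.hom = e.hom) : X ≅ Y :=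
  have h1 : ∀ W (v : Sec Y.sh W), act f.hom (act e.inv v) = v := fun W v => by
    rw [hf, ← act_comp, e.inv_hom_id, act_id]
  have h2 : ∀ W (v : Sec X.sh W), act e.inv (act f.hom v) = v := fun W v => by
    rw [hf, ← act_comp, e.hom_inv_id, act_id]
  { hom := f
    inv :=
    { hom := e.inv
      star := fun W v => by
        conv_lhs => rw [← h1 W v]
        rw [← f.star, h2]
      mul := fun W v w => by
        conv_lhs => rw [← h1 W v, ← h1 W w]
        rw [← f.mul, h2]
      one := fun W => by rw [← f.one, h2] }
    hom_inv_id := hom_ext (by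
      change f.hom ≫ e.inv = 𝟙 _
      rw [hf, e.hom_inv_id])
    inv_hom_id := hom_ext (by
      change e.inv ≫ f.hom = 𝟙 _
      rw [hf, e.inv_hom_id]) }

/-- The pullback functor. -/
def pbFunctor (h : U ⟶ U') : StarAlg U' ⥤ StarAlg U where
  obj X := pb h X
  map {X Y} f := mkPb (Y := pb h Y) (pullMap h f.hom)
    (fun W v => by rw [pullMap_eta, pullMap_eta, f.star, pb_star])
    (fun W v w => by rw [pullMap_eta, pullMap_eta, pullMap_eta, pb_mul, f.mul])
    (by rw [pullMap_eta, f.one, pb_one])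
  map_id X := hom_ext (pull_hom_ext h fun W v => pullMap_eta h (𝟙 _) v)
  map_comp {X Y Z} f g := hom_ext (pull_hom_ext h fun W v => by
    refine (pullMap_eta h (f.hom ≫ g.hom) v).trans ?_
    refine Eq.trans ?_ (congrArg (act (pullMap h g.hom)) (pullMap_eta h f.hom v)).symm
    exact (pullMap_eta h g.hom _).symm)

def pbId (X : StarAlg U) : pb (𝟙 U) X ≅ X :=
  mkIso (pullId X.sh) (mkPb (pullId X.sh).hom
    (fun W v => by rw [pullId_eta, pullId_eta]; rfl)
    (fun W v w => by rw [pullId_eta, pullId_eta, pullId_eta]; rfl)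
    (by rw [pullId_eta]; rfl)) rfl

def pbComp (h : U ⟶ U') (k : U' ⟶ U'') (X : StarAlg U'') : pb (h ≫ k) X ≅ pb h (pb k X) :=
  mkIso (Y := pb h (pb k X)) (pullComp h k X.sh) (mkPb (pullComp h k X.sh).hom
    (fun W v => by
      rw [pullComp_eta, pullComp_eta]
      refine Eq.trans ?_ (pb_star h (pb k X) (W := (pre k).obj W) (eta k v)).symm
      rw [pb_star])
    (fun W v w => by
      rw [pullComp_eta, pullComp_eta, pullComp_eta]
      refine Eq.trans ?_ (pb_mul h (pb k X) (W := (pre k).obj W) (eta k v) (eta k w)).symm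
      rw [pb_mul])
    (by
      rw [pullComp_eta]
      refine Eq.trans ?_ (pb_one h (pb k X) ((pre k).obj ⊤)).symm
      rw [pb_one])) rfl

theorem map_eta (h : U ⟶ U') {X Y : StarAlg U'} (f : X ⟶ Y) {W} (v : Sec X.sh W) :
    act ((pbFunctor h).map f).hom (eta h v) = eta h (act f.hom v) := pullMap_eta h f.hom v

theorem pbId_eta (X : StarAlg U) {W} (v : Sec X.sh W) :
    act (pbId X).hom.hom (eta (𝟙 U) v) = v := pullId_eta X.sh v

theorem pbComp_eta (h : U ⟶ U') (k : U' ⟶ U'') (X : StarAlg U'') {W} (v : Sec X.sh W) :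
    act (pbComp h k X).hom.hom (eta (h ≫ k) v) = eta h (eta k v) := pullComp_eta h k X.sh v

theorem pb_hom_ext {h : U ⟶ U'} {X : StarAlg U'} {Y : StarAlg U} {f g : pb h X ⟶ Y}
    (H : ∀ W (v : Sec X.sh W), act f.hom (eta h v) = act g.hom (eta h v)) : f = g :=
  hom_ext (pull_hom_ext h H)

/-- The coherent system of pullback functors. -/
def pullbacks : Pullbacks StarAlg where
  pb h := pbFunctor h
  pbId U := NatIso.ofComponents (F := pbFunctor (𝟙 U)) (G := 𝟭 _) (fun X => pbId X)
    (fun {X Y} f => pb_hom_ext (h := 𝟙 U) fun W v => by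
      refine (congrArg (act (pbId Y).hom.hom) (map_eta (𝟙 U) f v)).trans ?_
      refine (pbId_eta Y _).trans ?_
      exact (congrArg (act f.hom) (pbId_eta X v)).symm)
  pbComp h k := NatIso.ofComponents (F := pbFunctor (h ≫ k)) (G := pbFunctor k ⋙ pbFunctor h)
    (fun X => pbComp h k X)
    (fun {X Y} f => pb_hom_ext (h := h ≫ k) fun W v => by
      refine (congrArg (act (pbComp h k Y).hom.hom) (map_eta (h ≫ k) f v)).trans ?_
      refine (pbComp_eta h k Y _).trans ?_
      refine Eq.trans ?_ (congrArg (act ((pbFunctor h).map ((pbFunctor k).map f)).hom)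
        (pbComp_eta h k X v)).symm
      refine Eq.trans ?_ (map_eta h ((pbFunctor k).map f) (W := (pre k).obj W) (eta k v)).symm
      exact (congrArg (eta h) (map_eta k f v)).symm)
  assoc h k l X := pb_hom_ext (h := (h ≫ k) ≫ l) fun W v => by
    refine (congrArg (act (pbComp h k (pb l X)).hom.hom) (pbComp_eta (h ≫ k) l X v)).trans ?_
    refine (pbComp_eta h k (pb l X) (W := (pre l).obj W) (eta l v)).trans ?_
    refine Eq.trans ?_ (congrArg (act ((pbFunctor h).map (pbComp k l X).hom).hom)
        (pbComp_eta h (k ≫ l) X v)).symm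
    refine Eq.trans ?_ (map_eta h (pbComp k l X).hom (W := (pre (k ≫ l)).obj W)
      (eta (k ≫ l) v)).symm
    exact (congrArg (eta h) (pbComp_eta k l X v)).symm
  left_unit {U U'} h X := pb_hom_ext (h := 𝟙 U ≫ h) fun W v => by
    refine (congrArg (act (pbId (pb h X)).hom.hom) (pbComp_eta (𝟙 U) h X v)).trans ?_
    exact pbId_eta (pb h X) (W := (pre h).obj W) (eta h v)
  right_unit {U U'} h X := pb_hom_ext (h := h ≫ 𝟙 U') fun W v => by
    refine (congrArg (act ((pbFunctor h).map (pbId X).hom).hom) (pbComp_eta h (𝟙 U') X v)).trans ?_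
    refine (map_eta h (pbId X).hom (W := (pre (𝟙 U')).obj W) (eta (𝟙 U') v)).trans ?_
    exact congrArg (eta h) (pbId_eta X v)

/-- Star-algebras form a pseudofunctor on manifolds. -/
def prestack : Pseudofunctor (LocallyDiscrete Manᵒᵖ) Cat.{0, 1} := pullbacks.toPseudofunctor

end StarAlg

/-- The model with corners of a line bundle over a manifold. -/
abbrev mdl (U : Man) := (𝓡 U.dim).prod 𝓘(ℝ, ℝ)

/-- A smooth fiber bundle whose typical fiber is the real line. -/
structure LineFam (U : Man) where
  Fib : U → Type
  [topTot : TopologicalSpace (TotalSpace ℝ Fib)]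
  [topFib : ∀ x, TopologicalSpace (Fib x)]
  [bundle : FiberBundle ℝ Fib]
  transition : ∀ (e e' : Trivialization ℝ (π ℝ Fib)) [MemTrivializationAtlas e]
    [MemTrivializationAtlas e'], ContMDiffOn (mdl U) 𝓘(ℝ, ℝ) ∞
      (fun p : U × ℝ => (e' (e.toOpenPartialHomeomorph.symm p)).2)
      ((e.baseSet ∩ e'.baseSet) ×ˢ Set.univ)

attribute [instance] LineFam.topTot LineFam.topFib LineFam.bundle

namespace LineFam
variable {U : Man} (X : LineFam U)

/-- The total space, a manifold via the local trivializations. -/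
abbrev Tot : Type := TotalSpace ℝ X.Fib

/-- The bundle projection. -/
abbrev proj : X.Tot → U := π ℝ X.Fib

/-- The vertical tangent space. -/
def vert (p : X.Tot) : Submodule ℝ (TangentSpace (mdl U) p) :=
  (mfderiv (mdl U) (𝓡 U.dim) X.proj p).ker

/-- The differential of a real function on the total space. -/
def diff (f : X.Tot → ℝ) (p : X.Tot) (v : TangentSpace (mdl U) p) : ℝ :=
  mfderiv (mdl U) 𝓘(ℝ, ℝ) f p v

theorem nonempty_fib (x : U) : Nonempty (X.Fib x) := by
  let e := trivializationAt ℝ X.Fib x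
  have h : (e.toOpenPartialHomeomorph.symm (x, 0)).proj = x :=
    e.proj_symm_apply' (FiberBundle.mem_baseSet_trivializationAt' x)
  exact ⟨h ▸ (e.toOpenPartialHomeomorph.symm (x, 0)).2⟩

instance (x : U) : Nonempty (X.Fib x) := X.nonempty_fib x

end LineFam

/-- A smooth family of one-dimensional spacetimes over `U`: a fiber bundle with typical fiber an
open interval together with a smooth non-degenerate vertical one-form. -/
structure LocObj (U : Man) extends LineFam U where
  form : ∀ p : toLineFam.Tot, toLineFam.vert p →ₗ[ℝ] ℝ
  form_nondeg : ∀ p v, form p v = 0 → v = 0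
  form_smooth : ∀ (e : Trivialization ℝ (π ℝ Fib)) [MemTrivializationAtlas e],
    ∃ ρ : U × ℝ → ℝ, ContMDiffOn (mdl U) 𝓘(ℝ, ℝ) ∞ ρ (e.baseSet ×ˢ Set.univ) ∧
      ∀ p ∈ e.source, ∀ v : toLineFam.vert p, form p v =
        ρ (e p) * toLineFam.diff (fun q => (e q).2) p v

namespace LocObj
variable {U : Man}

open Classical in
/-- The vertical form extended by zero to non-vertical vectors. -/
def ev (X : LocObj U) (p : X.Tot) (v : TangentSpace (mdl U) p) : ℝ :=
  if h : v ∈ X.vert p then X.form p ⟨v, h⟩ else 0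

theorem ev_of_mem (X : LocObj U) {p : X.Tot} {v : TangentSpace (mdl U) p} (h : v ∈ X.vert p) :
    X.ev p v = X.form p ⟨v, h⟩ := dif_pos h

end LocObj

namespace LineFam
variable {U U' U'' : Man}

/-- The underlying continuous map. -/
abbrev cm (h : U ⟶ U') : C(U, U') := ⟨Hom.fn h, Hom.cont h⟩

instance (h : U ⟶ U') (X : LineFam U') : TopologicalSpace (TotalSpace ℝ ((cm h : U → U') *ᵖ X.Fib)) :=
  Pullback.TotalSpace.topologicalSpace ℝ X.Fib (cm h)

/-- The canonical map from the pullback bundle. -/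
def lift (h : U ⟶ U') (X : LineFam U') : TotalSpace ℝ ((cm h : U → U') *ᵖ X.Fib) → X.Tot :=
  Pullback.lift (cm h)

theorem contMDiff_lift (h : U ⟶ U') (X : LineFam U') : ContMDiff (mdl U) (mdl U') ∞ (X.lift h) := by
  intro q
  rw [contMDiffAt_totalSpace]
  constructor
  · exact (Hom.smooth h).contMDiffAt.comp q (contMDiffAt_proj _)
  · have := (contMDiffAt_totalSpace (IM := mdl U) (IB := 𝓡 U.dim) (n := ∞) (F := ℝ)
      (E := (cm h : U → U') *ᵖ X.Fib) (f := id) (x₀ := q)).1 contMDiffAt_id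
    exact this.2

theorem contMDiff_to_pullback (h : U ⟶ U') (X : LineFam U') {E H M : Type} [NormedAddCommGroup E]
    [NormedSpace ℝ E] [TopologicalSpace H] {I : ModelWithCorners ℝ E H} [TopologicalSpace M]
    [ChartedSpace H M] {f : M → TotalSpace ℝ ((cm h : U → U') *ᵖ X.Fib)}
    (h1 : ContMDiff I (𝓡 U.dim) ∞ fun m => (f m).proj)
    (h2 : ContMDiff I (mdl U') ∞ fun m => X.lift h (f m)) : ContMDiff I (mdl U) ∞ f := by
  intro q
  rw [contMDiffAt_totalSpace]
  exact ⟨h1 q, ((contMDiffAt_totalSpace).1 (h2 q)).2⟩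

theorem lift_symm (h : U ⟶ U') (X : LineFam U') (e : Trivialization ℝ (π ℝ X.Fib)) {p : U × ℝ}
    (hp : Hom.fn h p.1 ∈ e.baseSet) :
    X.lift h ((e.pullback (cm h)).toOpenPartialHomeomorph.symm p) =
      e.toOpenPartialHomeomorph.symm (Hom.fn h p.1, p.2) :=
  e.mk_symm hp p.2

/-- The pullback of a smooth line bundle. -/
def pb (h : U ⟶ U') (X : LineFam U') : LineFam U where
  Fib := (cm h : U → U') *ᵖ X.Fib
  transition := by
    rintro _ _ ⟨⟨e, he, rfl⟩⟩ ⟨⟨e', he', rfl⟩⟩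
    have hs : ContMDiff (mdl U) (mdl U') ∞ (fun p : U × ℝ => (Hom.fn h p.1, p.2)) :=
      ((Hom.smooth h).comp contMDiff_fst).prodMk contMDiff_snd
    have := (X.transition e e').comp hs.contMDiffOn
      (s := (Hom.fn h ⁻¹' (e.baseSet ∩ e'.baseSet)) ×ˢ Set.univ) (fun p hp => ⟨hp.1, trivial⟩)
    refine this.congr fun p hp => ?_
    exact congrArg (fun z => (e' z).2) (X.lift_symm h e hp.1.1)

end LineFam

namespace LineFam
variable {U U' U'' : Man}

theorem mdiff_lift (h : U ⟶ U') (X : LineFam U') (p : (X.pb h).Tot) :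
    MDifferentiableAt (mdl U) (mdl U') (X.lift h) p :=
  (X.contMDiff_lift h).mdifferentiable (by simp) p

/-- Over a map of the bases, the differential of a bundle map preserves vertical vectors. -/
theorem vert_map {X : LineFam U} {Y : LineFam U'} {f : X.Tot → Y.Tot} {g : U → U'} {p : X.Tot}
    (hf : MDifferentiableAt (mdl U) (mdl U') f p) (hg : MDifferentiableAt (𝓡 U.dim) (𝓡 U'.dim) g p.1)
    (H : ∀ q, (f q).1 = g q.1) {v : TangentSpace (mdl U) p} (hv : v ∈ X.vert p) :
    mfderiv (mdl U) (mdl U') f p v ∈ Y.vert (f p) := by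
  have h1 : MDifferentiableAt (mdl U') (𝓡 U'.dim) Y.proj (f p) :=
    (contMDiff_proj Y.Fib (n := ∞)).mdifferentiable (by simp) _
  have h2 : MDifferentiableAt (mdl U) (𝓡 U.dim) X.proj p :=
    (contMDiff_proj X.Fib (n := ∞)).mdifferentiable (by simp) _
  have e1 := mfderiv_comp p h1 hf
  have e2 := mfderiv_comp p hg h2
  have e : Y.proj ∘ f = g ∘ X.proj := funext H
  rw [e, e2] at e1
  have := congrArg (fun L => L v) e1
  have hv' : mfderiv (mdl U) (𝓡 U.dim) X.proj p v = 0 := hv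
  change mfderiv (mdl U') (𝓡 U'.dim) Y.proj (f p) (mfderiv (mdl U) (mdl U') f p v) = 0
  refine Eq.trans this.symm ?_
  exact (congrArg (mfderiv (𝓡 U.dim) (𝓡 U'.dim) g p.1) hv').trans (map_zero _)

theorem vert_lift (h : U ⟶ U') (X : LineFam U') (p : (X.pb h).Tot) {v : TangentSpace (mdl U) p}
    (hv : v ∈ (X.pb h).vert p) : mfderiv (mdl U) (mdl U') (X.lift h) p v ∈ X.vert (X.lift h p) :=
  vert_map (X := X.pb h) (Y := X) (g := Hom.fn h) (X.mdiff_lift h p)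
    ((Hom.smooth h).mdifferentiable (by simp) _) (fun _ => rfl) hv

theorem contMDiffAt_snd (X : LineFam U) (e : Trivialization ℝ (π ℝ X.Fib)) [MemTrivializationAtlas e]
    {p : X.Tot} (hp : p ∈ e.source) : ContMDiffAt (mdl U) 𝓘(ℝ, ℝ) ∞ (fun q => (e q).2) p := by
  let e₀ := trivializationAt ℝ X.Fib p.1
  have hp₀ : p ∈ e₀.source := FiberBundle.mem_trivializationAt_proj_source
  have h1 : ContMDiffAt (mdl U) (mdl U) ∞ (fun q : X.Tot => (q.1, (e₀ q).2)) p :=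
    (contMDiffAt_proj X.Fib).prodMk
      ((contMDiffAt_totalSpace (IM := mdl U) (f := id) (x₀ := p)).1 contMDiffAt_id).2
  have h2 : ContMDiffAt (mdl U) 𝓘(ℝ, ℝ) ∞ (fun y : U × ℝ =>
      (e (e₀.toOpenPartialHomeomorph.symm y)).2) (p.1, (e₀ p).2) :=
    (X.transition e₀ e).contMDiffAt (((e₀.open_baseSet.inter e.open_baseSet).prod isOpen_univ).mem_nhds
      ⟨⟨e₀.mem_source.1 hp₀, e.mem_source.1 hp⟩, trivial⟩)
  refine (h2.comp p h1).congr_of_eventuallyEq ?_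
  filter_upwards [e₀.open_source.mem_nhds hp₀] with q hq
  exact congrArg (fun z => (e z).2) (e₀.symm_apply_mk_proj hq).symm

theorem vert_ext (X : LineFam U) {p : X.Tot} {v : TangentSpace (mdl U) p} (hv : v ∈ X.vert p)
    (h0 : X.diff (fun q => (trivializationAt ℝ X.Fib p.1 q).2) p v = 0) : v = 0 := by
  let e := trivializationAt ℝ X.Fib p.1
  have hp : p ∈ e.source := FiberBundle.mem_trivializationAt_proj_source
  have hs : ContMDiffAt (mdl U) 𝓘(ℝ, ℝ) ∞ (fun q => (e q).2) p := X.contMDiffAt_snd e hp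
  have s1 : MDifferentiableAt (mdl U) 𝓘(ℝ, ℝ) (fun q => (e q).2) p :=
    hs.mdifferentiableAt (by simp)
  have s2 : MDifferentiableAt (mdl U) (𝓡 U.dim) X.proj p :=
    (contMDiff_proj X.Fib (n := ∞)).mdifferentiable (by simp) _
  have s3 : ContMDiffAt (mdl U) (mdl U) ∞ (fun y : U × ℝ => e.toOpenPartialHomeomorph.symm y)
      (p.1, (e p).2) := by
    rw [contMDiffAt_totalSpace]
    have hb : ∀ᶠ y : U × ℝ in 𝓝 (p.1, (e p).2), y.1 ∈ e.baseSet :=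
      (continuous_fst.tendsto _).eventually (e.open_baseSet.mem_nhds (e.mem_source.1 hp))
    constructor
    · refine contMDiffAt_fst.congr_of_eventuallyEq ?_
      filter_upwards [hb] with y hy
      exact e.proj_symm_apply' hy
    · refine _root_.contMDiffAt_snd.congr_of_eventuallyEq ?_
      have : (e.toOpenPartialHomeomorph.symm (p.1, (e p).2)).proj = p.1 :=
        e.proj_symm_apply' (e.mem_source.1 hp)
      rw [this]
      filter_upwards [hb] with y hy
      exact congrArg Prod.snd (e.apply_symm_apply' hy)
  have s4 := mfderiv_comp (I' := mdl U) p
    (g := fun y : U × ℝ => e.toOpenPartialHomeomorph.symm y) (f := fun q : X.Tot => (q.1, (e q).2))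
    (s3.mdifferentiableAt (by simp)) (s2.prodMk s1)
  have s5 : ((fun y : U × ℝ => e.toOpenPartialHomeomorph.symm y) ∘
      fun q : X.Tot => (q.1, (e q).2)) =ᶠ[𝓝 p] id := by
    filter_upwards [e.open_source.mem_nhds hp] with q hq
    exact e.symm_apply_mk_proj hq
  rw [s5.mfderiv_eq, mfderiv_id, mfderiv_prodMk s2 s1] at s4
  have s6 := congrArg (fun L => L v) s4
  have hv' : mfderiv (mdl U) (𝓡 U.dim) X.proj p v = 0 := hv
  have h0' : mfderiv (mdl U) 𝓘(ℝ, ℝ) (fun q => (e q).2) p v = 0 := h0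
  have s7 : (mfderiv (mdl U) (𝓡 U.dim) X.proj p v, mfderiv (mdl U) 𝓘(ℝ, ℝ) (fun q => (e q).2) p v)
      = 0 := Prod.ext hv' h0'
  refine Eq.trans s6 ?_
  exact (congrArg (mfderiv (mdl U) (mdl U)
    (fun y : U × ℝ => e.toOpenPartialHomeomorph.symm y) (p.1, (e p).2)) s7).trans (map_zero _)

theorem diff_pb (h : U ⟶ U') (X : LineFam U') (e : Trivialization ℝ (π ℝ X.Fib))
    [MemTrivializationAtlas e] (p : (X.pb h).Tot) (hp : X.lift h p ∈ e.source)
    (v : TangentSpace (mdl U) p) :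
    (X.pb h).diff (fun q => (e (X.lift h q)).2) p v =
      X.diff (fun q => (e q).2) (X.lift h p) (mfderiv (mdl U) (mdl U') (X.lift h) p v) :=
  congrArg (fun L => L v) (mfderiv_comp p
    ((X.contMDiffAt_snd e hp).mdifferentiableAt (by simp)) (X.mdiff_lift h p))

/-- A vertical vector of the pullback is determined by its image. -/
theorem lift_inj (h : U ⟶ U') (X : LineFam U') (p : (X.pb h).Tot) {v : TangentSpace (mdl U) p}
    (hv : v ∈ (X.pb h).vert p) (h0 : mfderiv (mdl U) (mdl U') (X.lift h) p v = 0) : v = 0 := by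
  apply (X.pb h).vert_ext hv
  refine (X.diff_pb h (trivializationAt ℝ X.Fib (X.lift h p).1) p
    FiberBundle.mem_trivializationAt_proj_source v).trans ?_
  rw [h0]
  exact map_zero (mfderiv (mdl U') 𝓘(ℝ, ℝ) _ _)

/-- The differential of the canonical map on vertical vectors. -/
def vlift (h : U ⟶ U') (X : LineFam U') (p : (X.pb h).Tot) :
    (X.pb h).vert p →ₗ[ℝ] X.vert (X.lift h p) where
  toFun v := ⟨mfderiv (mdl U) (mdl U') (X.lift h) p v.1, X.vert_lift h p v.2⟩
  map_add' v w := Subtype.ext (map_add (mfderiv (mdl U) (mdl U') (X.lift h) p) v.1 w.1)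
  map_smul' a v := Subtype.ext (map_smul (mfderiv (mdl U) (mdl U') (X.lift h) p) a v.1)

end LineFam

namespace LocObj
variable {U U' U'' : Man}

/-- The pullback of a family of spacetimes. -/
def pb (h : U ⟶ U') (X : LocObj U') : LocObj U where
  toLineFam := X.toLineFam.pb h
  form p := X.form (X.lift h p) ∘ₗ X.vlift h p
  form_nondeg p v hv := by
    have := X.form_nondeg _ _ hv
    exact Subtype.ext (X.lift_inj h p v.2 (congrArg Subtype.val this))
  form_smooth := by
    rintro _ ⟨⟨e, he, rfl⟩⟩
    obtain ⟨ρ, h1, h2⟩ := X.form_smooth e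
    have hs : ContMDiff (mdl U) (mdl U') ∞ (fun p : U × ℝ => (Hom.fn h p.1, p.2)) :=
      ((Hom.smooth h).comp contMDiff_fst).prodMk contMDiff_snd
    refine ⟨fun p => ρ (Hom.fn h p.1, p.2), h1.comp hs.contMDiffOn fun p hp => ⟨hp.1, trivial⟩, ?_⟩
    intro p hp v
    refine (h2 (X.lift h p) hp ⟨_, X.vert_lift h p v.2⟩).trans ?_
    congr 1
    · congr 1
      exact Prod.ext (e.coe_fst' (e.mem_source.1 hp)) rfl
    · exact (X.diff_pb h e p hp v).symm

/-- Morphisms of families of spacetimes. -/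
@[ext] structure Hom (X Y : LocObj U) where
  app : ∀ x, X.Fib x → Y.Fib x
  smooth : ContMDiff (mdl U) (mdl U) ∞ (fun p : X.Tot => (⟨p.1, app p.1 p.2⟩ : Y.Tot))
  emb : IsOpenEmbedding (fun p : X.Tot => (⟨p.1, app p.1 p.2⟩ : Y.Tot))
  form : ∀ (p : X.Tot) (v : TangentSpace (mdl U) p), v ∈ X.vert p →
    Y.ev ⟨p.1, app p.1 p.2⟩
      (mfderiv (mdl U) (mdl U) (fun p : X.Tot => (⟨p.1, app p.1 p.2⟩ : Y.Tot)) p v) = X.ev p v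

/-- The map of total spaces. -/
def Hom.tot {X Y : LocObj U} (f : Hom X Y) (p : X.Tot) : Y.Tot := ⟨p.1, f.app p.1 p.2⟩

theorem Hom.mdiff {X Y : LocObj U} (f : Hom X Y) (p : X.Tot) :
    MDifferentiableAt (mdl U) (mdl U) f.tot p := f.smooth.mdifferentiable (by simp) p

instance : Category (LocObj U) where
  Hom X Y := Hom X Y
  id X :=
    { app := fun _ t => t
      smooth := contMDiff_id
      emb := .id
      form := fun p v _ => by
        refine congrArg (X.ev p) ?_
        exact congrArg (fun L => L v) (mfderiv_id (I := mdl U) (x := p)) }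
  comp {X Y Z} f g :=
    { app := fun x t => g.app x (f.app x t)
      smooth := g.smooth.comp f.smooth
      emb := g.emb.comp f.emb
      form := fun p v hv => by
        refine Eq.trans ?_ (f.form p v hv)
        refine Eq.trans ?_ (g.form (f.tot p) _
          (LineFam.vert_map (g := id) (f.mdiff p) mdifferentiableAt_id (fun _ => rfl) hv))
        refine congrArg (Z.ev _) ?_
        exact congrArg (fun L => L v) (mfderiv_comp p (g.mdiff (f.tot p)) (f.mdiff p)) }

end LocObj

namespace LocObj
variable {U U' U'' : Man}

theorem ev_pb (h : U ⟶ U') (X : LocObj U') {p : (pb h X).Tot} {v : TangentSpace (mdl U) p}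
    (hv : v ∈ (pb h X).vert p) :
    (pb h X).ev p v = X.ev (X.lift h p) (mfderiv (mdl U) (mdl U') (X.lift h) p v) :=
  (ev_of_mem _ hv).trans (ev_of_mem _ (X.vert_lift h p hv)).symm

theorem ev_to_pb (h : U ⟶ U') {X : LocObj U} {Y : LocObj U'} {F : X.Tot → (pb h Y).Tot} {p : X.Tot}
    (hF : MDifferentiableAt (mdl U) (mdl U) F p) (H : ∀ q, (F q).1 = q.1)
    {v : TangentSpace (mdl U) p} (hv : v ∈ X.vert p) :
    (pb h Y).ev (F p) (mfderiv (mdl U) (mdl U) F p v) =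
      Y.ev (Y.lift h (F p)) (mfderiv (mdl U) (mdl U') (fun q => Y.lift h (F q)) p v) := by
  rw [ev_pb h Y (LineFam.vert_map (X := X.toLineFam) (Y := (pb h Y).toLineFam) (g := id) hF
    mdifferentiableAt_id H hv)]
  refine congrArg (Y.ev _) ?_
  exact (congrArg (fun L => L v) (mfderiv_comp p (Y.mdiff_lift h (F p)) hF)).symm

theorem hom_ext' {X Y : LocObj U} {f g : X ⟶ Y} (H : ∀ x t, f.app x t = g.app x t) : f = g :=
  Hom.ext (funext fun x => funext fun t => H x t)

theorem inducing_lift (h : U ⟶ U') (X : LocObj U') :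
    IsInducing (fun q : (pb h X).Tot => (q.1, X.lift h q)) :=
  inducing_pullbackTotalSpaceEmbedding ℝ X.Fib (LineFam.cm h)

section
variable (h : U ⟶ U') {X Y : LocObj U'} (f : Hom X Y)

def pbTot (p : (pb h X).Tot) : (pb h Y).Tot := ⟨p.1, f.app (Hom.fn h p.1) p.2⟩

theorem pbTot_smooth : ContMDiff (mdl U) (mdl U) ∞ (pbTot h f) :=
  Y.contMDiff_to_pullback h (contMDiff_proj _) (f.smooth.comp (X.contMDiff_lift h))

theorem pbTot_emb : IsOpenEmbedding (pbTot h f) := by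
  have h1 : IsInducing (fun q : (pb h X).Tot => (q.1, f.tot (X.lift h q))) :=
    (IsInducing.id.prodMap f.emb.isInducing).comp (inducing_lift h X)
  refine ⟨⟨?_, ?_⟩, ?_⟩
  · exact IsInducing.of_comp (pbTot_smooth h f).continuous (inducing_lift h Y).continuous h1
  · rintro ⟨x, s⟩ ⟨y, t⟩ hst
    have e1 : x = y := congrArg TotalSpace.proj hst
    subst e1
    have e2 : f.tot (X.lift h ⟨x, s⟩) = f.tot (X.lift h ⟨x, t⟩) := congrArg (Y.lift h) hst
    have e3 := f.emb.injective e2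
    have e4 : s = t := (TotalSpace.mk_inj (F := ℝ) (E := X.Fib) (b := Hom.fn h x) (y := s) (y' := t)).1 e3
    rw [e4]
  · have e : Set.range (pbTot h f) = Y.lift h ⁻¹' Set.range f.tot := by
      ext q
      constructor
      · rintro ⟨p, rfl⟩
        exact ⟨X.lift h p, rfl⟩
      · obtain ⟨x, t⟩ := q
        rintro ⟨⟨y, s⟩, hp⟩
        have e1 : y = Hom.fn h x := congrArg TotalSpace.proj hp
        subst e1
        refine ⟨⟨x, s⟩, ?_⟩
        have := (TotalSpace.mk_inj (F := ℝ) (E := Y.Fib)).1 hp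
        exact congrArg (TotalSpace.mk x) this
    rw [e]
    exact f.emb.isOpen_range.preimage (Y.contMDiff_lift h).continuous

theorem pbTot_form (p : (pb h X).Tot) (v : TangentSpace (mdl U) p) (hv : v ∈ (pb h X).vert p) :
    (pb h Y).ev (pbTot h f p) (mfderiv (mdl U) (mdl U) (pbTot h f) p v) = (pb h X).ev p v := by
  refine (ev_to_pb h ((pbTot_smooth h f).mdifferentiable (by simp) p) (fun _ => rfl) hv).trans ?_
  rw [ev_pb h X hv]
  refine Eq.trans (congrArg (Y.ev _) ?_) (f.form (X.lift h p) _ (X.vert_lift h p hv))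
  exact congrArg (fun L => L v) (mfderiv_comp p (f.mdiff (X.lift h p)) (X.mdiff_lift h p))

/-- The pullback of a morphism. -/
def pbMap : Hom (pb h X) (pb h Y) where
  app x t := f.app (Hom.fn h x) t
  smooth := pbTot_smooth h f
  emb := pbTot_emb h f
  form := pbTot_form h f

end

/-- An isomorphism from mutually inverse smooth maps, the first of which preserves the form. -/
def mkIso {X Y : LocObj U} (f : ∀ x, X.Fib x → Y.Fib x) (g : ∀ x, Y.Fib x → X.Fib x)
    (fg : ∀ x t, f x (g x t) = t) (gf : ∀ x t, g x (f x t) = t)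
    (hf : ContMDiff (mdl U) (mdl U) ∞ (fun p : X.Tot => (⟨p.1, f p.1 p.2⟩ : Y.Tot)))
    (hg : ContMDiff (mdl U) (mdl U) ∞ (fun p : Y.Tot => (⟨p.1, g p.1 p.2⟩ : X.Tot)))
    (hform : ∀ (p : X.Tot) (v : TangentSpace (mdl U) p), v ∈ X.vert p → Y.ev ⟨p.1, f p.1 p.2⟩
      (mfderiv (mdl U) (mdl U) (fun p : X.Tot => (⟨p.1, f p.1 p.2⟩ : Y.Tot)) p v) = X.ev p v)
    (gform : ∀ (p : Y.Tot) (v : TangentSpace (mdl U) p), v ∈ Y.vert p → X.ev ⟨p.1, g p.1 p.2⟩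
      (mfderiv (mdl U) (mdl U) (fun p : Y.Tot => (⟨p.1, g p.1 p.2⟩ : X.Tot)) p v) = Y.ev p v) :
    X ≅ Y :=
  let k : X.Tot ≃ₜ Y.Tot :=
    { toFun := fun p => ⟨p.1, f p.1 p.2⟩
      invFun := fun p => ⟨p.1, g p.1 p.2⟩
      left_inv := fun p => by simp only [gf]
      right_inv := fun p => by simp only [fg]
      continuous_toFun := hf.continuous
      continuous_invFun := hg.continuous }
  { hom := ⟨f, hf, k.isOpenEmbedding, hform⟩
    inv := ⟨g, hg, k.symm.isOpenEmbedding, gform⟩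
    hom_inv_id := hom_ext' gf
    inv_hom_id := hom_ext' fg }

/-- The pullback functor. -/
def pbFunctor (h : U ⟶ U') : LocObj U' ⥤ LocObj U where
  obj X := pb h X
  map f := pbMap h f

def pbIdMap (X : LocObj U) (p : (pb (𝟙 U) X).Tot) : X.Tot := ⟨p.1, p.2⟩
def pbIdInv (X : LocObj U) (p : X.Tot) : (pb (𝟙 U) X).Tot := ⟨p.1, p.2⟩

theorem pbIdInv_smooth (X : LocObj U) : ContMDiff (mdl U) (mdl U) ∞ (pbIdInv X) :=
  X.contMDiff_to_pullback (𝟙 U) (contMDiff_proj _) contMDiff_id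

/-- The unit isomorphism of pullbacks. -/
def pbId (X : LocObj U) : pb (𝟙 U) X ≅ X :=
  mkIso (fun _ t => t) (fun _ t => t) (fun _ _ => rfl) (fun _ _ => rfl)
    (X.contMDiff_lift (𝟙 U)) (pbIdInv_smooth X)
    (fun p v hv => (ev_pb (𝟙 U) X hv).symm)
    (fun p v hv => (ev_to_pb (𝟙 U) ((pbIdInv_smooth X).mdifferentiable (by simp) p)
      (fun _ => rfl) hv).trans (congrArg (X.ev p)
        (congrArg (fun L => L v) (mfderiv_id (I := mdl U) (x := p)))))

section
variable (h : U ⟶ U') (k : U' ⟶ U'') (X : LocObj U'')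

def pbCompMap (p : (pb (h ≫ k) X).Tot) : (pb h (pb k X)).Tot := ⟨p.1, p.2⟩
def pbCompInv (p : (pb h (pb k X)).Tot) : (pb (h ≫ k) X).Tot := ⟨p.1, p.2⟩
def pbCompMid (p : (pb (h ≫ k) X).Tot) : (pb k X).Tot := ⟨Hom.fn h p.1, p.2⟩

theorem pbCompMid_smooth : ContMDiff (mdl U) (mdl U') ∞ (pbCompMid h k X) :=
  X.contMDiff_to_pullback k ((Man.Hom.smooth h).comp (contMDiff_proj _)) (X.contMDiff_lift (h ≫ k))

theorem pbCompMap_smooth : ContMDiff (mdl U) (mdl U) ∞ (pbCompMap h k X) :=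
  (pb k X).contMDiff_to_pullback h (contMDiff_proj _) (pbCompMid_smooth h k X)

theorem pbCompInv_smooth : ContMDiff (mdl U) (mdl U) ∞ (pbCompInv h k X) :=
  X.contMDiff_to_pullback (h ≫ k) (contMDiff_proj _)
    ((X.contMDiff_lift k).comp ((pb k X).contMDiff_lift h))

theorem ev_pb_pb {p : (pb h (pb k X)).Tot} {v : TangentSpace (mdl U) p}
    (hv : v ∈ (pb h (pb k X)).vert p) : (pb h (pb k X)).ev p v =
      X.ev (X.lift (h ≫ k) (pbCompInv h k X p)) (mfderiv (mdl U) (mdl U'')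
        (fun q => X.lift (h ≫ k) (pbCompInv h k X q)) p v) := by
  rw [ev_pb h _ hv]
  refine (ev_pb k X ((pb k X).vert_lift h p hv)).trans ?_
  refine congrArg (X.ev _) ?_
  exact (congrArg (fun L => L v) (mfderiv_comp p (X.mdiff_lift k _) ((pb k X).mdiff_lift h p))).symm

theorem pbCompInv_form (p : (pb h (pb k X)).Tot) (v : TangentSpace (mdl U) p)
    (hv : v ∈ (pb h (pb k X)).vert p) : (pb (h ≫ k) X).ev (pbCompInv h k X p)
      (mfderiv (mdl U) (mdl U) (pbCompInv h k X) p v) = (pb h (pb k X)).ev p v :=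
  (ev_to_pb (h ≫ k) ((pbCompInv_smooth h k X).mdifferentiable (by simp) p)
      (fun _ => rfl) hv).trans (ev_pb_pb h k X hv).symm

theorem pbCompMap_form (p : (pb (h ≫ k) X).Tot) (v : TangentSpace (mdl U) p)
    (hv : v ∈ (pb (h ≫ k) X).vert p) : (pb h (pb k X)).ev (pbCompMap h k X p)
      (mfderiv (mdl U) (mdl U) (pbCompMap h k X) p v) = (pb (h ≫ k) X).ev p v := by
  have hd := (pbCompMap_smooth h k X).mdifferentiable (by simp) p
  rw [← pbCompInv_form h k X (pbCompMap h k X p) _ (LineFam.vert_map (X := (pb (h ≫ k) X).toLineFam)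
    (Y := (pb h (pb k X)).toLineFam) (g := id) hd mdifferentiableAt_id (fun _ => rfl) hv)]
  refine congrArg ((pb (h ≫ k) X).ev p) ?_
  refine (congrArg (fun L => L v) (mfderiv_comp p
    ((pbCompInv_smooth h k X).mdifferentiable (by simp) _) hd)).symm.trans ?_
  exact congrArg (fun L => L v) (mfderiv_id (I := mdl U) (x := p))

/-- The composition isomorphism of pullbacks. -/
def pbComp : pb (h ≫ k) X ≅ pb h (pb k X) :=
  mkIso (Y := pb h (pb k X)) (fun _ t => t) (fun _ t => t) (fun _ _ => rfl) (fun _ _ => rfl)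
    (pbCompMap_smooth h k X) (pbCompInv_smooth h k X) (pbCompMap_form h k X) (pbCompInv_form h k X)

end

/-- The coherent system of pullback functors. -/
def pullbacks : Pullbacks LocObj where
  pb h := pbFunctor h
  pbId U := NatIso.ofComponents (F := pbFunctor (𝟙 U)) (G := 𝟭 _) (fun X => pbId X)
    (fun _ => hom_ext' fun _ _ => rfl)
  pbComp h k := NatIso.ofComponents (F := pbFunctor (h ≫ k)) (G := pbFunctor k ⋙ pbFunctor h)
    (fun X => pbComp h k X) (fun _ => hom_ext' fun _ _ => rfl)
  assoc _ _ _ _ := hom_ext' fun _ _ => rfl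
  left_unit _ _ := hom_ext' fun _ _ => rfl
  right_unit _ _ := hom_ext' fun _ _ => rfl

/-- Families of spacetimes form a pseudofunctor on manifolds. -/
def prestack : Pseudofunctor (LocallyDiscrete Manᵒᵖ) Cat.{0, 1} := pullbacks.toPseudofunctor

end LocObj

section
variable {C D : Man → Type 1} [∀ U, Category.{0} (C U)] [∀ U, Category.{0} (D U)]
  {P : Pullbacks C} {Q : Pullbacks D} (T : P.toPseudofunctor.StrongTrans Q.toPseudofunctor)
  {U U' : Man}

/-- The functor `T_U` on objects. -/
def tobj (X : C U) : D U := (T.app ⟨op U⟩).toFunctor.obj X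

/-- The functor `T_U` on morphisms. -/
def tmap {X Y : C U} (f : X ⟶ Y) : tobj T X ⟶ tobj T Y := (T.app ⟨op U⟩).toFunctor.map f

/-- The component `h^* T_{U'} X ⟶ T_U h^* X` of the coherence isomorphism `T_h`. -/
def tcoh (h : U ⟶ U') (X : C U') : (Q.pb h).obj (tobj T X) ⟶ tobj T ((P.pb h).obj X) :=
  (T.naturality (Quiver.Hom.toLoc h.op)).inv.toNatTrans.app X

end

namespace LocObj
variable {U U' : Man} (X : LocObj U) {W W' : Opens U}

/-- The restriction of the total space to an open subset of the base. -/
def above (W : Opens U) : Set X.Tot := X.proj ⁻¹' W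

theorem isOpen_above (W : Opens U) : IsOpen (X.above W) :=
  W.isOpen.preimage (contMDiff_proj X.Fib (n := ∞) (IB := 𝓡 U.dim)).continuous

/-- Smooth `ℂ²`-valued functions on the total space over `W`; to avoid subtypes they are extended
by zero to the whole total space. -/
def fieldGroup (W : Opens U) : AddSubgroup (X.Tot → ℂ × ℂ) where
  carrier := {s | ContMDiffOn (mdl U) 𝓘(ℝ, ℂ × ℂ) ∞ s (X.above W) ∧ ∀ p, p ∉ X.above W → s p = 0}
  add_mem' := fun {s t} hs ht => ⟨hs.1.add ht.1, fun p hp => by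
    rw [Pi.add_apply, hs.2 p hp, ht.2 p hp, add_zero]⟩
  zero_mem' := ⟨contMDiffOn_const, fun _ _ => rfl⟩
  neg_mem' := fun {s} hs => ⟨hs.1.neg, fun p hp => by
    rw [Pi.neg_apply, hs.2 p hp, neg_zero]⟩

/-- The group of fields over `W`. -/
abbrev Field (W : Opens U) : Type := X.fieldGroup W

namespace Field
variable {X}

/-- Restriction to a smaller open subset of the base. -/
def rs (i : W' ≤ W) (s : X.Field W) : X.Field W' :=
  ⟨(X.above W').indicator s.1,
    (s.2.1.mono fun _ hp => i hp).congr fun _ hp => Set.indicator_of_mem hp _,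
    fun _ hp => Set.indicator_of_notMem hp _⟩

open Classical in
/-- Multiplication by the pullback of a function on the base. -/
def smul (a : Fn U W) (s : X.Field W) : X.Field W :=
  ⟨fun p => (if hp : p.1 ∈ W then a.ev ⟨p.1, hp⟩ else 0) • s.1 p, by
    have key : ContMDiffOn (mdl U) 𝓘(ℝ, ℂ) ∞
        (fun p : X.Tot => if hp : p.1 ∈ W then a.ev ⟨p.1, hp⟩ else 0) (X.above W) := by
      intro p hp
      have h1 : ContMDiffAt (𝓡 U.dim) 𝓘(ℝ, ℂ) ∞
          (fun x : U => if hx : x ∈ W then a.ev ⟨x, hx⟩ else 0) p.1 := by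
        refine (contMDiffAt_subtype_iff (x := (⟨p.1, hp⟩ : W))).1 ?_
        refine (a.smooth _).congr_of_eventuallyEq (Filter.Eventually.of_forall fun y => ?_)
        exact dif_pos y.2
      exact (h1.comp p (contMDiffAt_proj X.Fib)).contMDiffWithinAt
    have h3 : ContDiff ℝ ∞ fun z : ℂ × (ℂ × ℂ) => z.1 • z.2 := contDiff_smul
    exact h3.contMDiff.comp_contMDiffOn (key.prodMk_space s.2.1), fun p hp => by
      simp only [s.2.2 p hp, smul_zero]⟩

/-- The involution `(ψ, ψ̄) ↦ (ψ̄^*, ψ^*)`: swapping the components and complex conjugation. -/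
def star (s : X.Field W) : X.Field W :=
  ⟨fun p => (starRingEnd ℂ (s.1 p).2, starRingEnd ℂ (s.1 p).1), by
    have h1 : ContDiff ℝ ∞ fun z : ℂ × ℂ => (Complex.conjCLE z.2, Complex.conjCLE z.1) :=
      (Complex.conjCLE.contDiff.comp contDiff_snd).prodMk
        (Complex.conjCLE.contDiff.comp contDiff_fst)
    exact h1.contMDiff.comp_contMDiffOn s.2.1, fun p hp => by
      simp only [s.2.2 p hp]
      exact Prod.ext (map_zero (starRingEnd ℂ)) (map_zero (starRingEnd ℂ))⟩

/-- Pullback along the canonical map of total spaces. -/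
def pull (h : U ⟶ U') {X : LocObj U'} {W : Opens U'} (s : X.Field W) :
    (pb h X).Field ((pre h).obj W) :=
  ⟨fun p => s.1 (X.lift h p), s.2.1.comp (X.contMDiff_lift h).contMDiffOn fun _ hp => hp,
    fun p hp => s.2.2 (X.lift h p) hp⟩

/-- The support, as a closed subset of the total space over `W`. -/
def supp (s : X.Field W) : Set X.Tot := closure (Function.support s.1) ∩ X.above W

/-- `t` is the pushforward (extension by zero) of `s` along a morphism of spacetimes. -/
def IsPush {X Y : LocObj U} (f : X ⟶ Y) (s : X.Field W) (t : Y.Field W) : Prop :=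
  (∀ p, t.1 (Hom.tot f p) = s.1 p) ∧ ∀ p, p ∉ Set.range (Hom.tot f) → t.1 p = 0

/-- The differential of a field. -/
def diff (s : X.Field W) (p : X.Tot) (v : TangentSpace (mdl U) p) : ℂ × ℂ :=
  mfderiv (mdl U) 𝓘(ℝ, ℂ × ℂ) s.1 p v

/-- `t = D s` for the Dirac operator `D = diag(i ∗ d, -i ∗ d)`. Here `d` is the vertical
differential and `∗ d φ` is the function determined by `d φ = (∗ d φ) E`, with `E` the vertical
one-form. -/
def IsDirac (s t : X.Field W) : Prop :=
  ∀ p ∈ X.above W, ∀ v ∈ X.vert p,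
    (Complex.I * (s.diff p v).1, -Complex.I * (s.diff p v).2) = (X.ev p v : ℂ) • t.1 p

end Field

/-- The velocity of a curve. -/
def velocity (c : ℝ → X.Tot) (t : ℝ) : TangentSpace (mdl U) (c t) :=
  mfderiv 𝓘(ℝ, ℝ) (mdl U) c t (1 : ℝ)

/-- The vertical future (`ε = 1`) or past (`ε = -1`): points reached by future or past directed
vertical curves. -/
def J (ε : ℝ) (S : Set X.Tot) : Set X.Tot :=
  {p | ∃ c : ℝ → X.Tot, ContMDiff 𝓘(ℝ, ℝ) (mdl U) ∞ c ∧ (∀ t, (c t).1 = p.1) ∧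
    (∀ t, 0 ≤ ε * X.ev (c t) (X.velocity c t)) ∧ c 0 ∈ S ∧ c 1 = p}

/-- Vertically past (`ε = 1`) or future (`ε = -1`) compact support: over `W` there is a smooth
section whose vertical future, or past, contains the support. -/
def IsBdd (ε : ℝ) (s : X.Field W) : Prop :=
  ∃ σ : U → X.Tot, (∀ x ∈ W, (σ x).1 = x) ∧ ContMDiffOn (𝓡 U.dim) (mdl U) ∞ σ W ∧
    s.supp ⊆ X.J ε (σ '' W)

/-- Sections of the sheaf of fields of vertically past (`ε = 1`) or future (`ε = -1`) compact
support. -/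
def IsHalf (ε : ℝ) (s : X.Field W) : Prop :=
  ∀ x ∈ W, ∃ (W' : Opens U) (i : W' ≤ W), x ∈ W' ∧ X.IsBdd ε (s.rs i)

/-- Sections of the sheaf of fields of vertically compact support. -/
def IsVC (s : X.Field W) : Prop :=
  ∀ x ∈ W, ∃ (W' : Opens U) (i : W' ≤ W), x ∈ W' ∧ X.IsBdd 1 (s.rs i) ∧ X.IsBdd (-1) (s.rs i)

/-- A retarded (`ε = 1`) or advanced (`ε = -1`) Green operator for the Dirac operator: a morphism
of sheaves of modules on the fields of vertically past or future compact support which is inverse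
to the Dirac operator and has the causal support property. -/
structure IsGreen (ε : ℝ) (G : ∀ W, X.Field W → X.Field W) : Prop where
  maps : ∀ W s, X.IsHalf ε s → X.IsHalf ε (G W s)
  add : ∀ W s t, X.IsHalf ε s → X.IsHalf ε t → G W (s + t) = G W s + G W t
  smul : ∀ W (a : Fn U W) s, X.IsHalf ε s → G W (s.smul a) = (G W s).smul a
  nat : ∀ W W' (i : W' ≤ W) s, X.IsHalf ε s → G W' (s.rs i) = (G W s).rs i
  dirac_maps : ∀ W (s : X.Field W), X.IsHalf ε s → ∃ t, X.IsHalf ε t ∧ s.IsDirac t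
  dirac_green : ∀ W s, X.IsHalf ε s → (G W s).IsDirac s
  green_dirac : ∀ W s t, X.IsHalf ε s → s.IsDirac t → G W t = s
  causal : ∀ W s, X.IsHalf ε s → (G W s).supp ⊆ X.J ε s.supp

/-- Retarded and advanced Green operators for the Dirac operator. -/
structure DiracGreen where
  ret : ∀ W, X.Field W → X.Field W
  adv : ∀ W, X.Field W → X.Field W
  isGreen_ret : X.IsGreen 1 ret
  isGreen_adv : X.IsGreen (-1) adv

/-- The causal propagator. -/
def DiracGreen.prop {X : LocObj U} (S : X.DiracGreen) (s : X.Field W) : X.Field W :=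
  S.ret W s - S.adv W s

/-- The fiber over `x` in the coordinate of a local trivialization. -/
def fibCoord (x : U) (t : ℝ) : X.Tot :=
  (trivializationAt ℝ X.Fib x).toOpenPartialHomeomorph.symm (x, t)

/-- The integral of `φ E` over the fiber at `x`, oriented by the vertical one-form `E`. -/
def fibInt (φ : X.Tot → ℂ) (x : U) : ℂ :=
  ∫ t : ℝ, |X.ev (X.fibCoord x t) (X.velocity (X.fibCoord x) t)| • φ (X.fibCoord x t)

/-- The integrand of the pairing: the row `s` times the matrix with rows `(0, i)` and `(-i, 0)`
times the column `t`. -/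
def dens (s t : X.Field W) (p : X.Tot) : ℂ :=
  (s.1 p).1 * (Complex.I * (t.1 p).2) + (s.1 p).2 * (-Complex.I * (t.1 p).1)

end LocObj

/-- The strong transformation `L` is given by the quotients of the sheaves of fields of vertically
compact support by the image of the Dirac operator, with quotient maps `q`. -/
structure DiracPresentation (S : ∀ {U : Man} (X : LocObj U), X.DiracGreen)
    (L : LocObj.prestack.StrongTrans IPVec.prestack) where
  q : ∀ {U : Man} (X : LocObj U) (W : Opens U), X.Field W → Sec (tobj L X : IPVec U).sh W
  q_add : ∀ {U : Man} (X : LocObj U) W (s t : X.Field W), X.IsVC s → X.IsVC t →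
    q X W (s + t) = q X W s + q X W t
  q_smul : ∀ {U : Man} (X : LocObj U) W (a : Fn U W) (s : X.Field W), X.IsVC s →
    q X W (s.smul a) = a • q X W s
  q_res : ∀ {U : Man} (X : LocObj U) W W' (i : W' ≤ W) (s : X.Field W), X.IsVC s →
    q X W' (s.rs i) = res _ i (q X W s)
  q_surj : ∀ {U : Man} (X : LocObj U) W (v : Sec (tobj L X : IPVec U).sh W),
    ∃ s, X.IsVC s ∧ q X W s = v
  q_ker : ∀ {U : Man} (X : LocObj U) W (s : X.Field W), X.IsVC s →
    (q X W s = 0 ↔ ∃ t : X.Field W, X.IsVC t ∧ t.IsDirac s)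
  star : ∀ {U : Man} (X : LocObj U) W (s : X.Field W), X.IsVC s →
    (tobj L X : IPVec U).star W (q X W s) = q X W s.star
  pair : ∀ {U : Man} (X : LocObj U) W (s t : X.Field W), X.IsVC s → X.IsVC t → ∀ x : W,
    Fn.ev ((tobj L X : IPVec U).pair W (q X W s) (q X W t)) x =
      X.fibInt (X.dens s ((S X).prop t)) x.1
  map : ∀ {U : Man} {X Y : LocObj U} (f : X ⟶ Y) W (s : X.Field W), X.IsVC s →
    ∃ t : Y.Field W, Y.IsVC t ∧ s.IsPush f t ∧
      act (tmap L f : (tobj L X : IPVec U) ⟶ tobj L Y).hom (q X W s) = q Y W t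
  coh : ∀ {U U' : Man} (h : U ⟶ U') (X : LocObj U') W (s : X.Field W), X.IsVC s →
    (LocObj.pb h X).IsVC (s.pull h) ∧
      act (tcoh L h X : IPVec.pb h (tobj L X) ⟶ (tobj L (LocObj.pb h X) : IPVec U)).hom
        (eta h (q X W s)) = q (LocObj.pb h X) ((pre h).obj W) (s.pull h)

/-- Maps into a star-algebra satisfying the canonical anti-commutation relations. -/
structure IsCAR {U : Man} (V : IPVec U) (B : StarAlg U) (k : V.sh ⟶ B.sh) : Prop where
  star : ∀ W (v : Sec V.sh W), act k (V.star W v) = B.star W (act k v)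
  car : ∀ W (v w : Sec V.sh W), B.mul W (act k v) (act k w) + B.mul W (act k w) (act k v) =
    V.pair W v w • B.one W

/-- The strong transformation `K` is given by the star-algebras presented by the canonical
anti-commutation relations, with universal maps `j`. -/
structure CARPresentation (K : IPVec.prestack.StrongTrans StarAlg.prestack) where
  j : ∀ {U : Man} (V : IPVec U), V.sh ⟶ (tobj K V : StarAlg U).sh
  isCAR : ∀ {U : Man} (V : IPVec U), IsCAR V (tobj K V) (j V)
  univ : ∀ {U : Man} (V : IPVec U) (B : StarAlg U) (k : V.sh ⟶ B.sh), IsCAR V B k →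
    ∃! g : (tobj K V : StarAlg U) ⟶ B, j V ≫ g.hom = k
  map : ∀ {U : Man} {V N : IPVec U} (f : V ⟶ N),
    j V ≫ (tmap K f : (tobj K V : StarAlg U) ⟶ tobj K N).hom = f.hom ≫ j N
  coh : ∀ {U U' : Man} (h : U ⟶ U') (V : IPVec U') W (v : Sec V.sh W),
    act (tcoh K h V : StarAlg.pb h (tobj K V) ⟶ (tobj K (IPVec.pb h V) : StarAlg U)).hom
      (eta h (act (j V) v)) = act (j (IPVec.pb h V)) (eta h v)

end SmoothAQFT

end

open SmoothAQFT CategoryTheory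

/-! ### Strong transformations from families of functors compatible with pullbacks. -/

noncomputable section

namespace SmoothAQFT

/-! The geometry reduces to calculus on a cylinder. Every family (π, E) carries a global time
function: an identification over U of M with U × ℝ in which E = ρ dτ with ρ > 0
(`LocObj.exists_clock`). Near a point of the base it is a trivialization, with the fiber coordinate
reversed if E is negative in it. Local time functions are glued by a partition of unity: a convex
combination of functions increasing along the fibers is increasing and still maps every fiber onto
ℝ, and the implicit function theorem makes the fiberwise inverse smooth.

In these coordinates D s = t is the ordinary differential equation ∂s/∂τ = ρ R t with R = diag(-i,
i) (`isDirac_iff`). Vertically past or future compact support means support bounded below or above,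
locally uniformly in the base. So S⁺ and S⁻ take the primitive of ρ R t that vanishes in the past or
in the future (`cylPrim`). Uniqueness of such primitives gives linearity and compatibility with
restriction, and the tube lemma gives the causal support property.

Two primitives of the same function, one vanishing in the past and one in the future, differ by the
total integral. Hence S s is constant along each fiber, with value R I(s), where I(s) is the fiber
integral of s E (`prop_pt`). It follows that I(s) = 0 exactly when the retarded and advanced
solutions coincide, that is, when s is the image under D of a field of vertically compact support
(`pairInt_eq_zero_iff`). By means of a bump function along the fibers I is onto the smooth ℂ²-valued
functions (`exists_pairInt`). Thus over every open set I identifies the required quotient with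
C^∞(-, ℂ²); the involution becomes swap and conjugation, the pairing becomes -(v₁w₂ + v₂w₁).

This is why the Dirac stack morphism can be taken constant on each U, with value the free module
C^∞(-, ℂ²) of rank two (`pairMod`). Extension by zero along f preserves fiber integrals because
f^*E' = E (`exists_push`), so every f acts as the identity. Fiber integration commutes with base
change (`pairInt_pull`), so the coherence map is pullback of functions; it is invertible because the
module is free on constant sections.

The CAR algebra over an open set is the ring presented by functions and sections, and these rings
are then sheafified. Functions are generators too, so the antilinear involution is simply a ring
homomorphism to the opposite ring. The structure survives sheafification because multilinear maps on
an associated sheaf can be built from, and compared on, presheaf sections, one variable at a time.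
The coherence map from the pullback of CAR(V) to CAR of the pullback is adjoint to a map into a
pushforward algebra. Its inverse comes from the universal property, since the pulled back generators
satisfy the relations; both composites fix generators. -/

/-- A family of functors between coherent systems of pullback functors, compatible with them up to
coherent isomorphisms. -/
structure Pullbacks.Trans {C D : Man → Type 1} [∀ U, Category.{0} (C U)] [∀ U, Category.{0} (D U)]
    (P : Pullbacks C) (Q : Pullbacks D) where
  F : ∀ U, C U ⥤ D U
  coh : ∀ {U U' : Man} (h : U ⟶ U'), F U' ⋙ Q.pb h ≅ P.pb h ⋙ F U
  unit : ∀ {U : Man} (X : C U), (coh (𝟙 U)).hom.app X ≫ (F U).map ((P.pbId U).hom.app X) =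
    (Q.pbId U).hom.app ((F U).obj X)
  comp : ∀ {U U' U'' : Man} (h : U ⟶ U') (k : U' ⟶ U'') (X : C U''),
    (coh (h ≫ k)).hom.app X ≫ (F U).map ((P.pbComp h k).hom.app X) =
      (Q.pbComp h k).hom.app ((F U'').obj X) ≫ (Q.pb h).map ((coh k).hom.app X) ≫
        (coh h).hom.app ((P.pb k).obj X)

namespace Pullbacks.Trans

variable {C D : Man → Type 1} [∀ U, Category.{0} (C U)] [∀ U, Category.{0} (D U)]
  {P : Pullbacks C} {Q : Pullbacks D}

theorem nat_aux {E E' : Type*} [Category E] [Category E'] (F : E ⥤ E') {A : E} {B : E'}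
    (q : F.obj A ⟶ B) : F.map (𝟙 A) ≫ q = q ≫ 𝟙 B := by simp

/-- Passes from an axiom of `Trans`, written with the `hom` direction, to the corresponding axiom of
`StrongTrans`, written with the inverse. The identities on the right are the components of unitors
of `Cat`; in `comp_aux` they are those of associators. -/
theorem unit_aux {E : Type*} [Category E] {A B B' : E} (p : A ≅ B) (q : B ⟶ B') (r : A ⟶ B')
    (H : p.hom ≫ q = r) : p.inv ≫ r = q ≫ 𝟙 _ ≫ 𝟙 _ := by
  simp [← H]

theorem comp_aux {E : Type*} [Category E] {A B B' A₁ A₂ : E} (p : A ≅ B) (q : B ⟶ B') (r : A ⟶ A₁)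
    (s : A₁ ≅ A₂) (t : A₂ ≅ B') (H : p.hom ≫ q = r ≫ s.hom ≫ t.hom) :
    p.inv ≫ r = q ≫ 𝟙 _ ≫ t.inv ≫ 𝟙 _ ≫ s.inv ≫ 𝟙 _ := by
  simp [← cancel_epi p.hom, ← cancel_mono s.hom, ← cancel_mono t.hom, H]

/-- The associated strong transformation. -/
def toStrongTrans (T : Trans P Q) : P.toPseudofunctor.StrongTrans Q.toPseudofunctor where
  app U := (T.F U.as.unop).toCatHom
  -- A strong transformation compares in the opposite direction; with this choice `tcoh` is
  -- `coh.hom`.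
  naturality h := Cat.Hom.isoMk (T.coh h.as.unop).symm
  naturality_naturality {a b f g} η := by
    -- The source bicategory is locally discrete, so identities are the only 2-cells to be checked.
    obtain rfl : f = g := LocallyDiscrete.eq_of_hom η
    obtain rfl : η = 𝟙 f := Subsingleton.elim _ _
    rw [P.toPseudofunctor.map₂_id, Q.toPseudofunctor.map₂_id]
    apply Cat.Hom₂.ext
    ext X
    exact nat_aux (T.F b.as.unop) _
  naturality_id a := by
    apply Cat.Hom₂.ext
    ext X
    exact unit_aux ((T.coh (𝟙 a.as.unop)).app X) _ _ (T.unit X)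
  naturality_comp {a b c} f g := by
    apply Cat.Hom₂.ext
    ext X
    exact comp_aux ((T.coh (g.as.unop ≫ f.as.unop)).app X) _ _
      ((Q.pb g.as.unop).mapIso ((T.coh f.as.unop).app X))
      ((T.coh g.as.unop).app ((P.pb f.as.unop).obj X)) (T.comp g.as.unop f.as.unop X)

end Pullbacks.Trans

end SmoothAQFT

end

/-! ### Sheafification of presheaves of modules, in terms of sections. -/

noncomputable section

namespace SmoothAQFT

/-- Presheaves of modules over the sheaf of complex-valued smooth functions. -/
abbrev PMod (U : Man) := PresheafOfModules.{0} (O U).obj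

section Sheafification

variable {U : Man}

/-- Sections of a presheaf of modules. -/
abbrev PSec (P : PMod U) (W : Opens U) : Type := P.obj (op W)

/-- Restriction of sections of a presheaf of modules. -/
def pres (P : PMod U) {W W' : Opens U} (i : W' ≤ W) (v : PSec P W) : PSec P W' :=
  P.map (homOfLE i).op v

/-- The associated sheaf of modules. -/
def shf (P : PMod U) : Mod U := (PresheafOfModules.sheafification.{0} (𝟙 (O U).obj)).obj P

/-- The canonical map to the associated sheaf. -/
def iota {P : PMod U} {W : Opens U} (v : PSec P W) : Sec (shf P) W :=
  ((PresheafOfModules.sheafificationAdjunction.{0} (𝟙 (O U).obj)).unit.app P).app (op W) v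

variable {P P₁ P₂ : PMod U} {N T : Mod U} {W W' : Opens U}

theorem iota_add (v w : PSec P W) : iota (v + w) = iota v + iota w := map_add _ _ _

theorem iota_smul (a : Fn U W) (v : PSec P W) : iota (a • v) = a • iota v :=
  map_smul (((PresheafOfModules.sheafificationAdjunction.{0} (𝟙 (O U).obj)).unit.app P).app
    (op W)).hom a v

theorem iota_res (i : W' ≤ W) (v : PSec P W) : iota (pres P i v) = res _ i (iota v) :=
  PresheafOfModules.naturality_apply
    ((PresheafOfModules.sheafificationAdjunction.{0} (𝟙 (O U).obj)).unit.app P) (homOfLE i).op v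

theorem shf_hom_ext {f g : shf P ⟶ N} (H : ∀ W (v : PSec P W), act f (iota v) = act g (iota v)) :
    f = g := by
  apply ((PresheafOfModules.sheafificationAdjunction.{0} (𝟙 (O U).obj)).homEquiv P N).injective
  refine (Adjunction.homEquiv_unit _ _ _ f).trans (Eq.trans ?_
    (Adjunction.homEquiv_unit _ _ _ g).symm)
  ext W v
  exact H _ _

theorem shf_hom_exists (f : ∀ W, PSec P W → Sec N W) (add : ∀ W v w, f W (v + w) = f W v + f W w)
    (smul : ∀ W (a : Fn U W) v, f W (a • v) = a • f W v)
    (nat : ∀ W W' (i : W' ≤ W) v, f W' (pres P i v) = res N i (f W v)) :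
    ∃ g : shf P ⟶ N, ∀ W (v : PSec P W), act g (iota v) = f W v := by
  -- The right adjoint includes restriction of scalars along the identity, which changes nothing on
  -- sections but has to appear in the type.
  let k : P ⟶ (PresheafOfModules.restrictScalars (𝟙 (O U).obj)).obj N.val :=
    { app := fun W => ModuleCat.ofHom
        (Y := ((PresheafOfModules.restrictScalars (𝟙 (O U).obj)).obj N.val).obj W)
        { toFun := f W.unop
          map_add' := add _
          map_smul' := smul _ }
      naturality := by
        intro W W' i
        ext v
        exact nat _ _ i.unop.le v }
  refine ⟨((PresheafOfModules.sheafificationAdjunction.{0} (𝟙 (O U).obj)).homEquiv P N).symm k, ?_⟩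
  intro W v
  have := ((PresheafOfModules.sheafificationAdjunction.{0} (𝟙 (O U).obj)).homEquiv P N).apply_symm_apply k
  rw [Adjunction.homEquiv_unit] at this
  exact congrArg (fun f => f.app (op W) v) this

end Sheafification

end SmoothAQFT

end

/-! ### Linear, antilinear and bilinear maps on associated sheaves. -/

noncomputable section

namespace SmoothAQFT

section
variable {U : Man} (P : PMod U) {W W' W'' : Opens U}

theorem pres_add (i : W' ≤ W) (v w : PSec P W) : pres P i (v + w) = pres P i v + pres P i w :=
  map_add (P.map (homOfLE i).op).hom v w

theorem pres_smul (i : W' ≤ W) (a : Fn U W) (v : PSec P W) :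
    pres P i (a • v) = Fn.rs i a • pres P i v :=
  P.map_smul (homOfLE i).op a v

theorem pres_pres (i : W' ≤ W) (j : W'' ≤ W') (v : PSec P W) :
    pres P j (pres P i v) = pres P (j.trans i) v := by
  have := P.map_comp (homOfLE i).op (homOfLE j).op
  exact (congrArg (fun f => f v) this).symm

theorem pres_refl (i : W ≤ W) (v : PSec P W) : pres P i v = v := by
  have := P.map_id (op W)
  exact congrArg (fun f => f v) this

end

section
variable {U : Man}

/-- Bilinear maps from presheaves of modules to a sheaf of modules. -/
structure IsPBil {P₁ P₂ : PMod U} {T : Mod U}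
    (B : ∀ W, PSec P₁ W → PSec P₂ W → Sec T W) : Prop where
  add_left : ∀ R v w u, B R (v + w) u = B R v u + B R w u
  add_right : ∀ R v w u, B R u (v + w) = B R u v + B R u w
  smul_left : ∀ R (a : Fn U R) v u, B R (a • v) u = a • B R v u
  smul_right : ∀ R (a : Fn U R) v u, B R u (a • v) = a • B R u v
  nat : ∀ R R' (i : R' ≤ R) v w, B R' (pres _ i v) (pres _ i w) = res T i (B R v w)

theorem shf_lin_exists {P : PMod U} {N : Mod U} (f : ∀ W, PSec P W → Sec N W)
    (add : ∀ W v w, f W (v + w) = f W v + f W w)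
    (smul : ∀ W (a : Fn U W) v, f W (a • v) = a • f W v)
    (nat : ∀ W W' (i : W' ≤ W) v, f W' (pres P i v) = res N i (f W v)) :
    ∃ g : ∀ R, Sec (shf P) R → Sec N R, IsLin g ∧ ∀ W (v : PSec P W), g _ (iota v) = f W v := by
  obtain ⟨g, hg⟩ := shf_hom_exists f add smul nat
  exact ⟨fun R v => act g v, isLin_act g, hg⟩

/-- An antilinear map into `N` is a linear map into the conjugate sheaf `cj N`, so the linear case
applies. -/
theorem shf_conj_exists {P : PMod U} {N : Mod U} (f : ∀ W, PSec P W → Sec N W)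
    (add : ∀ W v w, f W (v + w) = f W v + f W w)
    (smul : ∀ W (a : Fn U W) v, f W (a • v) = conjFn W a • f W v)
    (nat : ∀ W W' (i : W' ≤ W) v, f W' (pres P i v) = res N i (f W v)) :
    ∃ g : ∀ R, Sec (shf P) R → Sec N R, IsConj g ∧ ∀ W (v : PSec P W), g _ (iota v) = f W v := by
  obtain ⟨g, hg⟩ := shf_hom_exists (N := cj N) f add smul nat
  exact ⟨fun R v => act g v, ⟨fun R v w => act_add g v w, fun R a v => act_smul g a v,
    fun R R' i v => act_res g i v⟩, hg⟩

theorem shf_conj_unique {P : PMod U} {N : Mod U} {f g : ∀ R, Sec (shf P) R → Sec N R}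
    (hf : IsConj f) (hg : IsConj g) (H : ∀ W (v : PSec P W), f _ (iota v) = g _ (iota v)) :
    f = g := by
  have := shf_hom_ext (f := mkHom (N := cj N) f hf.1 hf.2 hf.3)
    (g := mkHom (N := cj N) g hg.1 hg.2 hg.3) H
  funext R v
  exact congrArg (fun k => act k v) this

theorem shf_unique {P : PMod U} {N : Mod U} {f g : ∀ R, Sec (shf P) R → Sec N R}
    (hf : IsLin f) (hg : IsLin g) (H : ∀ W (v : PSec P W), f _ (iota v) = g _ (iota v)) :
    f = g := by
  have := shf_hom_ext (f := mkHom f hf.1 hf.2 hf.3) (g := mkHom g hg.1 hg.2 hg.3) H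
  funext R v
  exact congrArg (fun k => act k v) this

/-- Linear uniqueness, used for one variable at a time. With `w` over `Q` frozen, restricting both
arguments to `R ⊓ Q` makes `B` a morphism into `near T Q`, so a section over one open set can be
paired with sections over all others. -/
theorem shf_bil_unique {P₁ P₂ : PMod U} {T : Mod U}
    {B C : ∀ R, Sec (shf P₁) R → Sec (shf P₂) R → Sec T R} (hB : IsBil B) (hC : IsBil C)
    (H : ∀ W (v : PSec P₁ W) (w : PSec P₂ W), B _ (iota v) (iota w) = C _ (iota v) (iota w)) :
    B = C := by
  have s1 : ∀ W (v : PSec P₁ W) (P : Opens U) (i : P ≤ W) (w : Sec (shf P₂) P),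
      B P (res _ i (iota v)) w = C P (res _ i (iota v)) w := by
    intro W v P i w
    have := shf_unique (hB.lin_right (iota v)) (hC.lin_right (iota v)) (by
      intro W' v'
      have := H (W' ⊓ W) (pres _ inf_le_right v) (pres _ inf_le_left v')
      rw [iota_res, iota_res] at this
      exact this)
    -- The equality obtained lives over `P ⊓ W`; restriction along `P ≤ P ⊓ W` brings it back to
    -- `P`.
    have := congrArg (res T (le_inf le_rfl i)) (congrArg ofN (congrFun (congrFun this P) w))
    rw [ofN_toN, ofN_toN, ← hB.nat, ← hC.nat, res_res, res_res, res_refl] at this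
    exact this
  funext R v w
  have := shf_unique (hB.lin_left w) (hC.lin_left w) (by
    intro W' v'
    exact s1 _ _ _ _ _)
  have := congrArg (res T (le_inf le_rfl le_rfl)) (congrArg ofN (congrFun (congrFun this R) v))
  rw [ofN_toN, ofN_toN, ← hB.nat, ← hC.nat, res_res, res_res, res_refl, res_refl] at this
  exact this

/-- Currying. `G W v` extends the second argument while `v` is still a presheaf section; it depends
linearly on `v`, so `K Q w` can extend the first argument while `w` is already a section of the
associated sheaf. -/
theorem shf_bil_exists {P₁ P₂ : PMod U} {T : Mod U}
    {β : ∀ W, PSec P₁ W → PSec P₂ W → Sec T W} (hβ : IsPBil β) :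
    ∃ B : ∀ R, Sec (shf P₁) R → Sec (shf P₂) R → Sec T R, IsBil B ∧
      ∀ W v w, B _ (iota v) (iota w) = β W v w := by
  have s1 : ∀ W (v : PSec P₁ W), ∃ g : ∀ R, Sec (shf P₂) R → Sec (near T W) R,
      IsLin g ∧ ∀ W' (w : PSec P₂ W'), g _ (iota w) =
        toN (β (W' ⊓ W) (pres _ inf_le_right v) (pres _ inf_le_left w)) := by
    intro W v
    apply shf_lin_exists
    · intro W' w w'
      rw [pres_add, hβ.add_right, toN_add]
    · intro W' a w
      rw [pres_smul, hβ.smul_right, toN_smul]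
    · intro W' W'' i w
      rw [← toN_res, pres_pres]
      have := hβ.nat _ _ (inf_le_inf_right W i) (pres _ inf_le_right v) (pres _ inf_le_left w)
      rw [pres_pres, pres_pres] at this
      rw [this]
  choose G hG hG' using s1
  -- Linearity in the frozen argument is an instance of uniqueness: both sides are morphisms with
  -- the same values on presheaf sections. The same pattern serves the other compatibilities of `G`
  -- and `K`.
  have G_add : ∀ W v v', G W (v + v') = fun R w => G W v R w + G W v' R w := by
    intro W v v'
    apply shf_unique (hG _ _)
    · constructor
      · intro R a b
        rw [(hG _ _).add, (hG _ _).add]; abel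
      · intro R a b
        rw [(hG _ _).smul, (hG _ _).smul, smul_add]
      · intro R R' i b
        rw [(hG _ _).nat, (hG _ _).nat, res_add]
    · intro W' w
      rw [hG', hG', hG', pres_add, hβ.add_left, toN_add]
  have G_smul : ∀ W (a : Fn U W) v, G W (a • v) = fun R w =>
      toN (Fn.rs (inf_le_right : R ⊓ W ≤ _) a • ofN (G W v R w)) := by
    intro W a v
    apply shf_unique (hG _ _)
    · constructor
      · intro R b c
        rw [(hG _ _).add, ofN_add, smul_add, toN_add]
      · intro R b c
        rw [(hG _ _).smul, ofN_smul, smul_smul_comm, toN_smul]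
      · intro R R' i b
        rw [(hG _ _).nat, ofN_res, ← toN_res, res_smul, rs_rs]
    · intro W' w
      rw [hG', hG', pres_smul, hβ.smul_left, ofN_toN]
  have G_res : ∀ W W' (i : W' ≤ W) v, G W' (pres _ i v) = fun R w =>
      toN (res T (inf_le_inf_left R i) (ofN (G W v R w))) := by
    intro W W' i v
    apply shf_unique (hG _ _)
    · constructor
      · intro R b c
        rw [(hG _ _).add, ofN_add, res_add, toN_add]
      · intro R b c
        rw [(hG _ _).smul, ofN_smul, res_smul, rs_rs, toN_smul]
      · intro R R' j b
        rw [(hG _ _).nat, ofN_res, ← toN_res, res_res, res_res]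
    · intro W'' w
      rw [hG', hG', ofN_toN, pres_pres]
      have := hβ.nat _ _ (inf_le_inf_left W'' i) (pres _ inf_le_right v) (pres _ inf_le_left w)
      rw [pres_pres, pres_pres] at this
      rw [this]
  have s2 : ∀ Q (w : Sec (shf P₂) Q), ∃ k : ∀ R, Sec (shf P₁) R → Sec (near T Q) R,
      IsLin k ∧ ∀ W (v : PSec P₁ W), k _ (iota v) =
        toN (res T (le_inf inf_le_right inf_le_left) (ofN (G W v Q w))) := by
    intro Q w
    apply shf_lin_exists
    · intro W v v'
      rw [G_add, ofN_add, res_add, toN_add]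
    · intro W a v
      rw [G_smul, ofN_toN, res_smul, rs_rs, toN_smul]
    · intro W W' i v
      rw [G_res, ofN_toN, ← toN_res, res_res, res_res]
  choose K hK hK' using s2
  have K_add : ∀ Q w w', K Q (w + w') = fun R v => K Q w R v + K Q w' R v := by
    intro Q w w'
    apply shf_unique (hK _ _)
    · constructor
      · intro R a b
        rw [(hK _ _).add, (hK _ _).add]; abel
      · intro R a b
        rw [(hK _ _).smul, (hK _ _).smul, smul_add]
      · intro R R' i b
        rw [(hK _ _).nat, (hK _ _).nat, res_add]
    · intro W v
      rw [hK', hK', hK', (hG _ _).add, ofN_add, res_add, toN_add]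
  have K_smul : ∀ Q (a : Fn U Q) w, K Q (a • w) = fun R v =>
      toN (Fn.rs (inf_le_right : R ⊓ Q ≤ Q) a • ofN (K Q w R v)) := by
    intro Q a w
    apply shf_unique (hK _ _)
    · constructor
      · intro R b c
        rw [(hK _ _).add, ofN_add, smul_add, toN_add]
      · intro R b c
        rw [(hK _ _).smul, ofN_smul, smul_smul_comm, toN_smul]
      · intro R R' i b
        rw [(hK _ _).nat, ofN_res, ← toN_res, res_smul, rs_rs]
    · intro W v
      rw [hK', hK', (hG _ _).smul, ofN_smul, res_smul, rs_rs, ofN_toN]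
  have K_res : ∀ Q Q' (i : Q' ≤ Q) w, K Q' (res _ i w) = fun R v =>
      toN (res T (inf_le_inf_left R i) (ofN (K Q w R v))) := by
    intro Q Q' i w
    apply shf_unique (hK _ _)
    · constructor
      · intro R b c
        rw [(hK _ _).add, ofN_add, res_add, toN_add]
      · intro R b c
        rw [(hK _ _).smul, ofN_smul, res_smul, rs_rs, toN_smul]
      · intro R R' j b
        rw [(hK _ _).nat, ofN_res, ← toN_res, res_res, res_res]
    · intro W v
      rw [hK', hK', (hG _ _).nat, ofN_res, ofN_toN, res_res, res_res]
  -- For both arguments over `R` the value lies over `R ⊓ R`, whence the restriction to `R`.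
  refine ⟨fun R v w => res T (le_inf le_rfl le_rfl) (ofN (K R w R v)), ?_, ?_⟩
  · constructor
    · intro R v v' w
      rw [(hK _ _).add, ofN_add, res_add]
    · intro R v v' w
      rw [K_add, ofN_add, res_add]
    · intro R a v w
      rw [(hK _ _).smul, ofN_smul, res_smul, rs_rs, rs_refl]
    · intro R a v w
      rw [K_smul, ofN_toN, res_smul, rs_rs, rs_refl]
    · intro R R' i v w
      rw [K_res, ofN_toN, (hK _ _).nat, ofN_res, res_res, res_res, res_res]
  · intro W v w
    dsimp only
    rw [hK', hG', ofN_toN, ofN_toN, res_res]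
    have := hβ.nat _ _ (le_inf le_rfl le_rfl : W ≤ W ⊓ W) (pres P₁ inf_le_right v)
      (pres P₂ inf_le_left w)
    rw [pres_pres, pres_pres, pres_refl, pres_refl] at this
    exact this.symm

/-- Both bracketings are trilinear. They agree on presheaf sections, hence for arbitrary `c` by
linear uniqueness (`s1`), hence for arbitrary `a` and `b` by bilinear uniqueness. -/
theorem shf_assoc {P : PMod U} {m : ∀ W, PSec P W → PSec P W → PSec P W}
    (m_assoc : ∀ W a b c, m W (m W a b) c = m W a (m W b c))
    {B : ∀ R, Sec (shf P) R → Sec (shf P) R → Sec (shf P) R} (hB : IsBil B)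
    (H : ∀ W v w, B _ (iota v) (iota w) = iota (m W v w)) (Q) (a b c : Sec (shf P) Q) :
    B Q (B Q a b) c = B Q a (B Q b c) := by
  have s1 : ∀ W (a b : PSec P W) (Q : Opens U) (i : Q ≤ W) (c : Sec (shf P) Q),
      B Q (B Q (res _ i (iota a)) (res _ i (iota b))) c =
        B Q (res _ i (iota a)) (B Q (res _ i (iota b)) c) := by
    intro W a b Q i c
    have h1 : IsLin (N := near (shf P) W) fun R (c : Sec (shf P) R) =>
        toN (B _ (res _ inf_le_right (B _ (iota a) (iota b))) (res _ inf_le_left c)) :=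
      hB.lin_right _
    have h2 : IsLin (N := near (shf P) W) fun R (c : Sec (shf P) R) =>
        toN (B _ (res _ inf_le_right (iota a))
          (B _ (res _ inf_le_right (iota b)) (res _ inf_le_left c))) := by
      constructor
      · intro R v w
        rw [res_add, hB.add_right, hB.add_right, toN_add]
      · intro R a v
        rw [res_smul, hB.smul_right, hB.smul_right, toN_smul]
      · intro R R' i v
        rw [← toN_res, ← hB.nat, ← hB.nat, res_res, res_res, res_res, res_res]
    have := shf_unique h1 h2 (by
      intro W' c
      have e1 := H (W' ⊓ W) (m _ (pres _ inf_le_right a) (pres _ inf_le_right b))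
        (pres _ inf_le_left c)
      rw [m_assoc, ← H, ← H, ← H, iota_res, iota_res, iota_res] at e1
      rw [← hB.nat]
      exact e1)
    have := congrArg (res _ (le_inf le_rfl i)) (congrArg ofN (congrFun (congrFun this Q) c))
    simp only [ofN_toN, ← hB.nat, res_res, res_refl] at this
    exact this
  have := shf_bil_unique (StarAlg.lin_mul_right hB c) (StarAlg.lin_mul_left hB c) (by
    intro W a b
    rw [← hB.nat]
    exact congrArg toN (s1 _ _ _ _ _ _))
  have := congrArg (res _ (le_inf le_rfl le_rfl))
    (congrArg ofN (congrFun (congrFun (congrFun this Q) a) b))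
  simp only [ofN_toN, ← hB.nat, res_res, res_refl] at this
  exact this

end

end SmoothAQFT

end

/-! ### The rings presented by the canonical anti-commutation relations. -/

noncomputable section

namespace SmoothAQFT

/-- The free ring on the functions and the sections over an open subset. -/
abbrev CarFree {U : Man} (V : IPVec U) (W : Opens U) : Type :=
  FreeAlgebra ℤ (Fn U W ⊕ Sec V.sh W)

/-- The generator given by a function. -/
abbrev CarFree.fn {U : Man} {V : IPVec U} {W : Opens U} (a : Fn U W) : CarFree V W :=
  FreeAlgebra.ι ℤ (Sum.inl a)

/-- The generator given by a section. -/
abbrev CarFree.sec {U : Man} {V : IPVec U} {W : Opens U} (v : Sec V.sh W) : CarFree V W :=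
  FreeAlgebra.ι ℤ (Sum.inr v)

open CarFree in
/-- The relations of the canonical anti-commutation relations algebra. -/
inductive CarRel {U : Man} (V : IPVec U) (W : Opens U) : CarFree V W → CarFree V W → Prop
  | fn_add (a b : Fn U W) : CarRel V W (fn (a + b)) (fn a + fn b)
  | fn_mul (a b : Fn U W) : CarRel V W (fn (a * b)) (fn a * fn b)
  | fn_one : CarRel V W (fn 1) 1
  | sec_add (v w : Sec V.sh W) : CarRel V W (sec (v + w)) (sec v + sec w)
  | sec_smul (a : Fn U W) (v : Sec V.sh W) : CarRel V W (sec (a • v)) (fn a * sec v)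
  | comm (a : Fn U W) (v : Sec V.sh W) : CarRel V W (fn a * sec v) (sec v * fn a)
  | car (v w : Sec V.sh W) : CarRel V W (sec v * sec w + sec w * sec v) (fn (V.pair W v w))

/-- The ring presented by functions and sections subject to the canonical anti-commutation
relations. -/
def CarRing {U : Man} (V : IPVec U) (W : Opens U) : Type := RingQuot (CarRel V W)

namespace CarRing
variable {U : Man} {V : IPVec U} {W W' W'' : Opens U}

instance : Ring (CarRing V W) := inferInstanceAs (Ring (RingQuot (CarRel V W)))

/-- The quotient map. -/
def mk : CarFree V W →+* CarRing V W := RingQuot.mkRingHom (CarRel V W)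

/-- The image of a section. -/
def sec (v : Sec V.sh W) : CarRing V W := mk (CarFree.sec v)

theorem mk_rel {x y : CarFree V W} (h : CarRel V W x y) : mk x = mk y := RingQuot.mkRingHom_rel h

/-- The image of the functions. -/
def fn : Fn U W →+* CarRing V W :=
  RingHom.mk' (⟨⟨fun a => mk (CarFree.fn a), (mk_rel .fn_one).trans (map_one mk)⟩,
    fun a b => (mk_rel (.fn_mul a b)).trans (map_mul mk _ _)⟩)
    (fun a b => (mk_rel (.fn_add a b)).trans (map_add mk _ _))

theorem sec_add (v w : Sec V.sh W) : sec (v + w) = sec v + sec w :=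
  (mk_rel (.sec_add v w)).trans (map_add mk _ _)

theorem sec_smul (a : Fn U W) (v : Sec V.sh W) : sec (a • v) = fn a * sec v :=
  (mk_rel (.sec_smul a v)).trans (map_mul mk _ _)

theorem fn_mul_sec (a : Fn U W) (v : Sec V.sh W) : fn a * sec v = sec v * fn a :=
  (map_mul mk _ _).symm.trans ((mk_rel (.comm a v)).trans (map_mul mk _ _))

theorem sec_car (v w : Sec V.sh W) : sec v * sec w + sec w * sec v = fn (V.pair W v w) := by
  refine Eq.trans ?_ (mk_rel (.car v w))
  rw [map_add, map_mul, map_mul]; rfl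

/-- The integer scalars of the free algebra need no case of their own, since they are images under
`fn` of constant functions. -/
theorem induct {p : CarRing V W → Prop} (hfn : ∀ a, p (fn a)) (hsec : ∀ v, p (sec v))
    (hadd : ∀ x y, p x → p y → p (x + y)) (hmul : ∀ x y, p x → p y → p (x * y)) (x) : p x := by
  obtain ⟨x, rfl⟩ := RingQuot.mkRingHom_surjective (CarRel V W) x
  change p (mk x)
  have h1 : p 1 := by rw [← map_one fn]; exact hfn 1
  have hz : ∀ r : ℤ, p (r : CarRing V W) := fun r => by
    rw [← map_intCast (fn (V := V) (W := W)) r]; exact hfn _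
  induction x using FreeAlgebra.induction with
  | grade0 r =>
    have : mk (algebraMap ℤ (CarFree V W) r) = (r : CarRing V W) := by
      rw [eq_intCast (algebraMap ℤ (CarFree V W)) r, map_intCast]
    rw [this]; exact hz r
  | grade1 x => cases x with
    | inl a => exact hfn a
    | inr v => exact hsec v
  | mul a b ha hb => rw [map_mul]; exact hmul _ _ ha hb
  | add a b ha hb => rw [map_add]; exact hadd _ _ ha hb

theorem hom_ext {R : Type*} [Ring R] {f g : CarRing V W →+* R} (h1 : ∀ a, f (fn a) = g (fn a))
    (h2 : ∀ v, f (sec v) = g (sec v)) : f = g :=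
  RingHom.ext fun x => induct (p := fun x => f x = g x) h1 h2 (fun x y hx hy => by rw [map_add, map_add, hx, hy])
    (fun x y hx hy => by rw [map_mul, map_mul, hx, hy]) x

theorem fn_central (a : Fn U W) (x : CarRing V W) : fn a * x = x * fn a := by
  induction x using induct with
  -- Sections of the structure sheaf are only known as a ring here, so commutativity is read off
  -- from values.
  | hfn b => rw [← map_mul, ← map_mul]; congr 1; exact Fn.ext fun x => mul_comm _ _
  | hsec v => exact fn_mul_sec a v
  | hadd x y hx hy => rw [mul_add, add_mul, hx, hy]
  | hmul x y hx hy => rw [← mul_assoc, hx, mul_assoc, hy, mul_assoc]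

section
variable {R : Type} [Ring R] (φ : Fn U W →+* R) (ψ : Sec V.sh W → R)
  (add : ∀ v w, ψ (v + w) = ψ v + ψ w) (smul : ∀ a v, ψ (a • v) = φ a * ψ v)
  (comm : ∀ a v, φ a * ψ v = ψ v * φ a) (car : ∀ v w, ψ v * ψ w + ψ w * ψ v = φ (V.pair W v w))

-- What makes `lift` descend: the relations among functions hold because `φ` is a ring homomorphism,
-- and each of the other four is one of the hypotheses.
include add smul comm car in
theorem lift_aux {x y : CarFree V W} (h : CarRel V W x y) :
    FreeAlgebra.lift ℤ (Sum.elim φ ψ) x = FreeAlgebra.lift ℤ (Sum.elim φ ψ) y := by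
  cases h <;> simp [FreeAlgebra.lift_ι_apply, *]

/-- Ring homomorphisms out of the presented ring. -/
def lift : CarRing V W →+* R :=
  RingQuot.lift ⟨(FreeAlgebra.lift ℤ (Sum.elim φ ψ)).toRingHom,
    fun _ _ h => lift_aux φ ψ add smul comm car h⟩

theorem lift_fn (a : Fn U W) : lift φ ψ add smul comm car (fn a) = φ a :=
  (RingQuot.lift_mkRingHom_apply _ _ _).trans (FreeAlgebra.lift_ι_apply _ _)

theorem lift_sec (v : Sec V.sh W) : lift φ ψ add smul comm car (sec v) = ψ v :=
  (RingQuot.lift_mkRingHom_apply _ _ _).trans (FreeAlgebra.lift_ι_apply _ _)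
end

/-- Restriction to a smaller open subset. -/
def rs (i : W' ≤ W) : CarRing V W →+* CarRing V W' :=
  lift (fn.comp ((O U).obj.map (homOfLE i).op).hom) (fun v => sec (res _ i v))
    (fun v w => by rw [res_add, sec_add]) (fun a v => by rw [res_smul, sec_smul]; rfl)
    (fun a v => fn_mul_sec _ _) (fun v w => by rw [sec_car, V.pair_bil.nat]; rfl)

theorem rs_fn (i : W' ≤ W) (a : Fn U W) : rs i (fn a : CarRing V W) = fn (Fn.rs i a) :=
  lift_fn ..

theorem rs_sec (i : W' ≤ W) (v : Sec V.sh W) : rs i (sec v) = sec (res _ i v) := lift_sec ..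

theorem rs_rs (i : W' ≤ W) (j : W'' ≤ W') (x : CarRing V W) : rs j (rs i x) = rs (j.trans i) x :=
  congrArg (fun f => f x) (hom_ext (f := (rs j).comp (rs i)) (g := rs (j.trans i))
    (fun a => by rw [RingHom.comp_apply, rs_fn, rs_fn, rs_fn]; rfl)
    (fun v => by rw [RingHom.comp_apply, rs_sec, rs_sec, rs_sec, res_res]))

theorem rs_refl (i : W ≤ W) (x : CarRing V W) : rs i x = x :=
  congrArg (fun f => f x) (hom_ext (f := rs i) (g := RingHom.id _)
    (fun a => by rw [rs_fn]; rfl) (fun v => by rw [rs_sec, res_refl]; rfl))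

/-- The involution, as a homomorphism to the opposite ring. -/
def starHom : CarRing V W →+* (CarRing V W)ᵐᵒᵖ :=
  -- A homomorphism into the opposite ring needs commuting images, which centrality of functions
  -- supplies.
  lift (RingHom.toOpposite (fn.comp (conjFn W)) fun a _ => fn_central (conjFn W a) _)
    (fun v => .op (sec (V.star W v)))
    (fun v w => by rw [V.star_conj.add, sec_add]; rfl)
    (fun a v => by rw [V.star_conj.smul, sec_smul, fn_central]; rfl)
    (fun a v => congrArg MulOpposite.op (fn_mul_sec _ _).symm)
    -- Reversing products only exchanges the two summands of the anticommutator; what remains is the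
    -- compatibility `pair_star` of the pairing with the involutions.
    (fun v w => by
      refine Eq.trans ?_ (congrArg (fun z => MulOpposite.op (fn z)) (V.pair_star W v w).symm)
      rw [← sec_car, add_comm]; rfl)

/-- The involution. -/
def star (x : CarRing V W) : CarRing V W := (starHom x).unop

theorem star_add (x y : CarRing V W) : star (x + y) = star x + star y := by
  rw [star, map_add]; rfl
theorem star_mul (x y : CarRing V W) : star (x * y) = star y * star x := by
  rw [star, map_mul]; rfl
theorem star_fn (a : Fn U W) : star (fn a : CarRing V W) = fn (conjFn W a) :=
  congrArg MulOpposite.unop (lift_fn ..)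
theorem star_sec (v : Sec V.sh W) : star (sec v) = sec (V.star W v) :=
  congrArg MulOpposite.unop (lift_sec ..)

theorem star_star (x : CarRing V W) : star (star x) = x := by
  induction x using induct with
  | hfn a => rw [star_fn, star_fn, conjFn_conjFn]
  | hsec v => rw [star_sec, star_sec, V.star_star]
  | hadd x y hx hy => rw [star_add, star_add, hx, hy]
  | hmul x y hx hy => rw [star_mul, star_mul, hx, hy]

theorem star_rs (i : W' ≤ W) (x : CarRing V W) : star (rs i x) = rs i (star x) := by
  induction x using induct with
  | hfn a => rw [rs_fn, star_fn, star_fn, rs_fn]; rfl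
  | hsec v => rw [rs_sec, star_sec, star_sec, rs_sec, V.star_conj.nat]
  | hadd x y hx hy => rw [map_add, star_add, star_add, hx, hy, map_add]
  | hmul x y hx hy => rw [map_mul, star_mul, star_mul, hx, hy, map_mul]

instance instModule : Module (Fn U W) (CarRing V W) := fn.toModule

theorem smul_eq (a : Fn U W) (x : CarRing V W) : a • x = fn a * x := rfl

theorem rs_smul (i : W' ≤ W) (a : Fn U W) (x : CarRing V W) : rs i (a • x) = Fn.rs i a • rs i x := by
  rw [smul_eq, map_mul, rs_fn]; rfl

variable (V) in
/-- The presheaf of modules formed by the presented rings. -/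
def pmod : PMod U where
  obj W := @ModuleCat.of (Fn U W.unop) _ (CarRing V W.unop) _ instModule
  map {W W'} i := ModuleCat.ofHom
    (Y := (ModuleCat.restrictScalars ((O U).obj.map i).hom).obj (@ModuleCat.of (Fn U W'.unop) _ (CarRing V W'.unop) _ instModule))
    { toFun := fun x => rs i.unop.le x
      map_add' := map_add _
      map_smul' := rs_smul i.unop.le }
  map_id W := by
    ext x
    exact rs_refl _ x
  map_comp i j := by
    ext x
    exact (rs_rs _ _ x).symm

end CarRing

end SmoothAQFT

end

/-! ### The sheaf of CAR star-algebras. -/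

noncomputable section

namespace SmoothAQFT

namespace CarRing
variable {U : Man} {V : IPVec U} {W W' : Opens U}

/-- The section of the associated sheaf given by an element of the presented ring. -/
def toSec (x : CarRing V W) : Sec (shf (pmod V)) W := iota (P := pmod V) x

theorem toSec_add (x y : CarRing V W) : toSec (x + y) = toSec x + toSec y :=
  iota_add (P := pmod V) x y

theorem toSec_fn_mul (a : Fn U W) (x : CarRing V W) : toSec (fn a * x) = a • toSec x :=
  iota_smul (P := pmod V) a x

theorem toSec_rs (i : W' ≤ W) (x : CarRing V W) : toSec (rs i x) = res _ i (toSec x) :=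
  iota_res (P := pmod V) i x

theorem toSec_unique {N : Mod U} {f g : ∀ R, Sec (shf (pmod V)) R → Sec N R}
    (hf : IsLin f) (hg : IsLin g) (H : ∀ W (x : CarRing V W), f _ (toSec x) = g _ (toSec x)) :
    f = g := shf_unique hf hg H

variable (V)

/-- The multiplication of the presented rings is bilinear over functions because functions are
central, so it passes to the associated sheaf. -/
theorem mul_exists : ∃ B : ∀ R, Sec (shf (pmod V)) R → Sec (shf (pmod V)) R →
    Sec (shf (pmod V)) R, IsBil B ∧ ∀ W (x y : CarRing V W), B _ (toSec x) (toSec y) = toSec (x * y) :=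
  shf_bil_exists (P₁ := pmod V) (P₂ := pmod V) (T := shf (pmod V))
    (β := fun W (x y : CarRing V W) => toSec (x * y))
    { add_left := fun W (x y z : CarRing V W) => by
        refine Eq.trans ?_ (toSec_add _ _)
        rw [← add_mul]; rfl
      add_right := fun W (x y z : CarRing V W) => by
        refine Eq.trans ?_ (toSec_add _ _)
        rw [← mul_add]; rfl
      smul_left := fun W a (x y : CarRing V W) => by
        refine Eq.trans ?_ (toSec_fn_mul _ _)
        rw [← mul_assoc]; rfl
      smul_right := fun W a (x y : CarRing V W) => by
        refine Eq.trans ?_ (toSec_fn_mul _ _)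
        rw [← mul_assoc, fn_central, mul_assoc]; rfl
      nat := fun W W' i (x y : CarRing V W) => by
        refine Eq.trans ?_ (toSec_rs i _)
        rw [map_mul]; rfl }

/-- The involution reverses products, so its antilinearity for the left module structure again rests
on centrality of functions. -/
theorem star_exists : ∃ f : ∀ R, Sec (shf (pmod V)) R → Sec (shf (pmod V)) R, IsConj f ∧
    ∀ W (x : CarRing V W), f _ (toSec x) = toSec (star x) :=
  shf_conj_exists (P := pmod V) (N := shf (pmod V)) (fun W (x : CarRing V W) => toSec (star x))
    (fun W (x y : CarRing V W) => by
      refine Eq.trans ?_ (toSec_add _ _)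
      rw [← star_add]; rfl)
    (fun W a (x : CarRing V W) => by
      refine Eq.trans ?_ (toSec_fn_mul _ _)
      rw [fn_central, ← star_fn, ← star_mul]; rfl)
    (fun W W' i (x : CarRing V W) => by
      refine Eq.trans ?_ (toSec_rs i _)
      rw [← star_rs]; rfl)

end CarRing

open CarRing

/-- The sheaf of star-algebras presented by the canonical anti-commutation relations. -/
def car {U : Man} (V : IPVec U) : StarAlg U :=
  have hm := (mul_exists V).choose_spec
  have hs := (star_exists V).choose_spec
  have one_res : ∀ W W' (i : W' ≤ W), res _ i (toSec (1 : CarRing V W)) = toSec 1 := fun W W' i => by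
    rw [← toSec_rs, map_one]
  have hss : ∀ W v, (star_exists V).choose W ((star_exists V).choose W v) = v := fun W v =>
    congrFun (congrFun (toSec_unique (hs.1.comp hs.1) isLin_id fun W x => by
      rw [hs.2, hs.2, CarRing.star_star]) W) v
  { sh := shf (pmod V)
    mul := (mul_exists V).choose
    one := fun W => toSec (1 : CarRing V W)
    star := (star_exists V).choose
    mul_bil := hm.1
    mul_assoc := shf_assoc (P := pmod V) (m := fun W (x y : CarRing V W) => x * y)
      (fun W (x y z : CarRing V W) => mul_assoc x y z) hm.1 hm.2
    one_res := one_res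
    one_mul := fun W a => by
      have hl : IsLin (V := shf (pmod V)) (N := shf (pmod V)) fun R a =>
          (mul_exists V).choose R (toSec (1 : CarRing V R)) a :=
        ⟨fun R v w => hm.1.add_right R v w _, fun R a v => hm.1.smul_right R a v _,
          fun R R' i v => by rw [← one_res R R' i, hm.1.nat]⟩
      exact congrFun (congrFun (toSec_unique hl isLin_id fun W x => by rw [hm.2, one_mul]) W) a
    mul_one := fun W a => by
      have hl : IsLin (V := shf (pmod V)) (N := shf (pmod V)) fun R a =>
          (mul_exists V).choose R a (toSec (1 : CarRing V R)) :=
        ⟨fun R v w => hm.1.add_left R v w _, fun R a v => hm.1.smul_left R a v _,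
          fun R R' i v => by rw [← one_res R R' i, hm.1.nat]⟩
      exact congrFun (congrFun (toSec_unique hl isLin_id fun W x => by rw [hm.2, mul_one]) W) a
    star_conj := hs.1
    star_star := hss
    star_mul := fun W a b => by
      -- The products `a b` and `(b^* a^*)^*` are both bilinear in `(a, b)`, so they can be compared
      -- on presheaf sections; one more involution gives the claim.
      have := congrFun (congrFun (congrFun (shf_bil_unique hm.1 (hm.1.swap.conj hs.1 hs.1 hs.1)
        fun W (v w : CarRing V W) => by
          refine (hm.2 W v w).trans (Eq.trans ?_ (congrArg _ ((congrArg₂ _ (hs.2 W w) (hs.2 W v)).trans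
            (hm.2 W _ _))).symm)
          rw [hs.2, CarRing.star_mul, CarRing.star_star, CarRing.star_star]) W) a) b
      rw [this, hss] }

namespace car
variable {U : Man} (V : IPVec U)

/-- The section given by an element of the presented ring. -/
def of {W} (x : CarRing V W) : Sec (car V).sh W := toSec x

theorem of_add {W} (x y : CarRing V W) : of V (x + y) = of V x + of V y := toSec_add x y

theorem of_fn_mul {W} (a : Fn U W) (x : CarRing V W) : of V (fn a * x) = a • of V x :=
  toSec_fn_mul a x

theorem of_fn {W} (a : Fn U W) : of V (fn a) = a • (car V).one W := by
  rw [← mul_one (fn a)]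
  exact of_fn_mul V a 1

theorem of_rs {W W'} (i : W' ≤ W) (x : CarRing V W) : of V (rs i x) = res _ i (of V x) :=
  toSec_rs i x

theorem mul_of {W} (x y : CarRing V W) : (car V).mul W (of V x) (of V y) = of V (x * y) :=
  (mul_exists V).choose_spec.2 W x y

theorem star_of {W} (x : CarRing V W) : (car V).star W (of V x) = of V (CarRing.star x) :=
  (star_exists V).choose_spec.2 W x

/-- This lemma and the three after it are the sheafification lemmas with sections of `pmod V`
displayed as elements of `CarRing V W`, where the ring operations are available. -/
theorem sh_hom_ext {V : IPVec U} {N : Mod U} {f g : (car V).sh ⟶ N}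
    (H : ∀ W (x : CarRing V W), act f (of V x) = act g (of V x)) : f = g :=
  shf_hom_ext (P := pmod V) H

theorem sh_hom_exists {V : IPVec U} {N : Mod U} (f : ∀ W, CarRing V W → Sec N W)
    (add : ∀ W x y, f W (x + y) = f W x + f W y)
    (smul : ∀ W (a : Fn U W) x, f W (fn a * x) = a • f W x)
    (nat : ∀ W W' (i : W' ≤ W) x, f W' (rs i x) = res N i (f W x)) :
    ∃ g : (car V).sh ⟶ N, ∀ W (x : CarRing V W), act g (of V x) = f W x :=
  shf_hom_exists (P := pmod V) f add smul nat

theorem sh_bil_unique {V : IPVec U} {T : Mod U}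
    {B C : ∀ R, Sec (car V).sh R → Sec (car V).sh R → Sec T R} (hB : IsBil B) (hC : IsBil C)
    (H : ∀ W (x y : CarRing V W), B _ (of V x) (of V y) = C _ (of V x) (of V y)) : B = C :=
  shf_bil_unique (P₁ := pmod V) (P₂ := pmod V) hB hC H

theorem sh_conj_unique {V : IPVec U} {N : Mod U} {f g : ∀ R, Sec (car V).sh R → Sec N R}
    (hf : IsConj f) (hg : IsConj g) (H : ∀ W (x : CarRing V W), f _ (of V x) = g _ (of V x)) :
    f = g := shf_conj_unique (P := pmod V) hf hg H

/-- The canonical map. -/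
def j : V.sh ⟶ (car V).sh :=
  mkHom (fun W v => of V (CarRing.sec v))
    (fun W v w => by rw [sec_add, of_add]) (fun W a v => by rw [sec_smul, of_fn_mul])
    (fun W W' i v => by rw [← rs_sec, of_rs])

theorem act_j {W} (v : Sec V.sh W) : act (j V) v = of V (CarRing.sec v) := rfl

theorem isCAR : IsCAR V (car V) (j V) where
  star W v := by rw [act_j, act_j, star_of, star_sec]
  car W v w := by rw [act_j, act_j, mul_of, mul_of, ← of_add, sec_car, of_fn]

end car

end SmoothAQFT

end

/-! ### Universal property of the CAR algebra and the stack morphism it defines. -/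

noncomputable section

namespace SmoothAQFT

open CarRing Man

namespace StarAlg
variable {U : Man} (B : StarAlg U) (W : Opens U)

/-- The sections of a sheaf of star-algebras, as a ring. -/
def SecRing : Type := Sec B.sh W

instance : AddCommGroup (B.SecRing W) := (inferInstance : AddCommGroup (Sec B.sh W))

instance : Ring (B.SecRing W) where
  __ := (inferInstance : AddCommGroup (B.SecRing W))
  mul := B.mul W
  one := B.one W
  mul_assoc := B.mul_assoc W
  one_mul := B.one_mul W
  mul_one := B.mul_one W
  left_distrib a b c := B.mul_bil.add_right W b c a
  right_distrib a b c := B.mul_bil.add_left W a b c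
  zero_mul a := by
    have := B.mul_bil.add_left W 0 0 a
    rw [add_zero] at this
    exact left_eq_add.1 this
  mul_zero a := by
    have := B.mul_bil.add_right W 0 0 a
    rw [add_zero] at this
    exact left_eq_add.1 this

theorem smul_one_mul (a : Fn U W) (b : Sec B.sh W) : B.mul W (a • B.one W) b = a • b := by
  rw [B.mul_bil.smul_left, B.one_mul]

theorem mul_smul_one (a : Fn U W) (b : Sec B.sh W) : B.mul W b (a • B.one W) = a • b := by
  rw [B.mul_bil.smul_right, B.mul_one]

/-- Apply the involution to the product of `1^*` and `1`. -/
theorem star_one : B.star W (B.one W) = B.one W := by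
  have := B.star_mul W (B.star W (B.one W)) (B.one W)
  rwa [B.mul_one, B.star_star, B.mul_one, eq_comm] at this

/-- Functions as multiples of the unit. -/
def fnHom : Fn U W →+* B.SecRing W where
  toFun a := (a • B.one W : Sec B.sh W)
  map_one' := one_smul (Fn U W) (B.one W)
  map_mul' a b := ((B.smul_one_mul W a (b • B.one W)).trans (smul_smul a b (B.one W))).symm
  map_zero' := zero_smul (Fn U W) (B.one W)
  map_add' a b := add_smul a b (B.one W)

end StarAlg

namespace car
variable {U : Man} {V : IPVec U} {B : StarAlg U} {k : V.sh ⟶ B.sh} (hk : IsCAR V B k)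
  {W W' : Opens U}

/-- The homomorphism of presented rings induced by a map satisfying the relations. -/
def liftRing (hk : IsCAR V B k) (W : Opens U) : CarRing V W →+* B.SecRing W :=
  lift (B.fnHom W) (fun v => (act k v : Sec B.sh W)) (act_add k)
    (fun a v => (act_smul k a v).trans (B.smul_one_mul W a _).symm)
    (fun a v => (B.smul_one_mul W a (act k v)).trans (B.mul_smul_one W a (act k v)).symm)
    (hk.car W)

/-- The value of the induced homomorphism, as a section. -/
def liftSec (x : CarRing V W) : Sec B.sh W := liftRing hk W x

theorem liftSec_fn (a : Fn U W) : liftSec hk (fn a) = a • B.one W := lift_fn (R := B.SecRing W) ..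
theorem liftSec_sec (v : Sec V.sh W) : liftSec hk (sec v) = act k v := lift_sec (R := B.SecRing W) ..
theorem liftSec_add (x y : CarRing V W) : liftSec hk (x + y) = liftSec hk x + liftSec hk y :=
  map_add (liftRing hk W) x y
theorem liftSec_mul (x y : CarRing V W) :
    liftSec hk (x * y) = B.mul W (liftSec hk x) (liftSec hk y) := map_mul (liftRing hk W) x y
theorem liftSec_one : liftSec hk (1 : CarRing V W) = B.one W := map_one (liftRing hk W)

/-- Verified on generators. This assembles the lifts over the separate open sets into a map of
presheaves, which then factors through the associated sheaf. -/
theorem liftSec_rs (i : W' ≤ W) (x : CarRing V W) :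
    liftSec hk (rs i x) = res _ i (liftSec hk x) := by
  induction x using induct with
  | hfn a => rw [rs_fn, liftSec_fn, liftSec_fn, res_smul, B.one_res]
  | hsec v => rw [rs_sec, liftSec_sec, liftSec_sec, act_res]
  | hadd x y hx hy => rw [map_add, liftSec_add, liftSec_add, hx, hy, res_add]
  | hmul x y hx hy => rw [map_mul, liftSec_mul, liftSec_mul, hx, hy, B.mul_bil.nat]

theorem liftSec_star (x : CarRing V W) :
    liftSec hk (CarRing.star x) = B.star W (liftSec hk x) := by
  induction x using induct with
  | hfn a => rw [star_fn, liftSec_fn, liftSec_fn, B.star_conj.smul, B.star_one]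
  | hsec v => rw [star_sec, liftSec_sec, liftSec_sec, hk.star]
  | hadd x y hx hy => rw [CarRing.star_add, liftSec_add, liftSec_add, hx, hy, B.star_conj.add]
  | hmul x y hx hy => rw [CarRing.star_mul, liftSec_mul, liftSec_mul, hx, hy, B.star_mul]

theorem desc_exists : ∃ g : (car V).sh ⟶ B.sh, ∀ W (x : CarRing V W),
    act g (of V x) = liftSec hk x :=
  sh_hom_exists (fun W x => liftSec hk x) (fun W x y => liftSec_add hk x y)
    (fun W a x => by rw [liftSec_mul, liftSec_fn, B.smul_one_mul])
    (fun W W' i x => liftSec_rs hk i x)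

/-- The morphism of star-algebras induced by a map satisfying the relations. -/
def desc : car V ⟶ B :=
  have hg := (desc_exists hk).choose_spec
  { hom := (desc_exists hk).choose
    mul := fun W a b => congrFun (congrFun (congrFun (sh_bil_unique
      ((car V).mul_bil.act_left (desc_exists hk).choose)
      (B.mul_bil.act_right (desc_exists hk).choose (desc_exists hk).choose)
      fun W x y => by rw [mul_of, hg, hg, hg, liftSec_mul]) W) a) b
    one := fun W => (hg W 1).trans (liftSec_one hk)
    star := fun W a => congrFun (congrFun (sh_conj_unique
      ((car V).star_conj.act_left (desc_exists hk).choose)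
      (B.star_conj.act_right (desc_exists hk).choose)
      fun W x => by rw [star_of, hg, hg, liftSec_star]) W) a }

theorem desc_j {W} (v : Sec V.sh W) : act (desc hk).hom (act (j V) v) = act k v :=
  ((desc_exists hk).choose_spec W _).trans (liftSec_sec hk v)

/-- A morphism out of the sheaf is determined on the presented rings, and these are generated by the
functions, which are multiples of the unit, and by the image of `j`. -/
theorem hom_ext {f g : car V ⟶ B}
    (H : ∀ W (v : Sec V.sh W), act f.hom (act (j V) v) = act g.hom (act (j V) v)) : f = g := by
  refine StarAlg.hom_ext (sh_hom_ext fun W x => ?_)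
  induction x using induct with
  | hfn a => rw [of_fn, act_smul, act_smul, f.one, g.one]
  | hsec v => exact H W v
  | hadd x y hx hy => rw [of_add, act_add, act_add, hx, hy]
  | hmul x y hx hy => rw [← mul_of, f.mul, g.mul, hx, hy]

end car

namespace StarAlg
variable {U U' : Man}

/-- The pushforward of a sheaf of star-algebras. -/
def push (h : U ⟶ U') (B : StarAlg U) : StarAlg U' where
  sh := (SmoothAQFT.push h).obj B.sh
  mul W := B.mul ((pre h).obj W)
  one W := B.one ((pre h).obj W)
  star W := B.star ((pre h).obj W)
  mul_bil :=
    { add_left := fun R v w u => B.mul_bil.add_left _ v w u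
      add_right := fun R v w u => B.mul_bil.add_right _ v w u
      smul_left := fun R a v u => B.mul_bil.smul_left _ (Hom.fnPull h R a) v u
      smul_right := fun R a v u => B.mul_bil.smul_right _ (Hom.fnPull h R a) v u
      nat := fun R R' i v w => B.mul_bil.nat _ _ ((pre h).map (homOfLE i)).le v w }
  mul_assoc W := B.mul_assoc _
  one_res W W' i := B.one_res _ _ ((pre h).map (homOfLE i)).le
  one_mul W := B.one_mul _
  mul_one W := B.mul_one _
  star_conj :=
    { add := fun R v w => B.star_conj.add _ v w
      smul := fun R a v => B.star_conj.smul _ (Hom.fnPull h R a) v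
      nat := fun R R' i v => B.star_conj.nat _ _ ((pre h).map (homOfLE i)).le v }
  star_star W := B.star_star _
  star_mul W := B.star_mul _

/-- The transpose of a morphism out of a pullback. -/
def transp {h : U ⟶ U'} {X : StarAlg U'} {B : StarAlg U} (f : pb h X ⟶ B) : X ⟶ push h B where
  hom := mkHom (N := (SmoothAQFT.push h).obj B.sh) (fun W v => act f.hom (eta h v))
    (fun W v w => by rw [eta_add, act_add]; rfl) (fun W a v => by rw [eta_smul, act_smul]; rfl)
    (fun W W' i v => by rw [eta_res, act_res]; rfl)
  mul W v w := by
    refine Eq.trans ?_ (f.mul _ (eta h v) (eta h w))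
    rw [pb_mul]; rfl
  one W := by
    refine Eq.trans ?_ (f.one _)
    rw [pb_one]; rfl
  star W v := by
    refine Eq.trans ?_ (f.star _ (eta h v))
    rw [pb_star]; rfl

end StarAlg

namespace car
variable {U U' U'' : Man}

/-- Morphisms out of the pullback of a presented algebra are determined by their values on the
pulled back generators. -/
theorem pb_hom_ext {h : U ⟶ U'} {V : IPVec U'} {B : StarAlg U} {f g : StarAlg.pb h (car V) ⟶ B}
    (H : ∀ W (v : Sec V.sh W), act f.hom (eta h (act (j V) v)) = act g.hom (eta h (act (j V) v))) :
    f = g := by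
  -- Transposition moves the question to `U'`, where `car V` itself is the source and generators
  -- suffice.
  have := hom_ext (f := StarAlg.transp f) (g := StarAlg.transp g) H
  exact StarAlg.pb_hom_ext fun W v => congrArg (fun k => act k.hom v) this

theorem isCAR_comp {U : Man} {V N : IPVec U} (f : V ⟶ N) : IsCAR V (car N) (f.hom ≫ j N) where
  star W v := by rw [act_comp, act_comp, f.star, (isCAR N).star]
  car W v w := by rw [act_comp, act_comp, (isCAR N).car, f.pair]

/-- The functor of canonical anti-commutation relations algebras. -/
def functor (U : Man) : IPVec U ⥤ StarAlg U where
  obj V := car V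
  map f := desc (isCAR_comp f)
  map_id V := hom_ext fun W v => desc_j (isCAR_comp (𝟙 V)) v
  map_comp {V N P} f g := hom_ext fun W v => by
    refine (desc_j (isCAR_comp (f ≫ g)) v).trans ?_
    refine Eq.trans ?_ (congrArg (act (desc (isCAR_comp g)).hom) (desc_j (isCAR_comp f) v)).symm
    exact (desc_j (isCAR_comp g) (act f.hom v)).symm

theorem map_j {U : Man} {V N : IPVec U} (f : V ⟶ N) {W} (v : Sec V.sh W) :
    act ((functor U).map f).hom (act (j V) v) = act (j N) (act f.hom v) := desc_j (isCAR_comp f) v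

/-- The generators of the pushforward of the algebra of a pullback. -/
def jpush (h : U ⟶ U') (V : IPVec U') : V.sh ⟶ (StarAlg.push h (car (IPVec.pb h V))).sh :=
  mkHom (N := (push h).obj (car (IPVec.pb h V)).sh)
    (fun W v => act (j (IPVec.pb h V)) (eta h v))
    (fun W v w => by rw [eta_add, act_add]; rfl) (fun W a v => by rw [eta_smul, act_smul]; rfl)
    (fun W W' i v => by rw [eta_res, act_res]; rfl)

/-- The relations of `CAR` over the preimage of `W`, evaluated on pulled back sections, whose
involution and pairing are by construction the pullbacks of the original ones. -/
theorem isCAR_jpush (h : U ⟶ U') (V : IPVec U') :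
    IsCAR V (StarAlg.push h (car (IPVec.pb h V))) (jpush h V) where
  star W v := by
    refine Eq.trans ?_ ((isCAR (IPVec.pb h V)).star _ (eta h v))
    rw [IPVec.pb_star]; rfl
  car W v w := by
    refine ((isCAR (IPVec.pb h V)).car _ (eta h v) (eta h w)).trans ?_
    rw [IPVec.pb_pair]; rfl

/-- The comparison map from the pullback of the algebra to the algebra of the pullback. -/
def cohHom (h : U ⟶ U') (V : IPVec U') : StarAlg.pb h (car V) ⟶ car (IPVec.pb h V) :=
  let g := desc (isCAR_jpush h V)
  have hg : ∃ f : pull h (car V).sh ⟶ (car (IPVec.pb h V)).sh, ∀ W (v : Sec (car V).sh W),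
      act f (eta h v) = act g.hom v :=
    pull_exists h (fun W v => act g.hom v) (fun W => act_add g.hom) (fun W => act_smul g.hom)
      (fun W W' => act_res g.hom)
  StarAlg.mkPb hg.choose
    (fun W v => by rw [hg.choose_spec, hg.choose_spec, g.star]; rfl)
    (fun W v w => by rw [hg.choose_spec, hg.choose_spec, hg.choose_spec, g.mul]; rfl)
    (by rw [hg.choose_spec, g.one]; rfl)

theorem cohHom_eta (h : U ⟶ U') (V : IPVec U') {W} (v : Sec V.sh W) :
    act (cohHom h V).hom (eta h (act (j V) v)) = act (j (IPVec.pb h V)) (eta h v) := by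
  -- The existence statement used inside `cohHom` is repeated; by proof irrelevance `hg.choose` is
  -- the map underlying `cohHom h V`.
  have hg : ∃ f : pull h (car V).sh ⟶ (car (IPVec.pb h V)).sh, ∀ W (v : Sec (car V).sh W),
      act f (eta h v) = act (desc (isCAR_jpush h V)).hom v :=
    pull_exists h (fun W v => act (desc (isCAR_jpush h V)).hom v) (fun W => act_add _)
      (fun W => act_smul _) (fun W W' => act_res _)
  exact (hg.choose_spec W (act (j V) v)).trans (desc_j (isCAR_jpush h V) v)

/-- Needed for the inverse of `cohHom`. Both sides of the anticommutation relation are bilinear in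
sections of the pullback, so it is enough to test pulled back sections, where the relation is the
pullback of that of `car V`. -/
theorem isCAR_pullMap (h : U ⟶ U') (V : IPVec U') :
    IsCAR (IPVec.pb h V) (StarAlg.pb h (car V)) (pullMap h (j V)) where
  star W v := congrFun (congrFun (conj_unique
    ((IPVec.pb h V).star_conj.act_left (pullMap h (j V)))
    ((StarAlg.pb h (car V)).star_conj.act_right (pullMap h (j V))) fun W v => by
      rw [IPVec.pb_star, pullMap_eta, pullMap_eta, (isCAR V).star]
      exact (StarAlg.pb_star h (car V) _).symm) W) v
  car W v w := by
    have hm := (StarAlg.pb h (car V)).mul_bil.act_right (pullMap h (j V)) (pullMap h (j V))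
    have hp := (IPVec.pb h V).pair_bil
    have h1 : IsBil (V₁ := pull h V.sh) (V₂ := pull h V.sh) (T := pull h (car V).sh) fun R v w =>
        (StarAlg.pb h (car V)).mul R (act (pullMap h (j V)) v) (act (pullMap h (j V)) w) +
        (StarAlg.pb h (car V)).mul R (act (pullMap h (j V)) w) (act (pullMap h (j V)) v) :=
      { add_left := fun R v w u => by
          rw [hm.add_left, hm.add_right]; abel
        add_right := fun R v w u => by
          rw [hm.add_left, hm.add_right]; abel
        smul_left := fun R a v u => by
          rw [hm.smul_left, hm.smul_right, smul_add]
        smul_right := fun R a v u => by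
          rw [hm.smul_left, hm.smul_right, smul_add]
        nat := fun R R' i v w => by
          rw [hm.nat, hm.nat, res_add] }
    have h2 : IsBil (V₁ := pull h V.sh) (V₂ := pull h V.sh) (T := pull h (car V).sh) fun R v w =>
        (IPVec.pb h V).pair R v w • (StarAlg.pb h (car V)).one R :=
      { add_left := fun R v w u => by
          rw [hp.add_left]; exact add_smul _ _ _
        add_right := fun R v w u => by
          rw [hp.add_right]; exact add_smul _ _ _
        smul_left := fun R a v u => by
          rw [hp.smul_left]; exact mul_smul _ _ _
        smul_right := fun R a v u => by
          rw [hp.smul_right]; exact mul_smul _ _ _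
        nat := fun R R' i v w => by
          rw [hp.nat, res_smul, (StarAlg.pb h (car V)).one_res]; rfl }
    exact congrFun (congrFun (congrFun (bil_unique h1 h2 fun W v w => by
      rw [pullMap_eta, pullMap_eta, IPVec.pb_pair, StarAlg.pb_one, StarAlg.pb_mul, StarAlg.pb_mul,
        ← eta_add, (isCAR V).car, eta_smul]) W) v) w

/-- The coherence isomorphism of the algebras. -/
def coh (h : U ⟶ U') (V : IPVec U') : StarAlg.pb h (car V) ≅ car (IPVec.pb h V) where
  hom := cohHom h V
  inv := desc (isCAR_pullMap h V)
  hom_inv_id := pb_hom_ext fun W v => by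
    refine (congrArg (act (desc (isCAR_pullMap h V)).hom) (cohHom_eta h V v)).trans ?_
    refine (desc_j (isCAR_pullMap h V) (W := (pre h).obj W) (eta h v)).trans ?_
    exact pullMap_eta h (j V) v
  inv_hom_id := by
    refine hom_ext fun W v => ?_
    -- `hom_ext` asks about all sections of the pulled back module; viewed as an equality of
    -- morphisms out of `pull h V.sh`, this reduces to sections `eta h v`.
    have : (j (IPVec.pb h V)) ≫ (desc (isCAR_pullMap h V) ≫ cohHom h V).hom =
        j (IPVec.pb h V) ≫ (𝟙 (car (IPVec.pb h V)) : _ ⟶ _).hom := by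
      refine pull_hom_ext h fun W v => ?_
      refine (congrArg (act (cohHom h V).hom) (desc_j (isCAR_pullMap h V) (eta h v))).trans ?_
      refine (congrArg (act (cohHom h V).hom) (pullMap_eta h (j V) v)).trans ?_
      exact cohHom_eta h V v
    exact congrArg (fun k => act k v) this

/-- The algebras are compatible with pullbacks. -/
def trans : Pullbacks.Trans IPVec.pullbacks StarAlg.pullbacks where
  F := functor
  coh {U U'} h := NatIso.ofComponents (F := functor U' ⋙ StarAlg.pbFunctor h)
    (G := IPVec.pbFunctor h ⋙ functor U) (fun V => coh h V) fun {V N} f => pb_hom_ext fun W v => by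
      refine (congrArg (act (cohHom h N).hom) (StarAlg.map_eta h ((functor U').map f) (act (j V) v))).trans ?_
      refine (congrArg (fun z => act (cohHom h N).hom (eta h z)) (map_j f v)).trans ?_
      refine (cohHom_eta h N (act f.hom v)).trans ?_
      refine Eq.trans ?_ (congrArg (act ((functor U).map ((IPVec.pbFunctor h).map f)).hom)
        (cohHom_eta h V v)).symm
      refine Eq.trans ?_ (map_j ((IPVec.pbFunctor h).map f) (W := (pre h).obj W) (eta h v)).symm
      exact congrArg (act (j (IPVec.pb h N))) (IPVec.map_eta h f v).symm
  unit {U} V := pb_hom_ext (h := 𝟙 U) fun W v => by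
    refine (congrArg (act ((functor U).map (IPVec.pbId V).hom).hom) (cohHom_eta (𝟙 U) V v)).trans ?_
    refine (map_j (IPVec.pbId V).hom (W := (pre (𝟙 U)).obj W) (eta (𝟙 U) v)).trans ?_
    refine (congrArg (act (j V)) (IPVec.pbId_eta V v)).trans ?_
    exact (StarAlg.pbId_eta (car V) (act (j V) v)).symm
  comp {U U' U''} h k V := pb_hom_ext (h := h ≫ k) fun W v => by
    refine (congrArg (act ((functor U).map (IPVec.pbComp h k V).hom).hom)
      (cohHom_eta (h ≫ k) V v)).trans ?_
    refine (map_j (IPVec.pbComp h k V).hom (W := (pre (h ≫ k)).obj W) (eta (h ≫ k) v)).trans ?_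
    refine (congrArg (act (j (IPVec.pb h (IPVec.pb k V)))) (IPVec.pbComp_eta h k V v)).trans ?_
    refine Eq.trans ?_ (congrArg (fun z => act (cohHom h (IPVec.pb k V)).hom
      (act ((StarAlg.pbFunctor h).map (cohHom k V)).hom z))
      (StarAlg.pbComp_eta h k (car V) (act (j V) v))).symm
    refine Eq.trans ?_ (congrArg (act (cohHom h (IPVec.pb k V)).hom)
      (StarAlg.map_eta h (cohHom k V) (W := (pre k).obj W) (eta k (act (j V) v)))).symm
    refine Eq.trans ?_ (congrArg (fun z => act (cohHom h (IPVec.pb k V)).hom (eta h z))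
      (cohHom_eta k V v)).symm
    exact (cohHom_eta h (IPVec.pb k V) (W := (pre k).obj W) (eta k v)).symm

/-- The stack morphism of canonical anti-commutation relations algebras. -/
abbrev strongTrans : IPVec.prestack.StrongTrans StarAlg.prestack := trans.toStrongTrans

/-- The stack morphism is given by the presented algebras. -/
def presentation : CARPresentation strongTrans where
  j V := j V
  isCAR V := isCAR V
  univ V B k hk := ⟨desc hk, act_ext fun W v => desc_j hk v, fun g hg => hom_ext fun W v =>
    (congrArg (fun k => act k v) hg).trans (desc_j hk v).symm⟩
  map f := act_ext fun W v => map_j f v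
  coh h V W v := cohHom_eta h V v

end car

end SmoothAQFT

end

/-! ### The free module of smooth ℂ²-valued functions, value of the Dirac stack morphism. -/

noncomputable section

namespace SmoothAQFT

open Man

/-- The product ring structure makes the smooth functions into ℂ × ℂ a sheaf of rings. The module
`pairMod` is its unit module seen through the diagonal embedding, so the sheaf condition is
inherited. -/
instance : ContMDiffRing 𝓘(ℝ, ℂ × ℂ) ∞ (ℂ × ℂ) where
  contMDiff_add := by
    rw [← modelWithCornersSelf_prod, chartedSpaceSelf_prod]
    exact contDiff_add.contMDiff
  contMDiff_mul := by
    rw [← modelWithCornersSelf_prod, chartedSpaceSelf_prod]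
    exact contDiff_mul.contMDiff

/-- The sheaf of rings of smooth functions with values in `ℂ × ℂ`. -/
abbrev OPair (U : Man) : Sheaf (Opens.grothendieckTopology U) RingCat.{0} :=
  smoothSheafRing (𝓡 U.dim) 𝓘(ℝ, ℂ × ℂ) U (ℂ × ℂ)

/-- The diagonal embedding of functions. -/
def diagFn {U : Man} (W : Opens U) : Fn U W →+* (OPair U).obj.obj (op W) where
  toFun a := ⟨fun x => (Fn.ev a x, Fn.ev a x), by
    have h1 : ContMDiff (𝓡 U.dim) 𝓘(ℝ, ℂ × ℂ) ∞ (fun x : W => (Fn.ev a x, Fn.ev a x)) :=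
      (Fn.smooth a).prodMk_space (Fn.smooth a)
    exact h1⟩
  map_one' := rfl
  map_mul' _ _ := rfl
  map_zero' := rfl
  map_add' _ _ := rfl

/-- The diagonal embedding of structure sheaves. -/
def diagPhi (U : Man) : O U ⟶
  ((𝟭 (Opens U)).sheafPushforwardContinuous RingCat.{0} (Opens.grothendieckTopology U)
    (Opens.grothendieckTopology U)).obj (OPair U) where
  hom := { app := fun W => RingCat.ofHom (diagFn W.unop) }

/-- Smooth functions with values in `ℂ × ℂ`, as a sheaf of modules. -/
def pairMod (U : Man) : Mod U :=
  (SheafOfModules.pushforward.{0} (diagPhi U)).obj (SheafOfModules.unit.{0} (OPair U))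

namespace pairMod
variable {U U' U'' : Man} {W W' : Opens U}

/-- The section given by a smooth function. -/
def mk (f : W → ℂ × ℂ) (hf : ContMDiff (𝓡 U.dim) 𝓘(ℝ, ℂ × ℂ) ∞ f) : Sec (pairMod U) W :=
  (show (OPair U).obj.obj (op W) from ⟨f, hf⟩)

/-- The value of a section. -/
def ev (v : Sec (pairMod U) W) (x : W) : ℂ × ℂ := (show (OPair U).obj.obj (op W) from v).1 x

theorem smooth (v : Sec (pairMod U) W) : ContMDiff (𝓡 U.dim) 𝓘(ℝ, ℂ × ℂ) ∞ (ev v) :=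
  smoothSheaf.contMDiff_section (show (OPair U).obj.obj (op W) from v)

theorem ext {v w : Sec (pairMod U) W} (h : ∀ x, ev v x = ev w x) : v = w :=
  Subtype.ext (funext h)

theorem ev_mk (f : W → ℂ × ℂ) (hf) (x : W) : ev (mk f hf) x = f x := rfl
theorem ev_add (v w : Sec (pairMod U) W) (x : W) : ev (v + w) x = ev v x + ev w x := rfl
theorem ev_smul (a : Fn U W) (v : Sec (pairMod U) W) (x : W) :
    ev (a • v) x = a.ev x • ev v x := rfl
theorem ev_res (i : W' ≤ W) (v : Sec (pairMod U) W) (x : W') :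
    ev (res _ i v) x = ev v ⟨x, i x.2⟩ := rfl

/-- The function given by a smooth map. -/
def fnMk (f : W → ℂ) (hf : ContMDiff (𝓡 U.dim) 𝓘(ℝ, ℂ) ∞ f) : Fn U W := ⟨f, hf⟩

theorem ev_fnMk (f : W → ℂ) (hf) (x : W) : (fnMk f hf).ev x = f x := rfl

theorem contMDiff_fst (v : Sec (pairMod U) W) :
    ContMDiff (𝓡 U.dim) 𝓘(ℝ, ℂ) ∞ (fun x => (ev v x).1) :=
  (contDiff_fst (𝕜 := ℝ) (E := ℂ) (F := ℂ)).contMDiff.comp (smooth v)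

theorem contMDiff_snd (v : Sec (pairMod U) W) :
    ContMDiff (𝓡 U.dim) 𝓘(ℝ, ℂ) ∞ (fun x => (ev v x).2) :=
  (contDiff_snd (𝕜 := ℝ) (E := ℂ) (F := ℂ)).contMDiff.comp (smooth v)

/-- The involution. -/
def star (v : Sec (pairMod U) W) : Sec (pairMod U) W :=
  mk (fun x => (starRingEnd ℂ (ev v x).2, starRingEnd ℂ (ev v x).1)) <| by
    have h1 : ContDiff ℝ ∞ fun z : ℂ × ℂ => (Complex.conjCLE z.2, Complex.conjCLE z.1) :=
      (Complex.conjCLE.contDiff.comp contDiff_snd).prodMk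
        (Complex.conjCLE.contDiff.comp contDiff_fst)
    exact h1.contMDiff.comp (smooth v)

theorem ev_star (v : Sec (pairMod U) W) (x : W) :
    ev (star v) x = (starRingEnd ℂ (ev v x).2, starRingEnd ℂ (ev v x).1) := rfl

/-- The pairing. -/
def pair (v w : Sec (pairMod U) W) : Fn U W :=
  -- The sign is `i * i`, with one factor from the matrix in the pairing and one from the causal
  -- propagator; compare `LocObj.fibInt_dens`.
  fnMk (fun x => -((ev v x).1 * (ev w x).2 + (ev v x).2 * (ev w x).1)) <| by
    have h1 : ContDiff ℝ ∞ fun z : (ℂ × ℂ) × (ℂ × ℂ) => -(z.1.1 * z.2.2 + z.1.2 * z.2.1) := by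
      fun_prop
    exact h1.contMDiff.comp ((smooth v).prodMk_space (smooth w))

variable (U) in
/-- The inner product vector space of smooth functions with values in `ℂ × ℂ`. -/
def ipvec : IPVec U where
  sh := pairMod U
  star W := star
  pair W := pair
  star_conj :=
    { add := fun R v w => ext fun x => Prod.ext (map_add (starRingEnd ℂ) _ _)
        (map_add (starRingEnd ℂ) _ _)
      smul := fun R a v => ext fun x => Prod.ext (map_mul (starRingEnd ℂ) _ _)
        (map_mul (starRingEnd ℂ) _ _)
      nat := fun R R' i v => rfl }
  star_star W v := ext fun x => Prod.ext (Complex.conj_conj _) (Complex.conj_conj _)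
  pair_bil :=
    { add_left := fun R v w u => Fn.ext fun x => by
        change _ = (pair v u).ev x + (pair w u).ev x
        simp only [pair, ev_fnMk, ev_add, Prod.fst_add, Prod.snd_add]
        ring
      add_right := fun R v w u => Fn.ext fun x => by
        change _ = (pair u v).ev x + (pair u w).ev x
        simp only [pair, ev_fnMk, ev_add, Prod.fst_add, Prod.snd_add]
        ring
      smul_left := fun R a v u => Fn.ext fun x => by
        change _ = a.ev x * (pair v u).ev x
        simp only [pair, ev_fnMk, ev_smul, Prod.smul_fst, Prod.smul_snd, smul_eq_mul]
        ring
      smul_right := fun R a v u => Fn.ext fun x => by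
        change _ = a.ev x * (pair u v).ev x
        simp only [pair, ev_fnMk, ev_smul, Prod.smul_fst, Prod.smul_snd, smul_eq_mul]
        ring
      nat := fun R R' i v w => rfl }
  pair_symm W v w := Fn.ext fun x => by
    simp only [pair, ev_fnMk]
    ring
  pair_star W v w := Fn.ext fun x => by
    change starRingEnd ℂ ((pair v w).ev x) = _
    simp only [pair, ev_fnMk, ev_star, map_neg, map_add, map_mul]
    ring

/-- Pullback of functions along a smooth map. -/
def comap (h : U ⟶ U') {W : Opens U'} (v : Sec (pairMod U') W) :
    Sec (pairMod U) ((pre h).obj W) :=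
  mk (fun x => ev v ⟨Hom.fn h x, x.2⟩) <| by
    have h2 : ContMDiff (𝓡 U.dim) (𝓡 U'.dim) ∞
        (fun x : (pre h).obj W => (⟨Hom.fn h x, x.2⟩ : W)) := by
      rw [← ContMDiff.subtypeVal_comp_iff]
      exact (Hom.smooth h).comp contMDiff_subtype_val
    exact (smooth v).comp h2

theorem ev_comap (h : U ⟶ U') {W : Opens U'} (v : Sec (pairMod U') W) (x) :
    ev (comap h v) x = ev v ⟨Hom.fn h x, x.2⟩ := rfl

theorem cohHom_exists (h : U ⟶ U') : ∃ g : pull h (pairMod U') ⟶ pairMod U,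
    ∀ W (v : Sec (pairMod U') W), act g (eta h v) = comap h v :=
  pull_exists h (fun _ v => comap h v) (fun _ _ _ => rfl) (fun _ _ _ => rfl) (fun _ _ _ _ => rfl)

/-- The sections of the standard basis. -/
def basis (c : ℂ × ℂ) (W : Opens U) : Sec (pairMod U) W := mk (fun _ => c) contMDiff_const

/-- Freeness on two constant sections is what makes the comparison map `h^* C^∞ → C^∞` invertible:
coefficients are functions on the new base, and constant sections are pulled back from the top open
set. -/
theorem eq_basis (v : Sec (pairMod U) W) :
    v = fnMk _ (contMDiff_fst v) • basis (1, 0) W + fnMk _ (contMDiff_snd v) • basis (0, 1) W :=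
  ext fun x => by
    simp only [ev_add, ev_smul, ev_fnMk, basis, ev_mk]
    simp

/-- The basis sections of the pullback. -/
def etaBasis (h : U ⟶ U') (c : ℂ × ℂ) (W : Opens U) : Sec (pull h (pairMod U')) W :=
  res _ (StarAlg.le_pre_top h W) (eta h (basis c ⊤))

theorem res_etaBasis (h : U ⟶ U') (c : ℂ × ℂ) (i : W' ≤ W) :
    res _ i (etaBasis h c W) = etaBasis h c W' := res_res _ _ _ _

theorem etaBasis_pre (h : U ⟶ U') (c : ℂ × ℂ) (W : Opens U') :
    etaBasis h c ((pre h).obj W) = eta h (basis c W) := by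
  have : basis c W = res _ le_top (basis c ⊤ : Sec (pairMod U') ⊤) := rfl
  rw [this, eta_res]
  rfl

/-- The inverse comparison map. -/
def cohInv (h : U ⟶ U') : pairMod U ⟶ pull h (pairMod U') :=
  mkHom (fun W v => fnMk _ (contMDiff_fst v) • etaBasis h (1, 0) W +
      fnMk _ (contMDiff_snd v) • etaBasis h (0, 1) W)
    (fun W v w => by
      have e1 : fnMk _ (contMDiff_fst (v + w)) =
        fnMk _ (contMDiff_fst v) + fnMk _ (contMDiff_fst w) := rfl
      have e2 : fnMk _ (contMDiff_snd (v + w)) =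
        fnMk _ (contMDiff_snd v) + fnMk _ (contMDiff_snd w) := rfl
      rw [e1, e2, add_smul, add_smul]
      abel)
    (fun W a v => by
      have e1 : fnMk _ (contMDiff_fst (a • v)) = a * fnMk _ (contMDiff_fst v) := rfl
      have e2 : fnMk _ (contMDiff_snd (a • v)) = a * fnMk _ (contMDiff_snd v) := rfl
      rw [e1, e2, mul_smul, mul_smul, smul_add])
    (fun W W' i v => by
      rw [res_add, res_smul, res_smul, res_etaBasis, res_etaBasis]
      rfl)

theorem act_cohInv (h : U ⟶ U') (v : Sec (pairMod U) W) : act (cohInv h) v =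
    fnMk _ (contMDiff_fst v) • etaBasis h (1, 0) W +
      fnMk _ (contMDiff_snd v) • etaBasis h (0, 1) W := rfl

/-- The comparison isomorphism of sheaves. -/
def cohSh (h : U ⟶ U') : pull h (pairMod U') ≅ pairMod U where
  hom := (cohHom_exists h).choose
  inv := cohInv h
  hom_inv_id := pull_hom_ext h fun W v => by
    rw [act_comp, (cohHom_exists h).choose_spec, act_cohInv, etaBasis_pre, etaBasis_pre]
    conv_rhs => rw [eq_basis v]
    rw [act_id, eta_add, eta_smul, eta_smul]
    rfl
  inv_hom_id := act_ext fun W v => by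
    have hb : ∀ c, act (cohHom_exists h).choose (etaBasis h c W) = basis c W := fun c => by
      rw [etaBasis, act_res, (cohHom_exists h).choose_spec]; rfl
    rw [act_comp, act_cohInv, act_add, act_smul, act_smul, hb, hb, ← eq_basis, act_id]

theorem cohSh_eta (h : U ⟶ U') {W : Opens U'} (v : Sec (pairMod U') W) :
    act (cohSh h).hom (eta h v) = comap h v := (cohHom_exists h).choose_spec W v

/-- The comparison isomorphism. -/
def coh (h : U ⟶ U') : IPVec.pb h (ipvec U') ≅ ipvec U :=
  IPVec.mkIso (X := IPVec.pb h (ipvec U')) (Y := ipvec U) (cohSh h)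
    (IPVec.mkPb (X := ipvec U') (Y := ipvec U) (cohSh h).hom
      (fun W v => by
        refine (cohSh_eta h _).trans ?_
        exact (congrArg star (cohSh_eta h v)).symm)
      (fun W v w => (congrArg₂ pair (cohSh_eta h v) (cohSh_eta h w)).trans rfl)) rfl

theorem coh_eta (h : U ⟶ U') {W : Opens U'} (v : Sec (pairMod U') W) :
    act (coh h).hom.hom (eta h v : Sec (pull h (pairMod U')) _) = comap h v := cohSh_eta h v

/-- The constant functors with value the smooth functions with values in `ℂ × ℂ`. -/
def trans : Pullbacks.Trans LocObj.pullbacks IPVec.pullbacks where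
  F U := (Functor.const (LocObj U)).obj (ipvec U)
  coh {U U'} h := NatIso.ofComponents
    (F := (Functor.const (LocObj U')).obj (ipvec U') ⋙ IPVec.pbFunctor h)
    (G := LocObj.pbFunctor h ⋙ (Functor.const (LocObj U)).obj (ipvec U)) (fun _ => coh h)
    -- The constant functors send `f` to identities, so naturality is trivial; `LocObj.exists_push`
    -- later shows that this is the action of extension by zero.
    fun {X Y} f => Pullbacks.Trans.nat_aux (IPVec.pbFunctor h) (A := ipvec U') (B := ipvec U)
      (coh h).hom
  unit {U} X := IPVec.pb_hom_ext (h := 𝟙 U) (X := ipvec U) fun W v =>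
    (coh_eta (𝟙 U) v).trans (IPVec.pbId_eta (ipvec U) v).symm
  comp {U U' U''} h k X := IPVec.pb_hom_ext (h := h ≫ k) (X := ipvec U'') fun W v => by
    refine (coh_eta (h ≫ k) v).trans ?_
    refine Eq.trans ?_ (congrArg (fun z => act (coh h).hom.hom
      (act ((IPVec.pbFunctor h).map (coh k).hom).hom z))
      (IPVec.pbComp_eta h k (ipvec U'') v)).symm
    refine Eq.trans ?_ (congrArg (act (coh h).hom.hom)
      (IPVec.map_eta h (coh k).hom (W := (pre k).obj W) (eta k v))).symm
    refine Eq.trans ?_ (congrArg (fun z => act (coh h).hom.hom (eta h z)) (coh_eta k v)).symm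
    exact (coh_eta h (W := (pre k).obj W) (comap k v)).symm

/-- The stack morphism with constant value the smooth functions with values in `ℂ × ℂ`. -/
abbrev strongTrans : LocObj.prestack.StrongTrans IPVec.prestack := trans.toStrongTrans

end pairMod

end SmoothAQFT

end

/-! ### Smoothness on the cylinder over the base. -/

noncomputable section

namespace SmoothAQFT

open Man Set Filter

section Cylinder

variable {U : Man} {V : Type} [NormedAddCommGroup V] [NormedSpace ℝ V]

/-- The cylinder over an open subset. -/
abbrev cyl (B : Opens U) : Set (U × ℝ) := (B : Set U) ×ˢ univ

theorem isOpen_cyl (B : Opens U) : IsOpen (cyl B) := B.isOpen.prod isOpen_univ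

/-- Smoothness on the cylinder, in a chart of the base. -/
theorem contMDiffAt_cyl_iff (F : U × ℝ → V) (x₀ : U) {x : U}
    (hx : x ∈ (chartAt (EuclideanSpace ℝ (Fin U.dim)) x₀).source) (t : ℝ) :
    ContMDiffAt (mdl U) 𝓘(ℝ, V) ∞ F (x, t) ↔
      ContDiffAt ℝ ∞ (fun q : EuclideanSpace ℝ (Fin U.dim) × ℝ =>
        F ((chartAt (EuclideanSpace ℝ (Fin U.dim)) x₀).symm q.1, q.2))
        (chartAt (EuclideanSpace ℝ (Fin U.dim)) x₀ x, t) := by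
  set φ := chartAt (EuclideanSpace ℝ (Fin U.dim)) x₀ with hφ
  have hy : φ x ∈ φ.target := φ.map_source hx
  have h1 : ContMDiffAt 𝓘(ℝ, EuclideanSpace ℝ (Fin U.dim) × ℝ) (mdl U) ∞
      (fun q : EuclideanSpace ℝ (Fin U.dim) × ℝ => (φ.symm q.1, q.2)) (φ x, t) :=
    (((contMDiffOn_chart_symm (I := 𝓡 U.dim) (x := x₀)).contMDiffAt
      (φ.open_target.mem_nhds hy)).comp (φ x, t) contDiffAt_fst.contMDiffAt).prodMk
        contDiffAt_snd.contMDiffAt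
  have h2 : ContMDiffAt (mdl U) 𝓘(ℝ, EuclideanSpace ℝ (Fin U.dim) × ℝ) ∞
      (fun q : U × ℝ => (φ q.1, q.2)) (x, t) :=
    (((contMDiffOn_chart (I := 𝓡 U.dim) (x := x₀)).contMDiffAt
      (φ.open_source.mem_nhds hx)).comp (x, t) contMDiffAt_fst).prodMk_space contMDiffAt_snd
  rw [← contMDiffAt_iff_contDiffAt]
  constructor
  · intro h
    have h' : ContMDiffAt (mdl U) 𝓘(ℝ, V) ∞ F (φ.symm (φ x), t) := by rwa [φ.left_inv hx]
    exact h'.comp (φ x, t) h1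
  · intro h
    refine (h.comp (x, t) h2).congr_of_eventuallyEq ?_
    filter_upwards [(φ.open_source.prod isOpen_univ).mem_nhds ⟨hx, trivial⟩] with q hq
    simp only [Function.comp_apply, φ.left_inv hq.1]

theorem contMDiffOn_cyl_iff {F : U × ℝ → V} {B : Opens U} :
    ContMDiffOn (mdl U) 𝓘(ℝ, V) ∞ F (cyl B) ↔
      ∀ x ∈ B, ∀ t, ContMDiffAt (mdl U) 𝓘(ℝ, V) ∞ F (x, t) :=
  ⟨fun h x hx t => h.contMDiffAt ((isOpen_cyl B).mem_nhds ⟨hx, trivial⟩),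
    fun h q hq => (h q.1 hq.1 q.2).contMDiffWithinAt⟩

theorem ContMDiffAt.differentiableAt_snd {F : U × ℝ → V} {x : U} {t : ℝ}
    (h : ContMDiffAt (mdl U) 𝓘(ℝ, V) ∞ F (x, t)) : ContDiffAt ℝ ∞ (fun s => F (x, s)) t := by
  rw [← contMDiffAt_iff_contDiffAt]
  exact ContMDiffAt.comp t (g := F) (f := fun s => (x, s)) h
    (contMDiffAt_const.prodMk contMDiffAt_id)

theorem hasDerivAt_of_contMDiffAt {F : U × ℝ → V} {x : U} {t : ℝ}
    (h : ContMDiffAt (mdl U) 𝓘(ℝ, V) ∞ F (x, t)) :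
    HasDerivAt (fun s => F (x, s)) (deriv (fun s => F (x, s)) t) t :=
  ((ContMDiffAt.differentiableAt_snd h).differentiableAt (by simp)).hasDerivAt

/-- The derivative along the cylinder of a smooth function is smooth. -/
theorem contMDiffAt_deriv {F : U × ℝ → V} {x : U} {t : ℝ}
    (h : ContMDiffAt (mdl U) 𝓘(ℝ, V) ∞ F (x, t)) :
    ContMDiffAt (mdl U) 𝓘(ℝ, V) ∞ (fun q => deriv (fun s => F (q.1, s)) q.2) (x, t) := by
  have hx := mem_chart_source (EuclideanSpace ℝ (Fin U.dim)) x
  rw [contMDiffAt_cyl_iff _ x hx] at h ⊢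
  set φ := chartAt (EuclideanSpace ℝ (Fin U.dim)) x with hφ
  -- In a chart of the base, the derivative along the fiber is the total derivative in the direction
  -- `(0, 1)`, which depends smoothly on the point.
  have h1 : ContDiffAt ℝ ∞ (fun q => fderiv ℝ (fun q : EuclideanSpace ℝ (Fin U.dim) × ℝ =>
      F (φ.symm q.1, q.2)) q (0, 1)) (φ x, t) :=
    (h.fderiv_right (m := ∞) (by simp)).clm_apply contDiffAt_const
  refine h1.congr_of_eventuallyEq ?_
  have h2 : ∀ᶠ q in 𝓝 (φ x, t), DifferentiableAt ℝ (fun q : EuclideanSpace ℝ (Fin U.dim) × ℝ =>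
      F (φ.symm q.1, q.2)) q := by
    filter_upwards [(h.of_le (m := 1) (by norm_cast)).eventually (by simp)] with q hq
    exact hq.differentiableAt (by simp)
  filter_upwards [h2] with q hq
  have h3 : HasDerivAt (fun s : ℝ => (q.1, s)) ((0 : EuclideanSpace ℝ (Fin U.dim)), (1 : ℝ)) q.2 :=
    (hasDerivAt_const _ _).prodMk (hasDerivAt_id _)
  exact (HasFDerivAt.comp_hasDerivAt (l := fun q : EuclideanSpace ℝ (Fin U.dim) × ℝ =>
      F (φ.symm q.1, q.2)) q.2 hq.hasFDerivAt h3).deriv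

/-- The fiberwise inverse of a smooth function with non-vanishing derivative is smooth. -/
theorem contMDiffAt_fiber_inverse {F G : U × ℝ → ℝ} {x : U} {τ : ℝ}
    (hF : ContMDiffAt (mdl U) 𝓘(ℝ, ℝ) ∞ F (x, G (x, τ)))
    (hd : deriv (fun s => F (x, s)) (G (x, τ)) ≠ 0)
    (hG : ∀ᶠ q in 𝓝 (x, τ), F (q.1, G q) = q.2)
    (hinj : ∀ᶠ y in 𝓝 x, Function.Injective fun s => F (y, s)) :
    ContMDiffAt (mdl U) 𝓘(ℝ, ℝ) ∞ G (x, τ) := by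
  have hx := mem_chart_source (EuclideanSpace ℝ (Fin U.dim)) x
  have hdF := (hasDerivAt_of_contMDiffAt hF)
  rw [contMDiffAt_cyl_iff _ x hx] at hF ⊢
  set φ := chartAt (EuclideanSpace ℝ (Fin U.dim)) x with hφ
  let t := G (x, τ)
  let u : (EuclideanSpace ℝ (Fin U.dim) × ℝ) × ℝ := ((φ x, τ), t)
  -- The implicit function theorem is applied to `F (y, s) - τ`, solved for `s`.
  let f : (EuclideanSpace ℝ (Fin U.dim) × ℝ) × ℝ → ℝ := fun q => F (φ.symm q.1.1, q.2) - q.1.2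
  have cdf : ContDiffAt ℝ ∞ f u := by
    have h1 : ContDiffAt ℝ ∞ (fun q : (EuclideanSpace ℝ (Fin U.dim) × ℝ) × ℝ => (q.1.1, q.2)) u := by
      fun_prop
    exact (ContDiffAt.comp u (g := fun q : EuclideanSpace ℝ (Fin U.dim) × ℝ => F (φ.symm q.1, q.2))
      hF h1).sub (by fun_prop)
  have hsymm : φ.symm (φ x) = x := φ.left_inv hx
  have hcomp : HasDerivAt (fun s => f ((φ x, τ), s)) (fderiv ℝ f u (0, 1)) t :=
    HasFDerivAt.comp_hasDerivAt (l := f) t (cdf.differentiableAt (by simp)).hasFDerivAt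
      ((hasDerivAt_const t (φ x, τ)).prodMk (hasDerivAt_id t))
  have hval : fderiv ℝ f u (0, 1) = deriv (fun s => F (x, s)) t := by
    refine hcomp.unique ?_
    simp only [f, hsymm]
    exact hdF.sub_const τ
  have inv : (fderiv ℝ f u ∘L .inr ℝ (EuclideanSpace ℝ (Fin U.dim) × ℝ) ℝ).IsInvertible := by
    refine ⟨ContinuousLinearEquiv.unitsEquivAut ℝ (Units.mk0 _ hd), ?_⟩
    ext
    simp [t, ← hval]
  have e1 := cdf.eventually_apply_implicitFunction (by simp) inv
  have e2 := cdf.contDiffAt_implicitFunction (by simp) inv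
  refine e2.congr_of_eventuallyEq ?_
  have hcs : ContinuousAt φ.symm (φ x) := φ.symm.continuousAt (φ.map_source hx)
  have c1 : Tendsto (fun q : EuclideanSpace ℝ (Fin U.dim) × ℝ => (φ.symm q.1, q.2))
      (𝓝 (φ x, τ)) (𝓝 (x, τ)) := by
    have := (hcs.comp (x := (φ x, τ)) continuousAt_fst).prodMk continuousAt_snd
    rw [ContinuousAt] at this
    simpa only [Function.comp_apply, hsymm] using this
  have c2 : Tendsto (fun q : EuclideanSpace ℝ (Fin U.dim) × ℝ => φ.symm q.1)
      (𝓝 (φ x, τ)) (𝓝 x) := (continuous_fst.tendsto (x, τ)).comp c1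
  -- Continuity of `G` is not needed: fiberwise injectivity of `F` forces `G` to agree with the
  -- implicit function near the point.
  filter_upwards [e1, c1.eventually hG, c2.eventually hinj] with q hq hq2 hq3
  apply hq3
  have hu : f u = 0 := by
    simp only [f, u, hsymm, t]
    rw [hG.self_of_nhds, sub_self]
  rw [hu] at hq
  exact hq2.trans (sub_eq_zero.1 hq).symm

end Cylinder

end SmoothAQFT

end

/-! ### Primitives on the line and along the cylinder. -/

noncomputable section

namespace SmoothAQFT

open Man Set Filter MeasureTheory Convolution

section Primitive

/-- Parameter-dependent integrals with smooth upper limit are smooth. -/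
theorem contDiffAt_integral {E V : Type} [NormedAddCommGroup E] [NormedSpace ℝ E]
    [NormedAddCommGroup V] [NormedSpace ℝ V] [CompleteSpace V]
    {G : E × ℝ → V} {S : Set E} (hS : IsOpen S) (hG : ContDiffOn ℝ ∞ G (S ×ˢ univ)) (a : ℝ)
    {x : E} (hx : x ∈ S) (t : ℝ) :
    ContDiffAt ℝ ∞ (fun q : E × ℝ => ∫ s in a..q.2, G (q.1, s)) (x, t) := by
  -- The substitution `s = a + (t - a) u` moves the integral to the fixed interval `(0, 1]`, where
  -- it is the convolution at `0` of the indicator `f` with `g`. Convolution at `0` evaluates `g` at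
  -- `-u`, hence the sign in `g`. The bump `b` equals `1` on `[-1, 1]` and only provides the compact
  -- support demanded by smoothness of parametrized convolutions.
  let b : ContDiffBump (0 : ℝ) := ⟨1, 2, one_pos, one_lt_two⟩
  let f : ℝ → ℝ := indicator (Ioc 0 1) 1
  let g : E × ℝ → ℝ → V := fun p u => b u • G (p.1, a + (p.2 - a) * (-u))
  have hf : LocallyIntegrable f volume :=
    ((integrable_indicator_iff measurableSet_Ioc).2
      (integrableOn_const (by simp))).locallyIntegrable
  have hg : ContDiffOn ℝ ∞ (Function.uncurry g) ((S ×ˢ univ) ×ˢ univ) := by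
    refine ContDiffOn.smul (b.contDiff.comp contDiff_snd).contDiffOn ?_
    refine hG.comp (t := S ×ˢ univ) (f := fun q : (E × ℝ) × ℝ => (q.1.1, a + (q.1.2 - a) * (-q.2)))
      (ContDiff.contDiffOn (by fun_prop)) ?_
    rintro q ⟨⟨h1, -⟩, -⟩
    exact ⟨h1, trivial⟩
  have key := contDiffOn_convolution_right_with_param (μ := volume) (n := (⊤ : ℕ∞))
    (ContinuousLinearMap.lsmul ℝ ℝ : ℝ →L[ℝ] V →L[ℝ] V) (g := g) (hS.prod isOpen_univ)
    (isCompact_closedBall (0 : ℝ) 2) (fun p u _ hu => by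
      have : b u = 0 := b.zero_of_le_dist (by
        rw [Metric.mem_closedBall, not_le] at hu
        exact hu.le)
      simp only [g, this, zero_smul]) hf hg
  -- The factor `q.2 - a` is the Jacobian of the substitution.
  have h0 : ContDiffAt ℝ ∞ (fun q : E × ℝ => (q.2 - a) •
      (f ⋆[(ContinuousLinearMap.lsmul ℝ ℝ : ℝ →L[ℝ] V →L[ℝ] V), volume] g q) 0) (x, t) := by
    refine ContDiffAt.smul (by fun_prop) ?_
    exact ContDiffAt.comp (x, t) (g := fun q : (E × ℝ) × ℝ =>
        (f ⋆[(ContinuousLinearMap.lsmul ℝ ℝ : ℝ →L[ℝ] V →L[ℝ] V), volume] g q.1) q.2)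
      (f := fun q : E × ℝ => (q, (0 : ℝ)))
      (key.contDiffAt (((hS.prod isOpen_univ).prod isOpen_univ).mem_nhds ⟨⟨hx, trivial⟩, trivial⟩))
      (by fun_prop)
  refine h0.congr_of_eventuallyEq (Eventually.of_forall fun q => ?_)
  have e1 : (f ⋆[(ContinuousLinearMap.lsmul ℝ ℝ : ℝ →L[ℝ] V →L[ℝ] V), volume] g q) 0 =
      ∫ u in (0 : ℝ)..1, G (q.1, a + (q.2 - a) * u) := by
    rw [intervalIntegral.integral_of_le zero_le_one, ← integral_indicator measurableSet_Ioc]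
    refine integral_congr_ae (Eventually.of_forall fun u => ?_)
    change f u • g q (0 - u) = _
    by_cases hu : u ∈ Ioc (0 : ℝ) 1
    · have hb : b (-u) = 1 := b.one_of_mem_closedBall (by
        rw [Metric.mem_closedBall, dist_zero_right, norm_neg, Real.norm_eq_abs, abs_of_pos hu.1]
        exact hu.2)
      simp only [f, g, indicator_of_mem hu, Pi.one_apply, one_smul, zero_sub, hb, neg_neg]
    · simp only [f, indicator_of_notMem hu, zero_smul]
  change _ = (q.2 - a) • _
  rw [e1, intervalIntegral.smul_integral_comp_add_mul (fun s => G (q.1, s))]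
  congr 1 <;> ring

variable {V : Type} [NormedAddCommGroup V] [NormedSpace ℝ V]

/-- The support of a function on the line is bounded below (`ε = 1`) or above (`ε = -1`). -/
def LineBdd (ε : ℝ) (g : ℝ → V) (c : ℝ) : Prop := ∀ t, g t ≠ 0 → c < ε * t

open Classical in
/-- The primitive vanishing in the past (`ε = 1`) or in the future (`ε = -1`). -/
def prim (ε : ℝ) (g : ℝ → V) (t : ℝ) : V :=
  -- By `prim_eq` the chosen bound does not matter. Without any bound the integral from `0` is still
  -- a primitive, so `hasDerivAt_prim` needs no boundedness.
  ∫ s in (ε * if h : ∃ c, LineBdd ε g c then h.choose else 0)..t, g s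

theorem mem_uIoc_sign {ε : ℝ} (hε : ε = 1 ∨ ε = -1) {a b s : ℝ} (h : s ∈ uIoc a b) :
    ε * s ≤ max (ε * a) (ε * b) := by
  rcases hε with rfl | rfl
  · rcases mem_uIoc.1 h with h | h
    · exact le_max_of_le_right (by linarith)
    · exact le_max_of_le_left (by linarith)
  · rcases mem_uIoc.1 h with h | h
    · exact le_max_of_le_left (by linarith)
    · exact le_max_of_le_right (by linarith)

theorem sign_mul_self {ε : ℝ} (hε : ε = 1 ∨ ε = -1) : ε * ε = 1 := by
  rcases hε with rfl | rfl <;> norm_num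

theorem integral_eq_zero_of_bdd {ε : ℝ} (hε : ε = 1 ∨ ε = -1) {g : ℝ → V} {c a b : ℝ}
    (hc : LineBdd ε g c) (ha : ε * a ≤ c) (hb : ε * b ≤ c) : ∫ s in a..b, g s = 0 := by
  refine intervalIntegral.integral_zero_ae (Eventually.of_forall fun s hs => ?_)
  by_contra h
  exact absurd (hc s h) (not_lt.2 ((mem_uIoc_sign hε hs).trans (max_le ha hb)))

/-- Between two admissible starting points `g` vanishes, so both give the same integral. -/
theorem prim_eq {ε : ℝ} (hε : ε = 1 ∨ ε = -1) {g : ℝ → V} (hg : Continuous g) {c : ℝ}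
    (hc : LineBdd ε g c) (t : ℝ) : prim ε g t = ∫ s in (ε * c)..t, g s := by
  have h : ∃ c, LineBdd ε g c := ⟨c, hc⟩
  rw [prim, dif_pos h]
  have e : ∀ x, ε * (ε * x) = x := fun x => by rw [← mul_assoc, sign_mul_self hε, one_mul]
  have h0 : ∫ s in (ε * h.choose)..(ε * c), g s = 0 := by
    rcases le_total c h.choose with hh | hh
    · exact integral_eq_zero_of_bdd hε h.choose_spec (e _).le ((e _).trans_le hh)
    · exact integral_eq_zero_of_bdd hε hc ((e _).trans_le hh) (e _).le
  rw [← intervalIntegral.integral_add_adjacent_intervals (hg.intervalIntegrable _ (ε * c))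
    (hg.intervalIntegrable _ t), h0, zero_add]

theorem hasDerivAt_prim [CompleteSpace V] (ε : ℝ) {g : ℝ → V} (hg : Continuous g) (t : ℝ) :
    HasDerivAt (prim ε g) (g t) t :=
  (hg.integral_hasStrictDerivAt _ t).hasDerivAt

/-- Here `t` itself may serve as starting point of the integral. This is causality on a single
fiber. -/
theorem prim_eq_zero {ε : ℝ} (hε : ε = 1 ∨ ε = -1) {g : ℝ → V} (hg : Continuous g) {t : ℝ} (h : ∀ s, ε * s ≤ ε * t → g s = 0) : prim ε g t = 0 := by
  have h' : LineBdd ε g (ε * t) := fun s hs => lt_of_not_ge fun hh => hs (h s hh)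
  have e : ∀ x, ε * (ε * x) = x := fun x => by rw [← mul_assoc, sign_mul_self hε, one_mul]
  rw [prim_eq hε hg h', e, intervalIntegral.integral_same]

theorem LineBdd.prim {ε : ℝ} (hε : ε = 1 ∨ ε = -1) {g : ℝ → V} (hg : Continuous g) {c : ℝ}
    (hc : LineBdd ε g c) : LineBdd ε (prim ε g) c := by
  intro t ht
  by_contra hh
  refine ht (prim_eq_zero hε hg fun s hs => ?_)
  by_contra hs'
  exact absurd (hc s hs') (not_lt.2 (hs.trans (not_lt.1 hh)))

theorem LineBdd.eq_zero {ε : ℝ} {u : ℝ → V} {c : ℝ} (hc : LineBdd ε u c) {t : ℝ}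
    (ht : ε * t ≤ c) : u t = 0 := by
  by_contra h
  exact absurd (hc t h) (not_lt.2 ht)

/-- The margin `1` ensures that `u` vanishes on a whole neighborhood of each point below the new
bound, so the derivative vanishes there too. -/
theorem LineBdd.of_hasDerivAt {ε : ℝ} {g u : ℝ → V} {c : ℝ} (hc : LineBdd ε u c)
    (hu : ∀ t, HasDerivAt u (g t) t) : LineBdd ε g (c - 1) := by
  intro t ht
  by_contra h
  refine ht ((hu t).unique ((hasDerivAt_const t (0 : V)).congr_of_eventuallyEq ?_))
  have : ∀ᶠ s in 𝓝 t, ε * s < c :=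
    (continuous_const.mul continuous_id).tendsto t |>.eventually
      (gt_mem_nhds (show ε * t < c by linarith))
  filter_upwards [this] with s hs
  exact hc.eq_zero hs.le

/-- The fundamental theorem of calculus, started at a point where `u` is zero. -/
theorem prim_unique [CompleteSpace V] {ε : ℝ} (hε : ε = 1 ∨ ε = -1) {g u : ℝ → V}
    (hg : Continuous g) {c : ℝ} (hc : LineBdd ε u c) (hu : ∀ t, HasDerivAt u (g t) t) :
    u = prim ε g := by
  have e : ∀ x, ε * (ε * x) = x := fun x => by rw [← mul_assoc, sign_mul_self hε, one_mul]
  funext t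
  rw [prim_eq hε hg (hc.of_hasDerivAt hu), intervalIntegral.integral_eq_sub_of_hasDerivAt
    (fun s _ => hu s) (hg.intervalIntegrable _ _), hc.eq_zero (t := ε * (c - 1)) (by
      rw [e]; linarith), sub_zero]

theorem integral_eq_of_bdd {g : ℝ → V} {c d : ℝ} (hc : LineBdd 1 g c) (hd : LineBdd (-1) g d) :
    ∫ t, g t = ∫ t in c..(-d), g t := by
  refine (intervalIntegral.integral_eq_integral_of_support_subset fun t ht => ?_).symm
  have h1 := hc t ht
  have h2 := hd t ht
  exact ⟨by linarith, by linarith⟩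

/-- The integrals up to `t` from below and from above together exhaust the line. This is why the
causal propagator is constant along fibers. -/
theorem prim_sub_prim {g : ℝ → V} (hg : Continuous g) {c d : ℝ} (hc : LineBdd 1 g c)
    (hd : LineBdd (-1) g d) (t : ℝ) : prim 1 g t - prim (-1) g t = ∫ s, g s := by
  rw [prim_eq (.inl rfl) hg hc, prim_eq (.inr rfl) hg hd, integral_eq_of_bdd hc hd,
    intervalIntegral.integral_symm t (-1 * d), sub_neg_eq_add,
    intervalIntegral.integral_add_adjacent_intervals (hg.intervalIntegrable _ _)
      (hg.intervalIntegrable _ _), one_mul, neg_one_mul]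

end Primitive

section Cylinder

variable {U : Man} {V : Type} [NormedAddCommGroup V] [NormedSpace ℝ V]

theorem continuous_slice {g : U × ℝ → V} {W : Opens U}
    (hg : ContMDiffOn (mdl U) 𝓘(ℝ, V) ∞ g (cyl W)) {x : U} (hx : x ∈ W) :
    Continuous fun t => g (x, t) :=
  continuous_iff_continuousAt.2 fun t =>
    (ContMDiffAt.differentiableAt_snd (contMDiffOn_cyl_iff.1 hg x hx t)).continuousAt

/-- The Euclidean statement `contDiffAt_integral`, read in a chart of the base. -/
theorem contMDiffAt_integral [CompleteSpace V] {g : U × ℝ → V} {W : Opens U}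
    (hg : ContMDiffOn (mdl U) 𝓘(ℝ, V) ∞ g (cyl W)) (a : ℝ) {x : U} (hx : x ∈ W) (t : ℝ) :
    ContMDiffAt (mdl U) 𝓘(ℝ, V) ∞ (fun q => ∫ s in a..q.2, g (q.1, s)) (x, t) := by
  have hx0 := mem_chart_source (EuclideanSpace ℝ (Fin U.dim)) x
  rw [contMDiffAt_cyl_iff _ x hx0]
  set φ := chartAt (EuclideanSpace ℝ (Fin U.dim)) x with hφ
  refine contDiffAt_integral (G := fun q => g (φ.symm q.1, q.2)) (S := φ.target ∩ φ.symm ⁻¹' W)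
    (φ.isOpen_inter_preimage_symm W.isOpen) ?_ a ⟨φ.map_source hx0, ?_⟩ t
  · rintro ⟨y, s⟩ ⟨⟨hy, hyW⟩, -⟩
    have := (contMDiffAt_cyl_iff g x (φ.map_target hy) s).1 (contMDiffOn_cyl_iff.1 hg _ hyW s)
    rw [← hφ, φ.right_inv hy] at this
    exact this.contDiffWithinAt
  · change φ.symm (φ x) ∈ W
    rwa [φ.left_inv hx0]

/-- The support of a function on the cylinder is locally uniformly bounded below (`ε = 1`) or
above (`ε = -1`). -/
def CylBdd (ε : ℝ) (W : Opens U) (g : U × ℝ → V) : Prop :=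
  ∀ x ∈ W, ∃ c, ∀ᶠ y in 𝓝 x, LineBdd ε (fun t => g (y, t)) c

theorem CylBdd.slice {ε : ℝ} {W : Opens U} {g : U × ℝ → V} (h : CylBdd ε W g) {x : U}
    (hx : x ∈ W) : ∃ c, LineBdd ε (fun t => g (x, t)) c :=
  (h x hx).imp fun _ hc => hc.self_of_nhds

/-- The primitive along the cylinder. -/
def cylPrim (ε : ℝ) (g : U × ℝ → V) (q : U × ℝ) : V := prim ε (fun t => g (q.1, t)) q.2

variable {ε : ℝ} {g : U × ℝ → V} {W : Opens U}

/-- Locally uniform bounds allow one starting point for all nearby fibers, so locally the primitive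
is a parameter-dependent integral with constant lower limit. -/
theorem contMDiffOn_cylPrim [CompleteSpace V] (hε : ε = 1 ∨ ε = -1)
    (hg : ContMDiffOn (mdl U) 𝓘(ℝ, V) ∞ g (cyl W)) (hb : CylBdd ε W g) :
    ContMDiffOn (mdl U) 𝓘(ℝ, V) ∞ (cylPrim ε g) (cyl W) := by
  rw [contMDiffOn_cyl_iff]
  intro x hx t
  obtain ⟨c, hc⟩ := hb x hx
  refine (contMDiffAt_integral hg (ε * c) hx t).congr_of_eventuallyEq ?_
  have h1 : ∀ᶠ q : U × ℝ in 𝓝 (x, t), q.1 ∈ W ∧ LineBdd ε (fun t => g (q.1, t)) c :=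
    (continuous_fst.tendsto (x, t)).eventually
      ((show ∀ᶠ y in 𝓝 x, y ∈ W from W.isOpen.mem_nhds hx).and hc)
  filter_upwards [h1] with q hq
  exact prim_eq hε (continuous_slice hg hq.1) hq.2 q.2

theorem CylBdd.cylPrim (hε : ε = 1 ∨ ε = -1)
    (hg : ContMDiffOn (mdl U) 𝓘(ℝ, V) ∞ g (cyl W)) (hb : CylBdd ε W g) :
    CylBdd ε W (cylPrim ε g) := by
  intro x hx
  obtain ⟨c, hc⟩ := hb x hx
  refine ⟨c, ?_⟩
  filter_upwards [hc, W.isOpen.mem_nhds hx] with y hy hyW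
  exact LineBdd.prim hε (continuous_slice hg hyW) hy

theorem hasDerivAt_cylPrim [CompleteSpace V] (hg : ContMDiffOn (mdl U) 𝓘(ℝ, V) ∞ g (cyl W)) {x : U}
    (hx : x ∈ W) (t : ℝ) : HasDerivAt (fun s => SmoothAQFT.cylPrim ε g (x, s)) (g (x, t)) t :=
  hasDerivAt_prim ε (continuous_slice hg hx) t

/-- Near each base point the integral runs over one fixed bounded interval. -/
theorem contMDiffOn_integral [CompleteSpace V] (hg : ContMDiffOn (mdl U) 𝓘(ℝ, V) ∞ g (cyl W))
    (h1 : CylBdd 1 W g) (h2 : CylBdd (-1) W g) :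
    ContMDiffOn (𝓡 U.dim) 𝓘(ℝ, V) ∞ (fun x => ∫ t, g (x, t)) W := by
  intro x hx
  obtain ⟨c, hc⟩ := h1 x hx
  obtain ⟨d, hd⟩ := h2 x hx
  have := ContMDiffAt.comp x (I := 𝓡 U.dim) (f := fun y => (y, -d))
    (contMDiffAt_integral hg c hx (-d)) (contMDiffAt_id.prodMk contMDiffAt_const)
  refine (this.congr_of_eventuallyEq ?_).contMDiffWithinAt
  filter_upwards [hc, hd] with y hy hy'
  exact integral_eq_of_bdd hy hy'

theorem CylBdd.mono {W' : Opens U} (h : CylBdd ε W g) (i : W' ≤ W) : CylBdd ε W' g :=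
  fun x hx => h x (i hx)

theorem CylBdd.of_support {V' : Type} [NormedAddCommGroup V'] [NormedSpace ℝ V'] {k : U × ℝ → V'}
    (h : CylBdd ε W g) (H : ∀ x ∈ W, ∀ t, k (x, t) ≠ 0 → g (x, t) ≠ 0) : CylBdd ε W k := by
  intro x hx
  obtain ⟨c, hc⟩ := h x hx
  refine ⟨c, ?_⟩
  filter_upwards [hc, W.isOpen.mem_nhds hx] with y hy hyW t ht
  exact hy t (H y hyW t ht)

end Cylinder

end SmoothAQFT

end

/-! ### Vertical differentials and time functions. -/

noncomputable section

namespace SmoothAQFT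

open Man Set Filter

namespace LineFam
variable {U : Man} (X : LineFam U) {V : Type} [NormedAddCommGroup V] [NormedSpace ℝ V]

/-- The differential of a vector-valued function on the total space. -/
def vdiff (s : X.Tot → V) (p : X.Tot) (v : TangentSpace (mdl U) p) : V :=
  mfderiv (mdl U) 𝓘(ℝ, V) s p v

/-- Along a fiber coordinate `c` with inverse `θ`, the vertical differential is the derivative. -/
theorem vdiff_vert {s : X.Tot → V} {p : X.Tot} {c : U × ℝ → X.Tot} {θ : X.Tot → ℝ}
    (hs : MDifferentiableAt (mdl U) 𝓘(ℝ, V) s p) (hθ : MDifferentiableAt (mdl U) 𝓘(ℝ, ℝ) θ p)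
    (hc : MDifferentiableAt (mdl U) (mdl U) c (p.1, θ p)) (H : ∀ᶠ q in 𝓝 p, c (q.1, θ q) = q)
    {v : TangentSpace (mdl U) p} (hv : v ∈ X.vert p) :
    X.vdiff s p v = X.diff θ p v • deriv (fun t => s (c (p.1, t))) (θ p) := by
  have hp : c (p.1, θ p) = p := H.self_of_nhds
  have h2 : MDifferentiableAt (mdl U) (𝓡 U.dim) X.proj p :=
    (contMDiff_proj X.Fib (n := ∞)).mdifferentiable (by simp) _
  have hs' : MDifferentiableAt (mdl U) 𝓘(ℝ, V) s (c (p.1, θ p)) := by rwa [hp]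
  have hg : MDifferentiableAt (mdl U) 𝓘(ℝ, V) (s ∘ c) (p.1, θ p) := hs'.comp _ hc
  have e1 := mfderiv_comp (I' := mdl U) p (g := s ∘ c) (f := fun q : X.Tot => (q.1, θ q)) hg
    (h2.prodMk hθ)
  -- Near `p` the function `s` factors through the coordinates `(q.1, θ q)`; a vertical vector has
  -- no component along the base, so only the derivative in the fiber coordinate remains.
  have e2 : (s ∘ c) ∘ (fun q : X.Tot => (q.1, θ q)) =ᶠ[𝓝 p] s := by
    filter_upwards [H] with q hq
    exact congrArg s hq
  rw [e2.mfderiv_eq, mfderiv_prodMk h2 hθ] at e1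
  have hι : MDifferentiableAt 𝓘(ℝ, ℝ) (mdl U) (fun t : ℝ => (p.1, t)) (θ p) :=
    mdifferentiableAt_const.prodMk mdifferentiableAt_id
  have e3 := mfderiv_comp (θ p) (I' := mdl U) (g := s ∘ c) (f := fun t : ℝ => (p.1, t)) hg hι
  rw [mfderiv_prod_right] at e3
  have hv' : mfderiv (mdl U) (𝓡 U.dim) X.proj p v = 0 := hv
  have e4 := congrArg (fun L => L v) e1
  have e5 := congrArg (fun L => L (X.diff θ p v)) e3
  have e6 : mfderiv 𝓘(ℝ, ℝ) 𝓘(ℝ, V) ((s ∘ c) ∘ fun t : ℝ => (p.1, t)) (θ p) (X.diff θ p v) =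
      X.diff θ p v • deriv (fun t => s (c (p.1, t))) (θ p) := by
    rw [mfderiv_eq_fderiv]
    have : ∀ (f : ℝ → V) (t a : ℝ), fderiv ℝ f t a = a • deriv f t := fun f t a =>
      fderiv_eq_smul_deriv a
    exact this _ _ _
  refine Eq.trans ?_ (e5.symm.trans e6)
  refine e4.trans ?_
  refine congrArg (mfderiv (mdl U) 𝓘(ℝ, V) (s ∘ c) (p.1, θ p)) ?_
  exact Prod.ext hv' rfl

end LineFam

namespace LocObj
variable {U : Man} (X : LocObj U) {V : Type} [NormedAddCommGroup V] [NormedSpace ℝ V]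

theorem velocity_mem_vert {c : ℝ → X.Tot} {t : ℝ} {x : U}
    (hc : MDifferentiableAt 𝓘(ℝ, ℝ) (mdl U) c t) (H : ∀ s, (c s).1 = x) :
    X.velocity c t ∈ X.vert (c t) := by
  have h2 : MDifferentiableAt (mdl U) (𝓡 U.dim) X.proj (c t) :=
    (contMDiff_proj X.Fib (n := ∞)).mdifferentiable (by simp) _
  have e1 := mfderiv_comp t h2 hc
  have e2 : X.proj ∘ c = fun _ => x := funext H
  rw [e2, mfderiv_const] at e1
  exact (congrArg (fun L => L (1 : ℝ)) e1).symm

theorem vdiff_velocity {c : ℝ → X.Tot} {t : ℝ} {s : X.Tot → V}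
    (hs : MDifferentiableAt (mdl U) 𝓘(ℝ, V) s (c t))
    (hc : MDifferentiableAt 𝓘(ℝ, ℝ) (mdl U) c t) :
    X.vdiff s (c t) (X.velocity c t) = deriv (fun u => s (c u)) t := by
  have e1 := congrArg (fun L => L (1 : ℝ)) (mfderiv_comp t hs hc)
  refine e1.symm.trans ?_
  rw [mfderiv_eq_fderiv]
  have : ∀ (f : ℝ → V) (t : ℝ), fderiv ℝ f t 1 = deriv f t := fun f t => fderiv_apply_one_eq_deriv
  exact this _ _

theorem diff_velocity {c : ℝ → X.Tot} {t : ℝ} {s : X.Tot → ℝ}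
    (hs : MDifferentiableAt (mdl U) 𝓘(ℝ, ℝ) s (c t))
    (hc : MDifferentiableAt 𝓘(ℝ, ℝ) (mdl U) c t) :
    X.diff s (c t) (X.velocity c t) = deriv (fun u => s (c u)) t := X.vdiff_velocity hs hc

/-- A time function over an open subset of the base, as the coordinate of a trivialization in which
the one-form is positive. -/
structure ClockOn (N : Opens U) where
  time : X.Tot → ℝ
  pt : U × ℝ → X.Tot
  rate : U × ℝ → ℝ
  proj_pt : ∀ x ∈ N, ∀ t, (pt (x, t)).1 = x
  time_pt : ∀ x ∈ N, ∀ t, time (pt (x, t)) = t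
  pt_time : ∀ p : X.Tot, p.1 ∈ N → pt (p.1, time p) = p
  smooth_time : ∀ p : X.Tot, p.1 ∈ N → ContMDiffAt (mdl U) 𝓘(ℝ, ℝ) ∞ time p
  smooth_pt : ∀ x ∈ N, ∀ t, ContMDiffAt (mdl U) (mdl U) ∞ pt (x, t)
  smooth_rate : ∀ x ∈ N, ∀ t, ContMDiffAt (mdl U) 𝓘(ℝ, ℝ) ∞ rate (x, t)
  rate_pos : ∀ x ∈ N, ∀ t, 0 < rate (x, t)
  ev_eq : ∀ p : X.Tot, p.1 ∈ N → ∀ v ∈ X.vert p, X.ev p v = rate (p.1, time p) * X.diff time p v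

variable {X}

namespace ClockOn
variable {N : Opens U} (C : X.ClockOn N)

theorem smooth_curve {x : U} (hx : x ∈ N) (t : ℝ) :
    ContMDiffAt 𝓘(ℝ, ℝ) (mdl U) ∞ (fun s => C.pt (x, s)) t :=
  ContMDiffAt.comp t (g := C.pt) (f := fun s => (x, s)) (C.smooth_pt x hx t)
    (contMDiffAt_const.prodMk contMDiffAt_id)

theorem vert_curve {x : U} (hx : x ∈ N) (t : ℝ) :
    X.velocity (fun s => C.pt (x, s)) t ∈ X.vert (C.pt (x, t)) :=
  X.velocity_mem_vert (c := fun s => C.pt (x, s)) ((C.smooth_curve hx t).mdifferentiableAt (by simp))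
    (fun s => C.proj_pt x hx s)

theorem ev_curve {x : U} (hx : x ∈ N) (t : ℝ) :
    X.ev (C.pt (x, t)) (X.velocity (fun s => C.pt (x, s)) t) = C.rate (x, t) := by
  have hp := C.proj_pt x hx t
  have hN : (C.pt (x, t)).1 ∈ N := by rwa [hp]
  rw [C.ev_eq _ hN _ (C.vert_curve hx t), C.time_pt x hx, hp]
  have : X.diff C.time (C.pt (x, t)) (X.velocity (fun s => C.pt (x, s)) t) = 1 := by
    refine (X.diff_velocity (c := fun s => C.pt (x, s)) ((C.smooth_time _ hN).mdifferentiableAt (by simp))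
      ((C.smooth_curve hx t).mdifferentiableAt (by simp))).trans ?_
    have : (fun u => C.time (C.pt (x, u))) = id := funext fun u => C.time_pt x hx u
    rw [this, deriv_id]
  rw [this, mul_one]

theorem vdiff_eq {s : X.Tot → V} {p : X.Tot} (hp : p.1 ∈ N)
    (hs : MDifferentiableAt (mdl U) 𝓘(ℝ, V) s p) {v : TangentSpace (mdl U) p} (hv : v ∈ X.vert p) :
    X.vdiff s p v = X.diff C.time p v • deriv (fun t => s (C.pt (p.1, t))) (C.time p) := by
  refine X.vdiff_vert hs ((C.smooth_time p hp).mdifferentiableAt (by simp))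
    ((C.smooth_pt _ hp _).mdifferentiableAt (by simp)) ?_ hv
  filter_upwards [(contMDiff_proj X.Fib (n := ∞) (IB := 𝓡 U.dim)).continuous.continuousAt
    (N.isOpen.mem_nhds hp)] with q hq
  exact C.pt_time q hq

end ClockOn

/-- A time function over `N`: its differential is a positive multiple of the one-form, and it maps
fibers onto the line. -/
structure IsTime (N : Opens U) (τ : X.Tot → ℝ) : Prop where
  smooth : ∀ p : X.Tot, p.1 ∈ N → ContMDiffAt (mdl U) 𝓘(ℝ, ℝ) ∞ τ p
  pos : ∀ p : X.Tot, p.1 ∈ N → ∃ r > 0, ∀ v ∈ X.vert p, X.ev p v = r * X.diff τ p v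
  surj : ∀ x ∈ N, ∀ t, ∃ p : X.Tot, p.1 = x ∧ τ p = t

theorem ClockOn.isTime {N : Opens U} (C : X.ClockOn N) : IsTime N C.time :=
  ⟨C.smooth_time, fun p hp => ⟨_, C.rate_pos p.1 hp _, C.ev_eq p hp⟩,
    fun x hx t => ⟨C.pt (x, t), C.proj_pt x hx t, C.time_pt x hx t⟩⟩

namespace IsTime
variable {N N' : Opens U} {τ : X.Tot → ℝ}

/-- On the velocity of the fiber curve of `C` the one-form takes the value `rate > 0`; by `hτ` that
value is also a positive multiple of the derivative of `τ` along the curve. -/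
theorem hasDerivAt (hτ : IsTime N' τ) (C : X.ClockOn N) {x : U} (hx : x ∈ N) (hx' : x ∈ N') (t : ℝ) :
    ∃ d > 0, HasDerivAt (fun s => τ (C.pt (x, s))) d t := by
  have hp := C.proj_pt x hx t
  have h1 := hτ.smooth (C.pt (x, t)) (by rwa [hp])
  have h2 := C.smooth_curve hx t
  obtain ⟨r, hr, H⟩ := hτ.pos (C.pt (x, t)) (by rwa [hp])
  have e1 := H _ (C.vert_curve hx t)
  rw [C.ev_curve hx] at e1
  have e2 := X.diff_velocity (c := fun s => C.pt (x, s)) (h1.mdifferentiableAt (by simp)) (h2.mdifferentiableAt (by simp))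
  have e3 := e1.trans (congrArg (r * ·) e2)
  have h3 : DifferentiableAt ℝ (fun s => τ (C.pt (x, s))) t :=
    ((h1.comp (g := τ) (f := fun s => C.pt (x, s)) t h2).contDiffAt).differentiableAt (by simp)
  refine ⟨_, ?_, h3.hasDerivAt⟩
  have := C.rate_pos x hx t
  rw [e3] at this
  exact (mul_pos_iff_of_pos_left hr).1 this

theorem strictMono (hτ : IsTime N' τ) (C : X.ClockOn N) {x : U} (hx : x ∈ N) (hx' : x ∈ N') : StrictMono fun s => τ (C.pt (x, s)) := by
  refine strictMono_of_deriv_pos fun t => ?_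
  obtain ⟨d, hd, h⟩ := hτ.hasDerivAt C hx hx' t
  rwa [h.deriv]

end IsTime

end LocObj

end SmoothAQFT

end

/-! ### Existence of global time functions. -/

noncomputable section

namespace SmoothAQFT

open Man Set Filter

namespace LineFam
variable {U : Man} (X : LineFam U)

theorem contMDiffAt_symm (e : Trivialization ℝ (π ℝ X.Fib)) [MemTrivializationAtlas e]
    {q : U × ℝ} (hq : q.1 ∈ e.baseSet) :
    ContMDiffAt (mdl U) (mdl U) ∞ (fun y : U × ℝ => e.toOpenPartialHomeomorph.symm y) q := by
  rw [contMDiffAt_totalSpace]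
  have hp : (e.toOpenPartialHomeomorph.symm q).proj = q.1 := e.proj_symm_apply' hq
  constructor
  · refine contMDiffAt_fst.congr_of_eventuallyEq ?_
    filter_upwards [(continuous_fst.tendsto q).eventually (e.open_baseSet.mem_nhds hq)] with y hy
    exact e.proj_symm_apply' hy
  · rw [hp]
    exact (X.transition e _).contMDiffAt (((e.open_baseSet.inter (Trivialization.open_baseSet _)).prod
      isOpen_univ).mem_nhds ⟨⟨hq, FiberBundle.mem_baseSet_trivializationAt' _⟩, trivial⟩)

end LineFam

namespace LocObj
variable {U : Man} (X : LocObj U)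

/-- At a zero of the density the one-form would kill the velocity of the coordinate curve, which by
non-degeneracy would vanish; but the coordinate grows along it at rate `1`. -/
theorem density_ne_zero {e : Trivialization ℝ (π ℝ X.Fib)} [MemTrivializationAtlas e] {ρ : U × ℝ → ℝ}
    (h : ∀ p ∈ e.source, ∀ v : X.vert p, X.form p v = ρ (e p) * X.diff (fun q => (e q).2) p v)
    {x : U} (hx : x ∈ e.baseSet) (t : ℝ) : ρ (x, t) ≠ 0 := by
  intro h0
  let c : ℝ → X.Tot := fun s => e.toOpenPartialHomeomorph.symm (x, s)
  have hc : MDifferentiableAt 𝓘(ℝ, ℝ) (mdl U) c t :=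
    (ContMDiffAt.comp t (g := fun y : U × ℝ => e.toOpenPartialHomeomorph.symm y)
      (f := fun s => (x, s)) (X.contMDiffAt_symm e (q := (x, t)) hx)
      (contMDiffAt_const.prodMk contMDiffAt_id)).mdifferentiableAt (by simp)
  have hv := X.velocity_mem_vert hc (x := x) fun s => e.proj_symm_apply' hx
  have hp : c t ∈ e.source := e.toOpenPartialHomeomorph.map_target (e.mem_target.2 hx)
  have e1 : X.diff (fun q => (e q).2) (c t) (X.velocity c t) = 1 := by
    rw [X.diff_velocity ((X.contMDiffAt_snd e hp).mdifferentiableAt (by simp)) hc]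
    have : (fun u => (e (c u)).2) = id := funext fun u => congrArg Prod.snd (e.apply_symm_apply' hx)
    rw [this, deriv_id]
  have e2 := h (c t) hp ⟨_, hv⟩
  have e3 : e (c t) = (x, t) := e.apply_symm_apply' hx
  rw [e3, h0, zero_mul] at e2
  have e4 : X.velocity c t = 0 := congrArg Subtype.val (X.form_nondeg _ _ e2)
  rw [e4] at e1
  exact (zero_ne_one : (0 : ℝ) ≠ 1) ((map_zero (mfderiv (mdl U) 𝓘(ℝ, ℝ) (fun q => (e q).2) (c t))).symm.trans e1)

/-- A trivialization is a time function up to the sign of the density. That sign is constant on each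
fiber, and it is constant over a neighborhood of `x₀` by continuity. -/
theorem exists_clockOn (x₀ : U) : ∃ N : Opens U, x₀ ∈ N ∧ Nonempty (X.ClockOn N) := by
  let e := trivializationAt ℝ X.Fib x₀
  obtain ⟨ρ, hρ, H⟩ := X.form_smooth e
  have hne : ∀ x ∈ e.baseSet, ∀ t, ρ (x, t) ≠ 0 := fun x hx t => X.density_ne_zero H hx t
  have hx₀ : x₀ ∈ e.baseSet := FiberBundle.mem_baseSet_trivializationAt' x₀
  -- `κ` is the sign of the density at `x₀`; the fiber coordinate is multiplied by it.
  obtain ⟨κ, hκ, hκ'⟩ : ∃ κ : ℝ, κ * κ = 1 ∧ 0 < κ * ρ (x₀, 0) := by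
    rcases lt_or_gt_of_ne (hne x₀ hx₀ 0) with h | h
    · exact ⟨-1, by norm_num, by linarith⟩
    · exact ⟨1, by norm_num, by linarith⟩
  have hκ0 : κ ≠ 0 := fun h => by simp [h] at hκ
  have hcont : ContinuousOn (fun x => κ * ρ (x, 0)) e.baseSet :=
    continuousOn_const.mul (hρ.continuousOn.comp (f := fun x => (x, (0 : ℝ)))
      (by fun_prop) fun x hx => ⟨hx, trivial⟩)
  let N : Opens U := ⟨e.baseSet ∩ (fun x => κ * ρ (x, 0)) ⁻¹' Ioi 0,
    hcont.isOpen_inter_preimage e.open_baseSet isOpen_Ioi⟩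
  -- `N` only prescribes the sign at fiber coordinate `0`; by the intermediate value theorem a
  -- nowhere vanishing density keeps it along the fiber.
  have hpos : ∀ x ∈ N, ∀ t, 0 < κ * ρ (x, t) := by
    intro x hx t
    by_contra hle
    have hc : Continuous fun s => κ * ρ (x, s) := by
      refine continuous_const.mul (continuousOn_univ.1 ?_)
      exact hρ.continuousOn.comp (f := fun s : ℝ => (x, s)) (by fun_prop) fun s _ => ⟨hx.1, trivial⟩
    obtain ⟨s, hs⟩ := mem_range_of_exists_le_of_exists_ge hc ⟨t, not_lt.1 hle⟩ ⟨0, le_of_lt hx.2⟩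
    exact mul_ne_zero hκ0 (hne x hx.1 s) hs
  have hsc : ∀ (x : U) (t : ℝ),
      ContMDiffAt (mdl U) (mdl U) ∞ (fun q : U × ℝ => (q.1, κ * q.2)) (x, t) := fun x t =>
    contMDiffAt_fst.prodMk (((contDiff_const.mul contDiff_id : ContDiff ℝ ∞ fun t : ℝ => κ * t).contMDiff.contMDiffAt).comp (x, t) contMDiffAt_snd)
  have hκκ : ∀ t, κ * (κ * t) = t := fun t => by rw [← mul_assoc, hκ, one_mul]
  refine ⟨N, ⟨hx₀, hκ'⟩, ⟨{
    time := fun p => κ * (e p).2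
    pt := fun q => e.toOpenPartialHomeomorph.symm (q.1, κ * q.2)
    rate := fun q => κ * ρ (q.1, κ * q.2)
    proj_pt := fun x hx t => e.proj_symm_apply' hx.1
    time_pt := ?_
    pt_time := ?_
    smooth_time := ?_
    smooth_pt := ?_
    smooth_rate := ?_
    rate_pos := fun x hx t => hpos x hx _
    ev_eq := ?_ }⟩⟩
  · intro x hx t
    have : e (e.toOpenPartialHomeomorph.symm (x, κ * t)) = (x, κ * t) := e.apply_symm_apply' hx.1
    rw [this]
    exact hκκ t
  · intro p hp
    dsimp only
    rw [hκκ]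
    exact e.symm_apply_mk_proj (e.mem_source.2 hp.1)
  · intro p hp
    exact (contDiff_const.mul contDiff_id : ContDiff ℝ ∞ fun t : ℝ => κ * t).contMDiff.contMDiffAt.comp
      p (X.contMDiffAt_snd e (e.mem_source.2 hp.1))
  · intro x hx t
    exact ContMDiffAt.comp (x, t) (g := fun y : U × ℝ => e.toOpenPartialHomeomorph.symm y)
      (X.contMDiffAt_symm e (q := (x, κ * t)) hx.1) (hsc x t)
  · intro x hx t
    refine (contDiff_const.mul contDiff_id : ContDiff ℝ ∞ fun t : ℝ => κ * t).contMDiff.contMDiffAt.comp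
      (x, t) ?_
    exact ContMDiffAt.comp (x, t) (g := ρ) (hρ.contMDiffAt ((e.open_baseSet.prod isOpen_univ).mem_nhds
      ⟨hx.1, trivial⟩)) (hsc x t)
  · intro p hp v hv
    have hps := e.mem_source.2 hp.1
    have e1 : X.diff (fun q => κ * (e q).2) p v = κ * X.diff (fun q => (e q).2) p v := by
      have := const_smul_mfderiv ((X.contMDiffAt_snd e hps).mdifferentiableAt (by simp)) κ
      exact congrArg (fun L => L v) this
    have e2 : e p = (p.1, (e p).2) := Prod.ext (e.coe_fst hps) rfl
    rw [ev_of_mem X hv, H p hps ⟨v, hv⟩, e1, hκκ, ← e2]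
    linear_combination (-(ρ (e p) * X.diff (fun q => (e q).2) p v)) * hκ

/-- Local time functions are averaged with a partition of unity on the base. The weights are
constant along fibers, so the average has positive derivative there, and its range on each fiber is
controlled by the ranges of the local functions. -/
theorem exists_isTime : ∃ τ : X.Tot → ℝ, IsTime ⊤ τ := by
  choose N hN C using X.exists_clockOn
  replace C := fun x => (C x).some
  have : LocallyCompactSpace U :=
    ChartedSpace.locallyCompactSpace (EuclideanSpace ℝ (Fin U.dim)) U
  obtain ⟨f, hf⟩ := SmoothPartitionOfUnity.exists_isSubordinate (𝓡 U.dim) (isClosed_univ (X := U))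
    (fun x => (N x : Set U)) (fun x => (N x).isOpen) (fun x _ => mem_iUnion_of_mem x (hN x))
  let τ : X.Tot → ℝ := fun p => ∑ i ∈ f.finsupport p.1, f i p.1 * (C i).time p
  have hmem : ∀ x, ∀ i ∈ f.fintsupport x, x ∈ N i := fun x i hi =>
    hf i ((f.mem_fintsupport_iff x i).1 hi)
  have hmem' : ∀ x, ∀ i ∈ f.finsupport x, x ∈ N i := fun x i hi =>
    hmem x i (f.finsupport_subset_fintsupport x hi)
  have hfpos : ∀ x, ∀ i ∈ f.finsupport x, 0 < f i x := fun x i hi =>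
    lt_of_le_of_ne (f.nonneg i x) (Ne.symm ((f.mem_finsupport x).1 hi))
  have hsum : ∀ x, ∑ i ∈ f.finsupport x, f i x = 1 := fun x => f.sum_finsupport x (mem_univ x)
  have hne : ∀ x, (f.finsupport x).Nonempty := fun x => by
    rw [Finset.nonempty_iff_ne_empty]
    intro h
    have := hsum x
    simp [h] at this
  have hfib : ∀ x t, τ ((C x).pt (x, t)) =
      ∑ i ∈ f.finsupport x, f i x * (C i).time ((C x).pt (x, t)) := by
    intro x t
    simp only [τ, (C x).proj_pt x (hN x) t]
  have hsm : ∀ p, ContMDiffAt (mdl U) 𝓘(ℝ, ℝ) ∞ τ p := by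
    intro p
    -- The index set of the defining sum varies with the point. It is replaced by one finite set
    -- valid near `p.1`; the additional terms have weight zero.
    have h1 : ContMDiffAt (mdl U) 𝓘(ℝ, ℝ) ∞
        (fun q : X.Tot => ∑ i ∈ f.fintsupport p.1, f i q.1 * (C i).time q) p := by
      refine contMDiffAt_finsetSum fun i hi => ?_
      refine ContMDiffAt.mul ?_ ((C i).smooth_time p (hmem _ i hi))
      exact ((f i).contMDiff.contMDiffAt).comp p (contMDiffAt_proj X.Fib)
    refine h1.congr_of_eventuallyEq ?_
    filter_upwards [(contMDiff_proj X.Fib (n := ∞) (IB := 𝓡 U.dim)).continuous.continuousAt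
      (f.eventually_finsupport_subset p.1)] with q hq
    refine Finset.sum_subset hq fun i _ hi => ?_
    have : f i q.1 = 0 := by
      by_contra h
      exact hi ((f.mem_finsupport _).2 h)
    rw [this, zero_mul]
  have hder : ∀ x t, ∃ d > 0, HasDerivAt (fun s => τ ((C x).pt (x, s))) d t := by
    intro x t
    have h1 : ∀ i ∈ f.finsupport x, ∃ d > 0,
        HasDerivAt (fun s => (C i).time ((C x).pt (x, s))) d t := fun i hi =>
      (C i).isTime.hasDerivAt (C x) (hN x) (hmem' x i hi) t
    choose! d hd hd' using h1
    refine ⟨∑ i ∈ f.finsupport x, f i x * d i,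
      Finset.sum_pos (fun i hi => mul_pos (hfpos x i hi) (hd i hi)) (hne x), ?_⟩
    simp only [hfib]
    exact HasDerivAt.fun_sum fun i hi => (hd' i hi).const_mul _
  refine ⟨τ, fun p _ => hsm p, ?_, ?_⟩
  · intro p _
    have hp := hN p.1
    obtain ⟨d, hd, h⟩ := hder p.1 ((C p.1).time p)
    refine ⟨(C p.1).rate (p.1, (C p.1).time p) / d, div_pos ((C p.1).rate_pos _ hp _) hd, ?_⟩
    intro v hv
    have e1 : X.diff τ p v = X.diff (C p.1).time p v • _ :=
      (C p.1).vdiff_eq hp ((hsm p).mdifferentiableAt (by simp)) hv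
    rw [h.deriv, smul_eq_mul] at e1
    rw [(C p.1).ev_eq p hp v hv, e1]
    field_simp
  · intro x _ t
    have hcont : Continuous fun s => τ ((C x).pt (x, s)) := continuous_iff_continuousAt.2 fun s =>
      (hder x s).choose_spec.2.continuousAt
    have h1 : ∀ i ∈ f.finsupport x, ∃ s, (C i).time ((C x).pt (x, s)) = t := by
      intro i hi
      refine ⟨(C x).time ((C i).pt (x, t)), ?_⟩
      have e1 := (C i).proj_pt x (hmem' x i hi) t
      have e2 := (C x).pt_time ((C i).pt (x, t)) (by rw [e1]; exact hN x)
      rw [e1] at e2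
      rw [e2, (C i).time_pt x (hmem' x i hi)]
    choose! s hs using h1
    have hmono : ∀ i ∈ f.finsupport x, Monotone fun s => (C i).time ((C x).pt (x, s)) := fun i hi =>
      ((C i).isTime.strictMono (C x) (hN x) (hmem' x i hi)).monotone
    have ht : t = ∑ i ∈ f.finsupport x, f i x * t := by rw [← Finset.sum_mul, hsum, one_mul]
    -- `s i` is where the local time `i` reaches `t`. At the smallest of these positions all local
    -- times are at most `t`, at the largest at least `t`, so the average takes the value `t` in
    -- between.
    obtain ⟨a, ha, ha'⟩ := Finset.exists_min_image _ s (hne x)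
    obtain ⟨b, hb, hb'⟩ := Finset.exists_max_image _ s (hne x)
    have hlow : τ ((C x).pt (x, s a)) ≤ t := by
      rw [hfib, ht]
      refine Finset.sum_le_sum fun i hi => mul_le_mul_of_nonneg_left ?_ (f.nonneg i x)
      exact (hmono i hi (ha' i hi)).trans (hs i hi).le
    have hupp : t ≤ τ ((C x).pt (x, s b)) := by
      rw [hfib]
      conv_lhs => rw [ht]
      refine Finset.sum_le_sum fun i hi => mul_le_mul_of_nonneg_left ?_ (f.nonneg i x)
      exact (hs i hi).symm.le.trans (hmono i hi (hb' i hi))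
    obtain ⟨r, hr⟩ := mem_range_of_exists_le_of_exists_ge hcont ⟨_, hlow⟩ ⟨_, hupp⟩
    exact ⟨(C x).pt (x, r), (C x).proj_pt x (hN x) r, hr⟩

/-- A function with `IsTime` is bijective on each fiber, so together with the projection it is a
global coordinate system; only smoothness of the inverse and of the density remains, both local
questions settled in a local clock. -/
theorem exists_clock : Nonempty (X.ClockOn ⊤) := by
  obtain ⟨τ, hτ⟩ := X.exists_isTime
  choose N hN C using X.exists_clockOn
  replace C := fun x => (C x).some
  choose! pt h1 h2 using fun (x : U) (t : ℝ) => hτ.surj x trivial t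
  have hinj : ∀ p q : X.Tot, p.1 = q.1 → τ p = τ q → p = q := by
    intro p q hpq ht
    have e1 := (C p.1).pt_time p (hN p.1)
    have e2 := (C p.1).pt_time q (by rw [← hpq]; exact hN p.1)
    rw [← hpq] at e2
    have := (hτ.strictMono (C p.1) (hN p.1) trivial).injective (a₁ := (C p.1).time p)
      (a₂ := (C p.1).time q) (by simp only [e1, e2, ht])
    rw [← e1, ← e2, this]
  -- The local time at `x₀` of the point with prescribed global time: the fiberwise inverse of the
  -- global time in the local coordinate.
  let G : U → U × ℝ → ℝ := fun x₀ q => (C x₀).time (pt q.1 q.2)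
  have hG : ∀ x₀, ∀ q : U × ℝ, q.1 ∈ N x₀ → (C x₀).pt (q.1, G x₀ q) = pt q.1 q.2 := by
    intro x₀ q hq
    have := (C x₀).pt_time (pt q.1 q.2) (by rw [h1]; exact hq)
    rwa [h1] at this
  have hsG : ∀ x t, ContMDiffAt (mdl U) 𝓘(ℝ, ℝ) ∞ (G x) (x, t) := by
    intro x t
    refine contMDiffAt_fiber_inverse (F := fun q => τ ((C x).pt q)) ?_ ?_ ?_ ?_
    · exact ContMDiffAt.comp _ (hτ.smooth _ trivial) ((C x).smooth_pt x (hN x) _)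
    · obtain ⟨d, hd, h⟩ := hτ.hasDerivAt (C x) (hN x) trivial (G x (x, t))
      rw [h.deriv]
      exact hd.ne'
    · filter_upwards [(continuous_fst.tendsto (x, t)).eventually
        ((N x).isOpen.mem_nhds (hN x))] with q hq
      rw [hG x q hq, h2]
    · filter_upwards [(N x).isOpen.mem_nhds (hN x)] with y hy
      exact (hτ.strictMono (C x) hy trivial).injective
  have hspt : ∀ x t, ContMDiffAt (mdl U) (mdl U) ∞ (fun q : U × ℝ => pt q.1 q.2) (x, t) := by
    intro x t
    have := ContMDiffAt.comp (x, t) (g := (C x).pt) (f := fun q : U × ℝ => (q.1, G x q))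
      ((C x).smooth_pt x (hN x) _) (contMDiffAt_fst.prodMk (hsG x t))
    refine this.congr_of_eventuallyEq ?_
    filter_upwards [(continuous_fst.tendsto (x, t)).eventually
      ((N x).isOpen.mem_nhds (hN x))] with q hq
    exact (hG x q hq).symm
  have hcurve : ∀ x t, MDifferentiableAt 𝓘(ℝ, ℝ) (mdl U) (pt x) t := fun x t =>
    (ContMDiffAt.comp t (g := fun q : U × ℝ => pt q.1 q.2) (f := fun s => (x, s)) (hspt x t)
      (contMDiffAt_const.prodMk contMDiffAt_id)).mdifferentiableAt (by simp)
  have hvert : ∀ x t, X.velocity (pt x) t ∈ X.vert (pt x t) := fun x t =>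
    X.velocity_mem_vert (hcurve x t) (h1 x)
  have hunit : ∀ x t, X.diff τ (pt x t) (X.velocity (pt x) t) = 1 := by
    intro x t
    rw [X.diff_velocity ((hτ.smooth _ trivial).mdifferentiableAt (by simp)) (hcurve x t)]
    have : (fun u => τ (pt x u)) = id := funext fun u => h2 x u
    rw [this, deriv_id]
  -- The density is the value of the one-form on the curve along which global time has derivative
  -- `1`, so it agrees with every factor `r` from `IsTime`.
  let rate : U × ℝ → ℝ := fun q => X.ev (pt q.1 q.2) (X.velocity (pt q.1) q.2)
  have hrate : ∀ x t r, (∀ v ∈ X.vert (pt x t), X.ev (pt x t) v = r * X.diff τ (pt x t) v) →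
      rate (x, t) = r := by
    intro x t r h
    have := h _ (hvert x t)
    rwa [hunit, mul_one] at this
  have hpt : ∀ p : X.Tot, pt p.1 (τ p) = p := fun p => hinj _ _ (h1 _ _) (h2 _ _)
  refine ⟨{
    time := τ
    pt := fun q => pt q.1 q.2
    rate := rate
    proj_pt := fun x _ t => h1 x t
    time_pt := fun x _ t => h2 x t
    pt_time := fun p _ => hpt p
    smooth_time := fun p _ => hτ.smooth p trivial
    smooth_pt := fun x _ t => hspt x t
    smooth_rate := ?_
    rate_pos := ?_
    ev_eq := ?_ }⟩
  · intro x _ t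
    -- The transformation rule of a density under the change of coordinate `G x` exhibits the global
    -- density as smooth.
    have h3 : ContMDiffAt (mdl U) 𝓘(ℝ, ℝ) ∞ (fun q : U × ℝ => (C x).rate (q.1, G x q) *
        deriv (fun s => G x (q.1, s)) q.2) (x, t) := by
      refine ContMDiffAt.mul ?_ (contMDiffAt_deriv (hsG x t))
      exact ContMDiffAt.comp (x, t) (g := (C x).rate) (f := fun q : U × ℝ => (q.1, G x q))
        ((C x).smooth_rate x (hN x) _) (contMDiffAt_fst.prodMk (hsG x t))
    refine h3.congr_of_eventuallyEq ?_
    filter_upwards [(continuous_fst.tendsto (x, t)).eventually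
      ((N x).isOpen.mem_nhds (hN x))] with q hq
    have hq' : (pt q.1 q.2).1 ∈ N x := by rw [h1]; exact hq
    have e1 := (C x).ev_eq _ hq' _ (hvert q.1 q.2)
    refine e1.trans ?_
    rw [X.diff_velocity (((C x).smooth_time _ hq').mdifferentiableAt (by simp)) (hcurve q.1 q.2), h1]
  · intro x _ t
    obtain ⟨r, hr, h⟩ := hτ.pos (pt x t) trivial
    rw [hrate x t r h]
    exact hr
  · intro p _ v hv
    obtain ⟨r, hr, h⟩ := hτ.pos p trivial
    have := hrate p.1 (τ p) r (by rw [hpt]; exact h)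
    rw [this]
    exact h v hv

end LocObj

end SmoothAQFT

end

/-! ### Fields, supports and the Dirac equation in clock coordinates. -/

noncomputable section

namespace SmoothAQFT

open Man Set Filter

namespace LocObj
variable {U : Man} (X : LocObj U) {V : Type} [NormedAddCommGroup V] [NormedSpace ℝ V]

/-- A global time function. -/
abbrev Clock := X.ClockOn ⊤

/-- A choice of a global time function. -/
def clock : X.Clock := X.exists_clock.some

variable {X} {W W' : Opens U}

theorem Field.ext' {s t : X.Field W} (h : ∀ p ∈ X.above W, s.1 p = t.1 p) : s = t := by
  refine Subtype.ext (funext fun p => ?_)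
  by_cases hp : p ∈ X.above W
  · exact h p hp
  · rw [s.2.2 p hp, t.2.2 p hp]

theorem Field.contMDiffAt (s : X.Field W) {p : X.Tot} (hp : p ∈ X.above W) :
    ContMDiffAt (mdl U) 𝓘(ℝ, ℂ × ℂ) ∞ s.1 p :=
  s.2.1.contMDiffAt ((X.isOpen_above W).mem_nhds hp)

namespace ClockOn
variable (C : X.Clock)

theorem time_pt' (q : U × ℝ) : C.time (C.pt q) = q.2 := C.time_pt q.1 trivial q.2
theorem proj_pt' (q : U × ℝ) : (C.pt q).1 = q.1 := C.proj_pt q.1 trivial q.2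
theorem pt_time' (p : X.Tot) : C.pt (p.1, C.time p) = p := C.pt_time p trivial
theorem smooth_pt' : ContMDiff (mdl U) (mdl U) ∞ C.pt := fun q => C.smooth_pt q.1 trivial q.2
theorem smooth_time' : ContMDiff (mdl U) 𝓘(ℝ, ℝ) ∞ C.time := fun p => C.smooth_time p trivial
theorem smooth_rate' : ContMDiff (mdl U) 𝓘(ℝ, ℝ) ∞ C.rate := fun q => C.smooth_rate q.1 trivial q.2

theorem smooth_coord : ContMDiff (mdl U) (mdl U) ∞ fun p : X.Tot => (p.1, C.time p) :=
  (contMDiff_proj X.Fib).prodMk C.smooth_time'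

theorem pt_mem_above {q : U × ℝ} : C.pt q ∈ X.above W ↔ q.1 ∈ W := by
  change (C.pt q).1 ∈ W ↔ _
  rw [C.proj_pt']

theorem smooth_read (s : X.Field W) :
    ContMDiffOn (mdl U) 𝓘(ℝ, ℂ × ℂ) ∞ (fun q => s.1 (C.pt q)) (cyl W) :=
  s.2.1.comp C.smooth_pt'.contMDiffOn fun _ hq => C.pt_mem_above.2 hq.1

theorem field_ext {s t : X.Field W} (h : ∀ x ∈ W, ∀ τ, s.1 (C.pt (x, τ)) = t.1 (C.pt (x, τ))) :
    s = t := Field.ext' fun p hp => by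
  rw [← C.pt_time' p]
  exact h _ hp _

/-- The field with a given expression in the cylinder coordinates. -/
def field (g : U × ℝ → ℂ × ℂ) (hg : ContMDiffOn (mdl U) 𝓘(ℝ, ℂ × ℂ) ∞ g (cyl W)) : X.Field W :=
  ⟨(X.above W).indicator fun p => g (p.1, C.time p),
    (hg.comp C.smooth_coord.contMDiffOn fun _ hp => ⟨hp, trivial⟩).congr
      fun _ hp => Set.indicator_of_mem hp _,
    fun _ hp => Set.indicator_of_notMem hp _⟩

theorem field_pt {g : U × ℝ → ℂ × ℂ} (hg : ContMDiffOn (mdl U) 𝓘(ℝ, ℂ × ℂ) ∞ g (cyl W)) {x : U}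
    (hx : x ∈ W) (t : ℝ) : (C.field g hg).1 (C.pt (x, t)) = g (x, t) := by
  refine (Set.indicator_of_mem ((C.pt_mem_above (W := W) (q := (x, t))).2 hx)
    fun p : X.Tot => g (p.1, C.time p)).trans ?_
  rw [C.proj_pt', C.time_pt']

theorem rs_pt (s : X.Field W) (i : W' ≤ W) {x : U} (hx : x ∈ W') (t : ℝ) :
    (s.rs i).1 (C.pt (x, t)) = s.1 (C.pt (x, t)) :=
  Set.indicator_of_mem ((C.pt_mem_above (W := W') (q := (x, t))).2 hx) _

theorem smul_pt (a : Fn U W) (s : X.Field W) {x : U} (hx : x ∈ W) (t : ℝ) :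
    (s.smul a).1 (C.pt (x, t)) = a.ev ⟨x, hx⟩ • s.1 (C.pt (x, t)) := by
  have hx' : (C.pt (x, t)).1 ∈ W := (C.pt_mem_above (q := (x, t))).2 hx
  have e : a.ev ⟨(C.pt (x, t)).1, hx'⟩ = a.ev ⟨x, hx⟩ :=
    congrArg a.ev (Subtype.ext (C.proj_pt' (x, t)))
  rw [← e]
  exact congrArg (· • s.1 (C.pt (x, t))) (dif_pos hx')

/-- The vertical future and past in terms of a time function. -/
theorem mem_J {ε : ℝ} {S : Set X.Tot} {p : X.Tot} :
    p ∈ X.J ε S ↔ ∃ s ∈ S, s.1 = p.1 ∧ ε * C.time s ≤ ε * C.time p := by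
  constructor
  · rintro ⟨c, hc, hc1, hc2, hc3, hc4⟩
    refine ⟨c 0, hc3, hc1 0, ?_⟩
    have hm : ∀ t, MDifferentiableAt 𝓘(ℝ, ℝ) (mdl U) c t := fun t =>
      hc.mdifferentiable (by simp) t
    have hd : Differentiable ℝ fun t => C.time (c t) := fun t =>
      ((C.smooth_time'.comp hc).contDiff.differentiable (by simp)) t
    -- The sign condition on the velocity and positivity of the density make `ε * time`
    -- nondecreasing along the curve.
    have : Monotone fun t => ε * C.time (c t) := by
      refine monotone_of_deriv_nonneg (hd.const_mul ε) fun t => ?_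
      have h1 := hc2 t
      rw [C.ev_eq _ trivial _ (X.velocity_mem_vert (hm t) hc1),
        X.diff_velocity (C.smooth_time'.mdifferentiable (by simp) _) (hm t)] at h1
      rw [deriv_const_mul _ (hd t)]
      have h2 := C.rate_pos (c t).1 trivial (C.time (c t))
      have h3 : 0 ≤ C.rate ((c t).1, C.time (c t)) * (ε * deriv (fun u => C.time (c u)) t) := by
        linarith
      exact (mul_nonneg_iff_of_pos_left h2).1 h3
    have := this zero_le_one
    simp only [hc4] at this
    exact this
  · rintro ⟨s, hs, hsp, hle⟩
    let a := C.time s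
    let b := C.time p
    -- Conversely, the two points are joined by the curve that is affine in the time coordinate.
    have hl : ContMDiff 𝓘(ℝ, ℝ) (mdl U) ∞ fun u : ℝ => (p.1, a + u * (b - a)) :=
      contMDiff_const.prodMk (ContDiff.contMDiff (by fun_prop))
    have hc : ContMDiff 𝓘(ℝ, ℝ) (mdl U) ∞ fun u : ℝ => C.pt (p.1, a + u * (b - a)) :=
      C.smooth_pt'.comp hl
    refine ⟨fun u => C.pt (p.1, a + u * (b - a)), hc, fun u => C.proj_pt' _, fun u => ?_, ?_, ?_⟩
    · have hm := hc.mdifferentiable (by simp) u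
      rw [C.ev_eq _ trivial _ (X.velocity_mem_vert hm fun u => C.proj_pt' _),
        X.diff_velocity (C.smooth_time'.mdifferentiable (by simp) _) hm]
      simp only [C.time_pt']
      have h1 : deriv (fun u => a + u * (b - a)) u = b - a := by simp
      rw [h1]
      have h2 := C.rate_pos (C.pt (p.1, a + u * (b - a))).1 trivial (a + u * (b - a))
      have h3 : 0 ≤ ε * (b - a) := by
        have : ε * a ≤ ε * b := hle
        linarith
      calc 0 ≤ C.rate ((C.pt (p.1, a + u * (b - a))).1, a + u * (b - a)) * (ε * (b - a)) :=
            mul_nonneg h2.le h3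
        _ = _ := by ring
    · simp only [zero_mul, add_zero]
      rw [← hsp, C.pt_time']
      exact hs
    · simp only [one_mul, add_sub_cancel]
      exact C.pt_time' p

/-- The time of the bounding section is continuous, so near `x` it differs from its value at `x` by
less than the margin `1`. -/
theorem lineBdd_of_isBdd {ε : ℝ} {s : X.Field W} {i : W' ≤ W} (h : X.IsBdd ε (s.rs i)) {x : U}
    (hx : x ∈ W') : ∃ c, ∀ᶠ y in 𝓝 x, LineBdd ε (fun t => s.1 (C.pt (y, t))) c := by
  obtain ⟨σ, h1, h2, h3⟩ := h
  refine ⟨ε * C.time (σ x) - 1, ?_⟩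
  have hc : ContinuousAt (fun y => ε * C.time (σ y)) x :=
    continuousAt_const.mul (C.smooth_time'.continuous.continuousAt.comp
      (h2.continuousOn.continuousAt (W'.isOpen.mem_nhds hx)))
  filter_upwards [W'.isOpen.mem_nhds hx, hc.eventually (lt_mem_nhds (sub_one_lt _))] with y hy hyc t ht
  have hmem : C.pt (y, t) ∈ X.J ε (σ '' W') := by
    refine h3 ⟨subset_closure ?_, C.pt_mem_above.2 hy⟩
    change (s.rs i).1 _ ≠ 0
    rwa [C.rs_pt s i hy]
  obtain ⟨_, ⟨z, hz, rfl⟩, hz', hle⟩ := C.mem_J.1 hmem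
  rw [h1 z hz, C.proj_pt'] at hz'
  rw [C.time_pt', hz'] at hle
  exact hyc.trans_le hle

/-- The section of constant time `ε * c` bounds the support. -/
theorem isBdd_of_lineBdd {ε c : ℝ} (hε : ε = 1 ∨ ε = -1) {s : X.Field W} {i : W' ≤ W}
    (h : ∀ y ∈ W', LineBdd ε (fun t => s.1 (C.pt (y, t))) c) : X.IsBdd ε (s.rs i) := by
  refine ⟨fun y => C.pt (y, ε * c), fun x _ => C.proj_pt' _,
    (C.smooth_pt'.comp (contMDiff_id.prodMk contMDiff_const)).contMDiffOn, ?_⟩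
  rintro p ⟨hp, hpW⟩
  refine C.mem_J.2 ⟨_, ⟨p.1, hpW, rfl⟩, C.proj_pt' _, ?_⟩
  rw [C.time_pt']
  change ε * (ε * c) ≤ _
  rw [← mul_assoc, sign_mul_self hε, one_mul]
  by_contra hlt
  -- The set beyond the section is open, so a support point there would give a point with nonzero
  -- value.
  have ho : IsOpen {q : X.Tot | ε * C.time q < c} :=
    isOpen_lt (continuous_const.mul C.smooth_time'.continuous) continuous_const
  obtain ⟨q, ⟨hq1, hq2⟩, hq3⟩ := mem_closure_iff.1 hp _ (ho.inter (X.isOpen_above W'))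
    ⟨not_le.1 hlt, hpW⟩
  have hq4 : (s.rs i).1 (C.pt (q.1, C.time q)) ≠ 0 := by rwa [C.pt_time']
  rw [C.rs_pt s i hq2] at hq4
  exact absurd (h q.1 hq2 _ hq4) (not_lt.2 (le_of_lt hq1))

/-- This equivalence and `isVC_iff` replace sections and causal sets in the support conditions by
locally uniform bounds on the time coordinate. -/
theorem isHalf_iff {ε : ℝ} (hε : ε = 1 ∨ ε = -1) {s : X.Field W} :
    X.IsHalf ε s ↔ CylBdd ε W fun q => s.1 (C.pt q) := by
  constructor
  · intro h x hx
    obtain ⟨W', i, hx', hb⟩ := h x hx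
    exact C.lineBdd_of_isBdd hb hx'
  · intro h x hx
    obtain ⟨c, hc⟩ := h x hx
    obtain ⟨N, hN, hN', hxN⟩ := mem_nhds_iff.1 (inter_mem hc (W.isOpen.mem_nhds hx))
    exact ⟨⟨N, hN'⟩, fun y hy => (hN hy).2, hxN, C.isBdd_of_lineBdd hε fun y hy => (hN hy).1⟩

theorem isVC_iff {s : X.Field W} : X.IsVC s ↔
    CylBdd 1 W (fun q => s.1 (C.pt q)) ∧ CylBdd (-1) W fun q => s.1 (C.pt q) := by
  constructor
  · intro h
    constructor
    · intro x hx
      obtain ⟨W', i, hx', hb, -⟩ := h x hx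
      exact C.lineBdd_of_isBdd hb hx'
    · intro x hx
      obtain ⟨W', i, hx', -, hb⟩ := h x hx
      exact C.lineBdd_of_isBdd hb hx'
  · rintro ⟨h1, h2⟩ x hx
    obtain ⟨c, hc⟩ := h1 x hx
    obtain ⟨d, hd⟩ := h2 x hx
    obtain ⟨N, hN, hN', hxN⟩ := mem_nhds_iff.1 (inter_mem (inter_mem hc hd) (W.isOpen.mem_nhds hx))
    exact ⟨⟨N, hN'⟩, fun y hy => (hN hy).2, hxN,
      C.isBdd_of_lineBdd (.inl rfl) fun y hy => (hN hy).1.1,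
      C.isBdd_of_lineBdd (.inr rfl) fun y hy => (hN hy).1.2⟩

end ClockOn

/-- Multiplication by the diagonal matrix with entries `-i` and `i`. -/
def rot : ℂ × ℂ →L[ℝ] ℂ × ℂ :=
  ((-Complex.I) • ContinuousLinearMap.id ℝ ℂ).prodMap (Complex.I • ContinuousLinearMap.id ℝ ℂ)

theorem rot_apply (z : ℂ × ℂ) : rot z = (-Complex.I * z.1, Complex.I * z.2) := rfl

theorem rot_smul (a : ℂ) (z : ℂ × ℂ) : rot (a • z) = a • rot z := by
  simp only [rot_apply, Prod.smul_mk, Prod.smul_fst, Prod.smul_snd, smul_eq_mul]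
  exact Prod.ext (by ring) (by ring)

/-- `-rot` is the coefficient matrix of the Dirac operator, so this inverts it and solves the Dirac
equation for the derivative. -/
theorem rot_rot (z : ℂ × ℂ) : rot (rot z) = -z := by
  simp only [rot_apply]
  refine Prod.ext ?_ ?_
  · change -Complex.I * (-Complex.I * z.1) = -z.1
    linear_combination z.1 * Complex.I_mul_I
  · change Complex.I * (Complex.I * z.2) = -z.2
    linear_combination z.2 * Complex.I_mul_I

theorem eq_zero_of_rot {z : ℂ × ℂ} (h : rot z = 0) : z = 0 := by
  rw [← neg_eq_zero, ← rot_rot, h, map_zero]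

theorem neg_rot (z : ℂ × ℂ) : -rot z = (Complex.I * z.1, -Complex.I * z.2) := by
  rw [rot_apply]
  exact Prod.ext (by simp) (by simp)

namespace ClockOn
variable (C : X.Clock)

/-- The derivative along the cylinder of a solution of the Dirac equation with source `t`. -/
def src (t : X.Field W) (q : U × ℝ) : ℂ × ℂ := C.rate q • rot (t.1 (C.pt q))

theorem smooth_src (t : X.Field W) : ContMDiffOn (mdl U) 𝓘(ℝ, ℂ × ℂ) ∞ (C.src t) (cyl W) :=
  C.smooth_rate'.contMDiffOn.smul (rot.contDiff.contMDiff.comp_contMDiffOn (C.smooth_read t))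

theorem src_ne_zero {t : X.Field W} {q : U × ℝ} (h : C.src t q ≠ 0) : t.1 (C.pt q) ≠ 0 := by
  intro h0
  exact h (by rw [src, h0, map_zero, smul_zero])

theorem cylBdd_src {ε : ℝ} {t : X.Field W} (h : CylBdd ε W fun q => t.1 (C.pt q)) :
    CylBdd ε W (C.src t) := h.of_support fun _ _ _ => C.src_ne_zero

/-- A vertical vector is determined by its time component, so it suffices to test the equation on
velocities of the fiber curves. There it is an ordinary differential equation with source `src`. -/
theorem isDirac_iff {s t : X.Field W} : s.IsDirac t ↔
    ∀ x ∈ W, ∀ τ, HasDerivAt (fun u => s.1 (C.pt (x, u))) (C.src t (x, τ)) τ := by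
  have hd : ∀ x ∈ W, ∀ τ, DifferentiableAt ℝ (fun u => s.1 (C.pt (x, u))) τ := fun x hx τ =>
    (ContMDiffAt.differentiableAt_snd
      (contMDiffOn_cyl_iff.1 (C.smooth_read s) x hx τ)).differentiableAt (by simp)
  have key : ∀ (d z : ℂ × ℂ) (r : ℝ), d = r • rot z ↔
      (Complex.I * d.1, -Complex.I * d.2) = (r : ℂ) • z := by
    intro d z r
    rw [← neg_rot, ← Complex.coe_smul]
    constructor
    · rintro rfl
      rw [rot_smul, rot_rot, smul_neg, neg_neg]
    · intro h
      rw [← rot_smul, ← h, map_neg, rot_rot, neg_neg]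
  constructor
  · intro h x hx τ
    have h1 := h (C.pt (x, τ)) (C.pt_mem_above.2 hx) _ (C.vert_curve trivial τ)
    rw [C.ev_curve trivial] at h1
    have h2 : s.diff (C.pt (x, τ)) (X.velocity (fun u => C.pt (x, u)) τ) =
        deriv (fun u => s.1 (C.pt (x, u))) τ :=
      X.vdiff_velocity (c := fun u => C.pt (x, u))
        ((s.contMDiffAt (C.pt_mem_above.2 hx)).mdifferentiableAt (by simp))
        ((C.smooth_curve trivial τ).mdifferentiableAt (by simp))
    rw [h2, ← key] at h1
    rw [src, ← h1]
    exact (hd x hx τ).hasDerivAt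
  · intro h p hp v hv
    have h1 : s.diff p v = X.diff C.time p v • deriv (fun t => s.1 (C.pt (p.1, t))) (C.time p) :=
      C.vdiff_eq trivial ((s.contMDiffAt hp).mdifferentiableAt (by simp)) hv
    rw [(h p.1 hp (C.time p)).deriv] at h1
    rw [C.ev_eq p trivial v hv, ← key, h1, src, C.pt_time', smul_smul, mul_comm]

end ClockOn

end LocObj

end SmoothAQFT

end

/-! ### Green operators of the Dirac operator. -/

noncomputable section

namespace SmoothAQFT

open Man Set Filter

namespace LocObj
variable {U : Man} {X : LocObj U} {W W' : Opens U}

namespace ClockOn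
variable (C : X.Clock) {ε : ℝ}

open Classical in
/-- The Green operator in the coordinates of a time function. -/
def green (hε : ε = 1 ∨ ε = -1) (W : Opens U) (s : X.Field W) : X.Field W :=
  if h : X.IsHalf ε s then C.field (cylPrim ε (C.src s))
    (contMDiffOn_cylPrim hε (C.smooth_src s) (C.cylBdd_src ((C.isHalf_iff hε).1 h))) else 0

variable (hε : ε = 1 ∨ ε = -1) {s t : X.Field W}

theorem green_pt (h : X.IsHalf ε s) {x : U} (hx : x ∈ W) (τ : ℝ) :
    (C.green hε W s).1 (C.pt (x, τ)) = cylPrim ε (C.src s) (x, τ) := by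
  rw [green, dif_pos h, C.field_pt _ hx]

theorem green_isHalf (h : X.IsHalf ε s) : X.IsHalf ε (C.green hε W s) := by
  rw [C.isHalf_iff hε]
  exact (CylBdd.cylPrim hε (C.smooth_src s) (C.cylBdd_src ((C.isHalf_iff hε).1 h))).of_support
    fun x hx τ hne => by rwa [C.green_pt hε h hx] at hne

theorem green_isDirac (h : X.IsHalf ε s) : (C.green hε W s).IsDirac s := by
  rw [C.isDirac_iff]
  intro x hx τ
  simp only [C.green_pt hε h hx]
  exact hasDerivAt_cylPrim (C.smooth_src s) hx τ

/-- The source is, up to an invertible factor, the derivative of `s`, so `LineBdd.of_hasDerivAt`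
bounds its support. -/
theorem isHalf_of_isDirac (C : X.Clock) (hε : ε = 1 ∨ ε = -1) (h : X.IsHalf ε s) (hst : s.IsDirac t) : X.IsHalf ε t := by
  rw [C.isHalf_iff hε] at h ⊢
  rw [C.isDirac_iff] at hst
  intro x hx
  obtain ⟨c, hc⟩ := h x hx
  refine ⟨c - 1, ?_⟩
  filter_upwards [hc, W.isOpen.mem_nhds hx] with y hy hyW τ hτ
  refine hy.of_hasDerivAt (hst y hyW) τ fun h0 => hτ ?_
  exact eq_zero_of_rot ((smul_eq_zero.1 h0).resolve_left (C.rate_pos y trivial τ).ne')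

/-- Uniqueness of primitives on each fiber. Additivity, linearity and naturality of the Green
operator are all deduced from this. -/
theorem green_eq (h : X.IsHalf ε s) (hst : s.IsDirac t) : C.green hε W t = s := by
  have ht := C.isHalf_of_isDirac hε h hst
  refine C.field_ext fun x hx τ => ?_
  rw [C.green_pt hε ht hx]
  obtain ⟨c, hc⟩ := ((C.isHalf_iff hε).1 h).slice hx
  exact (congrFun (prim_unique hε (continuous_slice (C.smooth_src t) hx) hc
    (C.isDirac_iff.1 hst x hx)) τ).symm

end ClockOn

namespace Field

theorem IsDirac.add {s s' t t' : X.Field W} (h : s.IsDirac t) (h' : s'.IsDirac t') :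
    (s + s').IsDirac (t + t') := by
  rw [X.clock.isDirac_iff] at *
  intro x hx τ
  have : X.clock.src (t + t') (x, τ) = X.clock.src t (x, τ) + X.clock.src t' (x, τ) := by
    simp only [ClockOn.src]
    rw [← smul_add, ← map_add]
    rfl
  rw [this]
  exact (h x hx τ).add (h' x hx τ)

theorem IsDirac.smul {s t : X.Field W} (h : s.IsDirac t) (a : Fn U W) :
    (s.smul a).IsDirac (t.smul a) := by
  rw [X.clock.isDirac_iff] at *
  intro x hx τ
  have : X.clock.src (t.smul a) (x, τ) = a.ev ⟨x, hx⟩ • X.clock.src t (x, τ) := by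
    simp only [ClockOn.src]
    rw [X.clock.smul_pt a t hx, rot_smul, smul_comm]
  rw [this]
  simp only [X.clock.smul_pt a s hx]
  exact (h x hx τ).const_smul (a.ev ⟨x, hx⟩)

theorem IsDirac.rs {s t : X.Field W} (h : s.IsDirac t) (i : W' ≤ W) : (s.rs i).IsDirac (t.rs i) := by
  rw [X.clock.isDirac_iff] at *
  intro x hx τ
  have : X.clock.src (t.rs i) (x, τ) = X.clock.src t (x, τ) := by
    simp only [ClockOn.src]
    rw [X.clock.rs_pt t i hx]
  rw [this]
  simp only [X.clock.rs_pt s i hx]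
  exact h x (i hx) τ

end Field

section
variable {ε : ℝ} {s t : X.Field W}

theorem cylBdd_add {V : Type} [NormedAddCommGroup V] [NormedSpace ℝ V] {f g : U × ℝ → V}
    (hf : CylBdd ε W f) (hg : CylBdd ε W g) : CylBdd ε W (f + g) := by
  intro x hx
  obtain ⟨c, hc⟩ := hf x hx
  obtain ⟨d, hd⟩ := hg x hx
  refine ⟨min c d, ?_⟩
  filter_upwards [hc, hd] with y h1 h2 t ht
  by_contra hlt
  have h3 := not_lt.1 hlt
  refine ht ?_
  change f (y, t) + g (y, t) = 0
  rw [h1.eq_zero (h3.trans (min_le_left _ _)), h2.eq_zero (h3.trans (min_le_right _ _)), add_zero]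

theorem IsHalf.add (hε : ε = 1 ∨ ε = -1) (hs : X.IsHalf ε s) (ht : X.IsHalf ε t) : X.IsHalf ε (s + t) := by
  rw [X.clock.isHalf_iff hε] at *
  exact cylBdd_add hs ht

theorem IsHalf.smul (hε : ε = 1 ∨ ε = -1) (hs : X.IsHalf ε s) (a : Fn U W) : X.IsHalf ε (s.smul a) := by
  rw [X.clock.isHalf_iff hε] at *
  refine hs.of_support fun x hx τ hne h0 => hne ?_
  rw [X.clock.smul_pt a s hx, h0, smul_zero]

theorem IsHalf.rs (hε : ε = 1 ∨ ε = -1) (hs : X.IsHalf ε s) (i : W' ≤ W) : X.IsHalf ε (s.rs i) := by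
  rw [X.clock.isHalf_iff hε] at *
  refine (hs.mono i).of_support fun x hx τ hne => ?_
  rwa [X.clock.rs_pt s i hx] at hne

end

namespace ClockOn
variable (C : X.Clock) {ε : ℝ} (hε : ε = 1 ∨ ε = -1)

/-- The differential equation is solved for its source: differentiate along the fiber, multiply by
`-rot` and divide by the positive density. -/
theorem exists_dirac (C : X.Clock) (s : X.Field W) : ∃ t, s.IsDirac t := by
  have hs := contMDiffOn_cyl_iff.1 (C.smooth_read s)
  refine ⟨C.field (fun q => (C.rate q)⁻¹ • (-rot (deriv (fun u => s.1 (C.pt (q.1, u))) q.2))) ?_, ?_⟩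
  · rw [contMDiffOn_cyl_iff]
    intro x hx τ
    have h1 : ContMDiffAt (mdl U) 𝓘(ℝ, ℝ) ∞ (fun q => (C.rate q)⁻¹) (x, τ) :=
      ContMDiffAt.comp (x, τ) (g := fun r : ℝ => r⁻¹)
        ((contDiffAt_inv ℝ (C.rate_pos x trivial τ).ne').contMDiffAt) (C.smooth_rate' (x, τ))
    have h2 : ContMDiffAt (mdl U) 𝓘(ℝ, ℂ × ℂ) ∞
        (fun q => -rot (deriv (fun u => s.1 (C.pt (q.1, u))) q.2)) (x, τ) :=
      ContMDiffAt.comp (x, τ) (g := fun z => -rot z)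
        (rot.contDiff.neg.contMDiff.contMDiffAt) (contMDiffAt_deriv (hs x hx τ))
    exact h1.smul h2
  · rw [C.isDirac_iff]
    intro x hx τ
    rw [src, C.field_pt _ hx, map_smul, map_neg, rot_rot, neg_neg, smul_smul,
      mul_inv_cancel₀ (C.rate_pos x trivial τ).ne', one_smul]
    exact hasDerivAt_of_contMDiffAt (hs x hx τ)

/-- Fiber by fiber this is `prim_eq_zero`, but supports are closures. If the fiber of `p` misses the
support of `s` up to the time of `p`, the tube lemma shows that nearby fibers miss it too, so the
solution vanishes in a neighborhood of `p`. -/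
theorem green_causal {s : X.Field W} (h : X.IsHalf ε s) :
    (C.green hε W s).supp ⊆ X.J ε s.supp := by
  rintro p ⟨hp, hpW⟩
  rw [C.mem_J]
  by_contra! hno
  obtain ⟨c₀, hc₀⟩ := (C.cylBdd_src ((C.isHalf_iff hε).1 h)) p.1 hpW
  set t₀ := C.time p with ht₀
  have he : ∀ x, ε * (ε * x) = x := fun x => by rw [← mul_assoc, sign_mul_self hε, one_mul]
  -- `K` is the compact range of times from the uniform bound `c₀` to `t₀`; the minimum keeps `t₀`
  -- in `K` even when the bound lies beyond it.
  let c := min c₀ (ε * t₀)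
  let K : Set ℝ := (fun a => ε * a) '' Icc c (ε * t₀)
  have hK : IsCompact K := isCompact_Icc.image (by fun_prop)
  let n : Set (U × ℝ) := C.pt ⁻¹' (closure (Function.support s.1))ᶜ
  have hn : IsOpen n := isClosed_closure.isOpen_compl.preimage C.smooth_pt'.continuous
  have hsub : {p.1} ×ˢ K ⊆ n := by
    rintro ⟨x, τ⟩ ⟨hx, a, ha, haτ⟩ hcl
    obtain rfl : x = p.1 := hx
    subst haτ
    have := hno (C.pt (p.1, ε * a)) ⟨hcl, C.pt_mem_above.2 hpW⟩ (C.proj_pt' _)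
    rw [C.time_pt'] at this
    simp only [he] at this
    exact absurd ha.2 (not_le.2 this)
  obtain ⟨u, v, hu, hv, hxu, hKv, huv⟩ := generalized_tube_lemma isCompact_singleton hK hn hsub
  have ht₀K : t₀ ∈ K := ⟨ε * t₀, ⟨min_le_right _ _, le_rfl⟩, he _⟩
  obtain ⟨δ, hδ, hball⟩ := Metric.isOpen_iff.1 hv t₀ (hKv ht₀K)
  have hev : ∀ᶠ q in 𝓝 p, q.1 ∈ W ∧ q.1 ∈ u ∧
      LineBdd ε (fun t => C.src s (q.1, t)) c₀ ∧ C.time q ∈ Metric.ball t₀ δ := by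
    have hproj : Tendsto (fun q : X.Tot => q.1) (𝓝 p) (𝓝 p.1) :=
      (contMDiff_proj X.Fib (n := ∞) (IB := 𝓡 U.dim)).continuous.continuousAt
    filter_upwards [hproj.eventually (W.isOpen.mem_nhds hpW),
      hproj.eventually (hu.mem_nhds (hxu rfl)), hproj.eventually hc₀,
      C.smooth_time'.continuous.continuousAt.eventually (Metric.ball_mem_nhds _ hδ)] with q h1 h2 h3 h4
    exact ⟨h1, h2, h3, h4⟩
  have hzero : ∀ᶠ q in 𝓝 p, (C.green hε W s).1 q = 0 := by
    filter_upwards [hev] with q ⟨h1, h2, h3, h4⟩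
    rw [← C.pt_time' q, C.green_pt hε h h1]
    refine prim_eq_zero hε (continuous_slice (C.smooth_src s) h1) fun τ hτ => ?_
    by_contra hne
    have hc : c₀ < ε * τ := h3 τ hne
    have hτv : τ ∈ v := by
      -- A time relevant for `q` either lies in `K`, or lies between `t₀` and the nearby time of `q`
      -- and hence in the ball around `t₀`.
      rcases le_total (ε * τ) (ε * t₀) with hle | hle
      · exact hKv ⟨ε * τ, ⟨(min_le_left _ _).trans hc.le, hle⟩, he _⟩
      · refine hball ?_
        rw [Metric.mem_ball, Real.dist_eq] at h4 ⊢
        change ε * τ ≤ ε * C.time q at hτ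
        refine lt_of_le_of_lt ?_ h4
        rcases hε with rfl | rfl
        · rw [abs_of_nonneg (by linarith), abs_of_nonneg (by linarith)]
          linarith
        · rw [abs_of_nonpos (by linarith), abs_of_nonpos (by linarith)]
          linarith
    have : (q.1, τ) ∈ n := huv ⟨h2, hτv⟩
    exact this (subset_closure (C.src_ne_zero hne))
  obtain ⟨q, hq1, hq2⟩ := mem_closure_iff_nhds.1 hp _ hzero
  exact hq2 hq1

/-- For `add`, `smul` and `nat` the right-hand side is a solution with the correct support, so
`green_eq` identifies it with the Green operator. -/
theorem isGreen : X.IsGreen ε (C.green hε) where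
  maps W s h := C.green_isHalf hε h
  add W s t hs ht := C.green_eq hε (IsHalf.add hε (C.green_isHalf hε hs) (C.green_isHalf hε ht))
    ((C.green_isDirac hε hs).add (C.green_isDirac hε ht))
  smul W a s hs := C.green_eq hε (IsHalf.smul hε (C.green_isHalf hε hs) a) ((C.green_isDirac hε hs).smul a)
  nat W W' i s hs := C.green_eq hε (IsHalf.rs hε (C.green_isHalf hε hs) i) ((C.green_isDirac hε hs).rs i)
  dirac_maps W s hs := (C.exists_dirac s).imp fun t ht => ⟨C.isHalf_of_isDirac hε hs ht, ht⟩
  dirac_green W s hs := C.green_isDirac hε hs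
  green_dirac W s t hs hst := C.green_eq hε hs hst
  causal W s hs := C.green_causal hε hs

end ClockOn

/-- The Green operators of a family of spacetimes. -/
def diracGreen (X : LocObj U) : X.DiracGreen where
  ret := X.clock.green (.inl rfl)
  adv := X.clock.green (.inr rfl)
  isGreen_ret := X.clock.isGreen (.inl rfl)
  isGreen_adv := X.clock.isGreen (.inr rfl)

end LocObj

end SmoothAQFT

end

/-! ### Fiber integrals, the quotient and the pairing. -/

noncomputable section

namespace SmoothAQFT

open Man Set Filter MeasureTheory

theorem integrable_of_bdd {V : Type} [NormedAddCommGroup V] [NormedSpace ℝ V] {g : ℝ → V}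
    (hg : Continuous g) {c d : ℝ} (hc : LineBdd 1 g c) (hd : LineBdd (-1) g d) : Integrable g := by
  refine hg.integrable_of_hasCompactSupport
    (HasCompactSupport.of_support_subset_isCompact (isCompact_Icc (a := c) (b := -d)) ?_)
  intro t ht
  have h1 := hc t ht
  have h2 := hd t ht
  exact ⟨by linarith, by linarith⟩

namespace LocObj
variable {U : Man} {X : LocObj U} {W W' : Opens U}

/-- Fiber integrals in the coordinates of a time function. -/
theorem fibInt_eq (C : X.Clock) (φ : X.Tot → ℂ) (x : U) :
    X.fibInt φ x = ∫ t : ℝ, C.rate (x, t) • φ (C.pt (x, t)) := by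
  let e := trivializationAt ℝ X.Fib x
  have hx : x ∈ e.baseSet := FiberBundle.mem_baseSet_trivializationAt' x
  have hc : ContMDiff 𝓘(ℝ, ℝ) (mdl U) ∞ (X.fibCoord x) := fun t =>
    ContMDiffAt.comp t (g := fun y : U × ℝ => e.toOpenPartialHomeomorph.symm y) (f := fun s => (x, s))
      (X.contMDiffAt_symm e (q := (x, t)) hx) (contMDiffAt_const.prodMk contMDiffAt_id)
  have hc1 : ∀ t, (X.fibCoord x t).1 = x := fun t => e.proj_symm_apply' hx
  -- Time as a function of the trivialization coordinate. It is a bijection of the line, possibly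
  -- decreasing.
  let θ : ℝ → ℝ := fun t => C.time (X.fibCoord x t)
  have hpt : ∀ t, C.pt (x, θ t) = X.fibCoord x t := by
    intro t
    have := C.pt_time' (X.fibCoord x t)
    rwa [hc1] at this
  have hd : ∀ t, HasDerivAt θ (deriv θ t) t := fun t =>
    ((C.smooth_time'.comp hc).contDiff.differentiable (by simp) t).hasDerivAt
  have hinj : Function.Injective θ := by
    intro s t hst
    have h1 : X.fibCoord x s = X.fibCoord x t := by rw [← hpt, ← hpt, hst]
    have h2 : ∀ t, e (X.fibCoord x t) = (x, t) := fun t => e.apply_symm_apply' hx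
    have := congrArg e h1
    rw [h2, h2] at this
    exact congrArg Prod.snd this
  have hsurj : θ '' univ = univ := by
    refine image_univ_of_surjective fun τ => ⟨(e (C.pt (x, τ))).2, ?_⟩
    have hm : C.pt (x, τ) ∈ e.source := e.mem_source.2 (by
      change (C.pt (x, τ)).1 ∈ _
      rw [C.proj_pt']; exact hx)
    have h1 : e.toOpenPartialHomeomorph.symm ((C.pt (x, τ)).1, (e (C.pt (x, τ))).2) = C.pt (x, τ) :=
      e.symm_apply_mk_proj hm
    rw [C.proj_pt'] at h1
    change C.time (e.toOpenPartialHomeomorph.symm (x, _)) = τ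
    rw [h1, C.time_pt']
  -- The change of variables produces `|θ'|`, matching the absolute value in `fibInt`: the density
  -- there is `rate * θ'` with `rate > 0`.
  have key := integral_image_eq_integral_abs_deriv_smul MeasurableSet.univ
    (fun t _ => (hd t).hasDerivWithinAt) hinj.injOn (fun t => C.rate (x, t) • φ (C.pt (x, t)))
  rw [hsurj, setIntegral_univ, setIntegral_univ] at key
  rw [key]
  refine integral_congr_ae (Eventually.of_forall fun t => ?_)
  have hm := hc.mdifferentiable (by simp) t
  dsimp only
  rw [C.ev_eq _ trivial _ (X.velocity_mem_vert hm hc1), hpt, smul_smul,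
    X.diff_velocity (C.smooth_time'.mdifferentiable (by simp) _) hm, hc1, abs_mul,
    abs_of_pos (C.rate_pos x trivial _), mul_comm]

/-- The integrals of the two components of a field over the fiber at `x`. -/
def pairInt (s : X.Field W) (x : U) : ℂ × ℂ :=
  (X.fibInt (fun p => (s.1 p).1) x, X.fibInt (fun p => (s.1 p).2) x)

namespace ClockOn
variable (C : X.Clock)

/-- A field times the density of the one-form. -/
def wt (s : X.Field W) (q : U × ℝ) : ℂ × ℂ := C.rate q • s.1 (C.pt q)

theorem smooth_wt (s : X.Field W) : ContMDiffOn (mdl U) 𝓘(ℝ, ℂ × ℂ) ∞ (C.wt s) (cyl W) :=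
  C.smooth_rate'.contMDiffOn.smul (C.smooth_read s)

theorem rot_wt (s : X.Field W) (q : U × ℝ) : rot (C.wt s q) = C.src s q := map_smul rot _ _

theorem cylBdd_wt {ε : ℝ} {s : X.Field W} (h : CylBdd ε W fun q => s.1 (C.pt q)) :
    CylBdd ε W (C.wt s) := h.of_support fun x _ t hne h0 => hne (by
      change _ • s.1 (C.pt (x, t)) = 0
      rw [h0, smul_zero])

variable {s t : X.Field W}

theorem integrable_wt (hs : X.IsVC s) {x : U} (hx : x ∈ W) : Integrable fun τ => C.wt s (x, τ) := by
  obtain ⟨h1, h2⟩ := C.isVC_iff.1 hs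
  obtain ⟨c, hc⟩ := (C.cylBdd_wt h1).slice hx
  obtain ⟨d, hd⟩ := (C.cylBdd_wt h2).slice hx
  exact integrable_of_bdd (continuous_slice (C.smooth_wt s) hx) hc hd

theorem pairInt_eq (hs : X.IsVC s) {x : U} (hx : x ∈ W) :
    pairInt s x = ∫ τ, C.wt s (x, τ) := by
  have hi := C.integrable_wt hs hx
  refine Prod.ext ?_ ?_
  · rw [fst_integral hi]
    exact fibInt_eq C (fun p => (s.1 p).1) x
  · rw [snd_integral hi]
    exact fibInt_eq C (fun p => (s.1 p).2) x

theorem integral_src (hs : X.IsVC s) {x : U} (hx : x ∈ W) :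
    ∫ τ, C.src s (x, τ) = rot (pairInt s x) := by
  rw [C.pairInt_eq hs hx, ← rot.integral_comp_comm (C.integrable_wt hs hx)]
  simp only [rot_wt]

theorem smooth_pairInt (C : X.Clock) (hs : X.IsVC s) :
    ContMDiffOn (𝓡 U.dim) 𝓘(ℝ, ℂ × ℂ) ∞ (pairInt s) W := by
  obtain ⟨h1, h2⟩ := C.isVC_iff.1 hs
  exact (contMDiffOn_integral (C.smooth_wt s) (C.cylBdd_wt h1) (C.cylBdd_wt h2)).congr
    fun x hx => C.pairInt_eq hs hx

end ClockOn

variable {s t : X.Field W}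

theorem IsVC.isHalf (hs : X.IsVC s) : X.IsHalf 1 s ∧ X.IsHalf (-1) s := by
  rw [X.clock.isHalf_iff (.inl rfl), X.clock.isHalf_iff (.inr rfl)]
  exact X.clock.isVC_iff.1 hs

theorem isVC_of_isHalf (h1 : X.IsHalf 1 s) (h2 : X.IsHalf (-1) s) : X.IsVC s := by
  rw [X.clock.isHalf_iff (.inl rfl)] at h1
  rw [X.clock.isHalf_iff (.inr rfl)] at h2
  exact X.clock.isVC_iff.2 ⟨h1, h2⟩

theorem IsVC.add (hs : X.IsVC s) (ht : X.IsVC t) : X.IsVC (s + t) :=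
  isVC_of_isHalf (IsHalf.add (.inl rfl) hs.isHalf.1 ht.isHalf.1)
    (IsHalf.add (.inr rfl) hs.isHalf.2 ht.isHalf.2)

theorem IsVC.smul (hs : X.IsVC s) (a : Fn U W) : X.IsVC (s.smul a) :=
  isVC_of_isHalf (IsHalf.smul (.inl rfl) hs.isHalf.1 a) (IsHalf.smul (.inr rfl) hs.isHalf.2 a)

theorem IsVC.rs (hs : X.IsVC s) (i : W' ≤ W) : X.IsVC (s.rs i) :=
  isVC_of_isHalf (IsHalf.rs (.inl rfl) hs.isHalf.1 i) (IsHalf.rs (.inr rfl) hs.isHalf.2 i)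

theorem IsVC.star (hs : X.IsVC s) : X.IsVC s.star := by
  rw [X.clock.isVC_iff] at *
  have h : ∀ x ∈ W, ∀ t, s.star.1 (X.clock.pt (x, t)) ≠ 0 → s.1 (X.clock.pt (x, t)) ≠ 0 := by
    intro x _ t hne h0
    refine hne (Prod.ext ?_ ?_)
    · change starRingEnd ℂ (s.1 (X.clock.pt (x, t))).2 = 0
      rw [h0]; exact map_zero _
    · change starRingEnd ℂ (s.1 (X.clock.pt (x, t))).1 = 0
      rw [h0]; exact map_zero _
  exact ⟨hs.1.of_support h, hs.2.of_support h⟩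

theorem pairInt_add (hs : X.IsVC s) (ht : X.IsVC t) {x : U} (hx : x ∈ W) :
    pairInt (s + t) x = pairInt s x + pairInt t x := by
  rw [X.clock.pairInt_eq (hs.add ht) hx, X.clock.pairInt_eq hs hx, X.clock.pairInt_eq ht hx,
    ← integral_add (X.clock.integrable_wt hs hx) (X.clock.integrable_wt ht hx)]
  exact integral_congr_ae (Eventually.of_forall fun τ => smul_add _ _ _)

theorem pairInt_smul (hs : X.IsVC s) (a : Fn U W) {x : U} (hx : x ∈ W) :
    pairInt (s.smul a) x = a.ev ⟨x, hx⟩ • pairInt s x := by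
  rw [X.clock.pairInt_eq (hs.smul a) hx, X.clock.pairInt_eq hs hx, ← integral_smul]
  refine integral_congr_ae (Eventually.of_forall fun τ => ?_)
  dsimp only [ClockOn.wt]
  rw [X.clock.smul_pt a s hx, smul_comm]

theorem pairInt_rs (hs : X.IsVC s) (i : W' ≤ W) {x : U} (hx : x ∈ W') :
    pairInt (s.rs i) x = pairInt s x := by
  rw [X.clock.pairInt_eq (hs.rs i) hx, X.clock.pairInt_eq hs (i hx)]
  refine integral_congr_ae (Eventually.of_forall fun τ => ?_)
  dsimp only [ClockOn.wt]
  rw [X.clock.rs_pt s i hx]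

theorem fibInt_conj (φ : X.Tot → ℂ) (x : U) :
    X.fibInt (fun p => starRingEnd ℂ (φ p)) x = starRingEnd ℂ (X.fibInt φ x) := by
  rw [fibInt, fibInt, ← integral_conj]
  refine integral_congr_ae (Eventually.of_forall fun τ => ?_)
  simp only [Complex.real_smul, map_mul, Complex.conj_ofReal]

theorem pairInt_star (s : X.Field W) (x : U) :
    pairInt s.star x = (starRingEnd ℂ (pairInt s x).2, starRingEnd ℂ (pairInt s x).1) :=
  Prod.ext (fibInt_conj (fun p => (s.1 p).2) x) (fibInt_conj (fun p => (s.1 p).1) x)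

/-- A field of vertically compact support has vanishing fiber integrals if and only if it is in the
image of the Dirac operator. -/
theorem pairInt_eq_zero_iff (hs : X.IsVC s) :
    (∀ x ∈ W, pairInt s x = 0) ↔ ∃ t : X.Field W, X.IsVC t ∧ t.IsDirac s := by
  have hb := X.clock.isVC_iff.1 hs
  have hsub : ∀ x ∈ W, ∀ τ, cylPrim 1 (X.clock.src s) (x, τ) - cylPrim (-1) (X.clock.src s) (x, τ) =
      rot (pairInt s x) := by
    intro x hx τ
    obtain ⟨c, hc⟩ := (X.clock.cylBdd_src hb.1).slice hx
    obtain ⟨d, hd⟩ := (X.clock.cylBdd_src hb.2).slice hx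
    rw [← X.clock.integral_src hs hx]
    exact prim_sub_prim (continuous_slice (X.clock.smooth_src s) hx) hc hd τ
  constructor
  · intro h
    -- With zero fiber integral the retarded and advanced solutions agree, so the common solution is
    -- bounded on both sides.
    have heq : X.clock.green (.inl rfl) W s = X.clock.green (.inr rfl) W s :=
      X.clock.field_ext fun x hx τ => by
        rw [X.clock.green_pt _ hs.isHalf.1 hx, X.clock.green_pt _ hs.isHalf.2 hx, ← sub_eq_zero,
          hsub x hx, h x hx, map_zero]
    refine ⟨X.clock.green (.inl rfl) W s, isVC_of_isHalf (X.clock.green_isHalf _ hs.isHalf.1) ?_,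
      X.clock.green_isDirac _ hs.isHalf.1⟩
    rw [heq]
    exact X.clock.green_isHalf _ hs.isHalf.2
  · rintro ⟨t, ht, hts⟩ x hx
    -- A preimage of vertically compact support equals both solutions, so their difference, which is
    -- the rotated integral, vanishes.
    have h1 := X.clock.green_eq (.inl rfl) ht.isHalf.1 hts
    have h2 := X.clock.green_eq (.inr rfl) ht.isHalf.2 hts
    have h3 := hsub x hx 0
    rw [← X.clock.green_pt (.inl rfl) hs.isHalf.1 hx, ← X.clock.green_pt (.inr rfl) hs.isHalf.2 hx,
      h1, h2, sub_self] at h3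
    exact eq_zero_of_rot h3.symm

/-- The causal propagator is constant along the fibers. -/
theorem prop_pt (hs : X.IsVC s) {x : U} (hx : x ∈ W) (τ : ℝ) :
    (X.diracGreen.prop s).1 (X.clock.pt (x, τ)) = rot (pairInt s x) := by
  have hb := X.clock.isVC_iff.1 hs
  obtain ⟨c, hc⟩ := (X.clock.cylBdd_src hb.1).slice hx
  obtain ⟨d, hd⟩ := (X.clock.cylBdd_src hb.2).slice hx
  have e1 := X.clock.green_pt (.inl rfl) hs.isHalf.1 hx τ
  have e2 := X.clock.green_pt (.inr rfl) hs.isHalf.2 hx τ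
  refine (congrArg₂ (· - ·) e1 e2).trans ?_
  rw [← X.clock.integral_src hs hx]
  exact prim_sub_prim (continuous_slice (X.clock.smooth_src s) hx) hc hd τ

/-- The propagator is constant on the fiber and leaves the integral. What remains are the two
component integrals of `s`, with coefficients `i * i = -1`. -/
theorem fibInt_dens (hs : X.IsVC s) (ht : X.IsVC t) {x : U} (hx : x ∈ W) :
    X.fibInt (X.dens s (X.diracGreen.prop t)) x =
      -((pairInt s x).1 * (pairInt t x).2 + (pairInt s x).2 * (pairInt t x).1) := by
  have hi := X.clock.integrable_wt hs hx
  rw [fibInt_eq X.clock]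
  have e : ∀ τ, X.clock.rate (x, τ) • X.dens s (X.diracGreen.prop t) (X.clock.pt (x, τ)) =
      -((X.clock.wt s (x, τ)).1 * (pairInt t x).2 + (X.clock.wt s (x, τ)).2 * (pairInt t x).1) := by
    intro τ
    rw [dens, prop_pt ht hx, rot_apply]
    simp only [ClockOn.wt, Prod.smul_fst, Prod.smul_snd, Complex.real_smul]
    linear_combination (((X.clock.rate (x, τ) : ℂ) * (s.1 (X.clock.pt (x, τ))).1 * (pairInt t x).2) +
      ((X.clock.rate (x, τ) : ℂ) * (s.1 (X.clock.pt (x, τ))).2 * (pairInt t x).1)) * Complex.I_mul_I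
  simp only [e]
  rw [integral_neg, integral_add (hi.fst.mul_const _) (hi.snd.mul_const _),
    integral_mul_const, integral_mul_const, X.clock.pairInt_eq hs hx, fst_integral hi,
    snd_integral hi]

/-- Every smooth function on the base is a fiber integral. -/
theorem exists_pairInt (g : U → ℂ × ℂ) (hg : ContMDiffOn (𝓡 U.dim) 𝓘(ℝ, ℂ × ℂ) ∞ g W) :
    ∃ s : X.Field W, X.IsVC s ∧ ∀ x ∈ W, pairInt s x = g x := by
  -- A bump in the time coordinate with integral `1`, divided by the density so that integration
  -- against the one-form returns `g`.
  let b : ContDiffBump (0 : ℝ) := ⟨1, 2, one_pos, one_lt_two⟩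
  let C := X.clock
  let β : ℝ → ℝ := b.normed volume
  have hβ : ContDiff ℝ ∞ β := b.contDiff_normed
  have hβ0 : ∀ t, β t ≠ 0 → t ∈ Metric.ball (0 : ℝ) 2 := fun t ht => by
    have := b.support_normed_eq (μ := (volume : Measure ℝ))
    rw [← this]
    exact ht
  have hsm : ContMDiffOn (mdl U) 𝓘(ℝ, ℂ × ℂ) ∞
      (fun q : U × ℝ => ((C.rate q)⁻¹ * β q.2) • g q.1) (cyl W) := by
    rw [contMDiffOn_cyl_iff]
    intro x hx τ
    have h1 : ContMDiffAt (mdl U) 𝓘(ℝ, ℝ) ∞ (fun q => (C.rate q)⁻¹) (x, τ) :=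
      ContMDiffAt.comp (x, τ) (g := fun r : ℝ => r⁻¹)
        ((contDiffAt_inv ℝ (C.rate_pos x trivial τ).ne').contMDiffAt) (C.smooth_rate' (x, τ))
    have h2 : ContMDiffAt (mdl U) 𝓘(ℝ, ℝ) ∞ (fun q : U × ℝ => β q.2) (x, τ) :=
      ContMDiffAt.comp (x, τ) hβ.contMDiff.contMDiffAt contMDiffAt_snd
    have h3 : ContMDiffAt (mdl U) 𝓘(ℝ, ℂ × ℂ) ∞ (fun q : U × ℝ => g q.1) (x, τ) :=
      ContMDiffAt.comp (x, τ) (hg.contMDiffAt (W.isOpen.mem_nhds hx)) contMDiffAt_fst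
    exact (h1.mul h2).smul h3
  have hvc : X.IsVC (C.field _ hsm) := by
    have hbd : ∀ ε : ℝ, ε = 1 ∨ ε = -1 → CylBdd ε W fun q => (C.field _ hsm).1 (C.pt q) := by
      intro ε hε x hx
      -- The bump lives in `(-2, 2)`, so `-2` works for either sign `ε`.
      refine ⟨-2, ?_⟩
      filter_upwards [W.isOpen.mem_nhds hx] with y hy τ hτ
      have h0 : β τ ≠ 0 := by
        intro h0
        refine hτ ?_
        dsimp only
        rw [C.field_pt _ hy, h0, mul_zero, zero_smul]
      have h1 := hβ0 τ h0
      rw [Metric.mem_ball, dist_zero_right, Real.norm_eq_abs, abs_lt] at h1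
      rcases hε with rfl | rfl
      · linarith
      · linarith
    exact C.isVC_iff.2 ⟨hbd 1 (.inl rfl), hbd (-1) (.inr rfl)⟩
  refine ⟨C.field _ hsm, hvc, fun x hx => ?_⟩
  rw [C.pairInt_eq hvc hx]
  have e : ∀ τ, C.wt (C.field _ hsm) (x, τ) = β τ • g x := by
    intro τ
    rw [ClockOn.wt, C.field_pt _ hx, smul_smul, mul_inv_cancel_left₀ (C.rate_pos x trivial τ).ne']
  simp only [e]
  rw [integral_smul_const, b.integral_normed, one_smul]

end LocObj

end SmoothAQFT

end

/-! ### Extension by zero, base change, and the presentation of the Dirac stack morphism. -/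

noncomputable section

namespace SmoothAQFT

open Man Set Filter MeasureTheory

namespace LocObj

section Push
variable {U : Man} {X Y : LocObj U} {W : Opens U} (f : X ⟶ Y) (C : X.Clock) (D : Y.Clock)

/-- A morphism in the coordinates of time functions. -/
def Hom.coord (q : U × ℝ) : ℝ := D.time (Hom.tot f (C.pt q))

theorem Hom.smooth_tot : ContMDiff (mdl U) (mdl U) ∞ (Hom.tot f) := f.smooth

theorem Hom.pt_coord (x : U) (t : ℝ) : D.pt (x, Hom.coord f C D (x, t)) = Hom.tot f (C.pt (x, t)) := by
  have := D.pt_time' (Hom.tot f (C.pt (x, t)))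
  have h : (Hom.tot f (C.pt (x, t))).1 = x := C.proj_pt' (x, t)
  rwa [h] at this

theorem Hom.smooth_coord : ContMDiff (mdl U) 𝓘(ℝ, ℝ) ∞ (Hom.coord f C D) :=
  D.smooth_time'.comp ((Hom.smooth_tot f).comp C.smooth_pt')

/-- Preservation of the one-form, evaluated on a fiber curve, says that the density of `X` is that
of `Y` times this derivative. -/
theorem Hom.hasDerivAt_coord (x : U) (t : ℝ) : HasDerivAt (fun s => Hom.coord f C D (x, s))
    (C.rate (x, t) / D.rate (x, Hom.coord f C D (x, t))) t := by
  have h1 := hasDerivAt_of_contMDiffAt (Hom.smooth_coord f C D (x, t))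
  have hc := (C.smooth_curve (x := x) trivial t).mdifferentiableAt (by simp)
  have hd : ContMDiffAt 𝓘(ℝ, ℝ) (mdl U) ∞ (fun s => Hom.tot f (C.pt (x, s))) t :=
    ContMDiffAt.comp t (Hom.smooth_tot f _) (C.smooth_curve (x := x) trivial t)
  have h2 := f.form (C.pt (x, t)) _ (C.vert_curve trivial t)
  rw [C.ev_curve trivial] at h2
  have h3 : Y.velocity (fun s => Hom.tot f (C.pt (x, s))) t =
      mfderiv (mdl U) (mdl U) (Hom.tot f) (C.pt (x, t)) (X.velocity (fun s => C.pt (x, s)) t) :=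
    congrArg (fun L => L (1 : ℝ)) (mfderiv_comp t (Hom.mdiff f (C.pt (x, t))) hc)
  have hv := Y.velocity_mem_vert (c := fun s => Hom.tot f (C.pt (x, s))) (x := x)
    (hd.mdifferentiableAt (by simp)) fun s => C.proj_pt' (x, s)
  have h4 := D.ev_eq _ trivial _ hv
  rw [Y.diff_velocity (c := fun s => Hom.tot f (C.pt (x, s)))
    (D.smooth_time'.mdifferentiable (by simp) _) (hd.mdifferentiableAt (by simp))] at h4
  have h5 : (Hom.tot f (C.pt (x, t))).1 = x := C.proj_pt' (x, t)
  have h6 : Y.ev (Hom.tot f (C.pt (x, t))) (Y.velocity (fun s => Hom.tot f (C.pt (x, s))) t) =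
      C.rate (x, t) := by
    rw [h3]
    exact h2
  have h7 : C.rate (x, t) = D.rate (x, Hom.coord f C D (x, t)) *
      deriv (fun s => Hom.coord f C D (x, s)) t := by
    rw [← h6, h4, h5]
    rfl
  rw [h7, mul_div_cancel_left₀ _ (D.rate_pos x trivial _).ne']
  exact h1

theorem Hom.deriv_coord_pos (x : U) (t : ℝ) :
    0 < C.rate (x, t) / D.rate (x, Hom.coord f C D (x, t)) :=
  div_pos (C.rate_pos x trivial _) (D.rate_pos x trivial _)

theorem Hom.strictMono_coord (x : U) : StrictMono fun t => Hom.coord f C D (x, t) :=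
  strictMono_of_deriv_pos fun t => by
    rw [(Hom.hasDerivAt_coord f C D x t).deriv]
    exact Hom.deriv_coord_pos f C D x t

theorem Hom.injective_tot : Function.Injective (Hom.tot f) := f.emb.injective

theorem Hom.isOpen_range_tot : IsOpen (range (Hom.tot f)) := f.emb.isOpen_range

/-- Extension by zero along a morphism. -/
def Hom.ext0 {V : Type} [Zero V] (s : X.Tot → V) : Y.Tot → V := Function.extend (Hom.tot f) s fun _ => 0

theorem Hom.ext0_tot {V : Type} [Zero V] (s : X.Tot → V) (p : X.Tot) :
    Hom.ext0 f s (Hom.tot f p) = s p := (Hom.injective_tot f).extend_apply s _ p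

theorem Hom.ext0_of_notMem {V : Type} [Zero V] (s : X.Tot → V) {p : Y.Tot}
    (hp : p ∉ range (Hom.tot f)) : Hom.ext0 f s p = 0 := Function.extend_apply' s _ p hp

theorem Hom.ext0_coord {V : Type} [Zero V] (s : X.Tot → V) (x : U) (t : ℝ) :
    Hom.ext0 f s (D.pt (x, Hom.coord f C D (x, t))) = s (C.pt (x, t)) := by
  rw [Hom.pt_coord, Hom.ext0_tot]

theorem Hom.exists_coord_of_mem_range {q : U × ℝ} (h : D.pt q ∈ range (Hom.tot f)) :
    ∃ t, Hom.coord f C D (q.1, t) = q.2 := by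
  obtain ⟨p, hp⟩ := h
  have hp1 : p.1 = q.1 := (congrArg TotalSpace.proj hp).trans (D.proj_pt' q)
  refine ⟨C.time p, ?_⟩
  rw [Hom.coord, ← hp1, C.pt_time', hp, D.time_pt']

theorem Hom.exists_of_ext0_ne_zero {V : Type} [Zero V] {s : X.Tot → V} {x : U} {τ : ℝ}
    (h : Hom.ext0 f s (D.pt (x, τ)) ≠ 0) :
    ∃ t, Hom.coord f C D (x, t) = τ ∧ s (C.pt (x, t)) ≠ 0 := by
  obtain ⟨t, ht⟩ := Hom.exists_coord_of_mem_range f C D (q := (x, τ)) (by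
    by_contra hp
    exact h (Hom.ext0_of_notMem f s hp))
  refine ⟨t, ht, ?_⟩
  have ht' : Hom.coord f C D (x, t) = τ := ht
  rwa [← ht', Hom.ext0_coord] at h

/-- The time of `X`, extended by zero to `Y`, is the fiberwise inverse of `coord` on the image,
which is open; so the implicit function argument applies there. -/
theorem Hom.smooth_inverse {x : U} (t : ℝ) : ContMDiffAt (mdl U) 𝓘(ℝ, ℝ) ∞
    (fun q => Hom.ext0 f C.time (D.pt q)) (x, Hom.coord f C D (x, t)) := by
  have hG : ∀ y s, Hom.ext0 f C.time (D.pt (y, Hom.coord f C D (y, s))) = s := fun y s => by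
    rw [Hom.ext0_coord, C.time_pt']
  refine contMDiffAt_fiber_inverse (F := Hom.coord f C D) (Hom.smooth_coord f C D _) ?_ ?_ ?_
  · rw [(Hom.hasDerivAt_coord f C D x _).deriv]
    exact (Hom.deriv_coord_pos f C D x _).ne'
  · have hmem : D.pt (x, Hom.coord f C D (x, t)) ∈ range (Hom.tot f) := by
      rw [Hom.pt_coord]
      exact mem_range_self _
    filter_upwards [D.smooth_pt'.continuous.continuousAt
      ((Hom.isOpen_range_tot f).mem_nhds hmem)] with q hq
    obtain ⟨s, hs⟩ := Hom.exists_coord_of_mem_range f C D hq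
    have hq' : q = (q.1, Hom.coord f C D (q.1, s)) := Prod.ext rfl hs.symm
    rw [hq', hG]
  · exact Eventually.of_forall fun y => (Hom.strictMono_coord f C D y).injective

/-- The danger lies at the boundary of the image of `f`, and vertically compact support keeps away
from it: below the image of the lower bound and above that of the upper bound the extension vanishes
nearby, and in between every point is in the open image. -/
theorem Hom.smooth_ext0 (C : X.Clock) (D : Y.Clock) {s : X.Field W} (hs : X.IsVC s) :
    ContMDiffOn (mdl U) 𝓘(ℝ, ℂ × ℂ) ∞ (fun q => Hom.ext0 f s.1 (D.pt q)) (cyl W) := by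
  rw [contMDiffOn_cyl_iff]
  intro x hx τ
  obtain ⟨h1, h2⟩ := C.isVC_iff.1 hs
  obtain ⟨c, hc⟩ := h1 x hx
  obtain ⟨d, hd⟩ := h2 x hx
  have hF := (Hom.smooth_coord f C D).continuous
  have hfst : Tendsto (fun q : U × ℝ => q.1) (𝓝 (x, τ)) (𝓝 x) := continuous_fst.tendsto (x, τ)
  by_cases hlo : τ < Hom.coord f C D (x, c)
  · have ho : IsOpen {q : U × ℝ | q.2 < Hom.coord f C D (q.1, c)} :=
      isOpen_lt continuous_snd (hF.comp (by fun_prop))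
    refine (contMDiffAt_const (c := 0)).congr_of_eventuallyEq ?_
    filter_upwards [ho.mem_nhds hlo, hfst.eventually hc] with q hq hqc
    by_contra hne
    obtain ⟨t, ht, hst⟩ := Hom.exists_of_ext0_ne_zero f C D hne
    have h3 : c < 1 * t := hqc t hst
    have h4 : q.2 < Hom.coord f C D (q.1, c) := hq
    rw [one_mul] at h3
    have h5 := Hom.strictMono_coord f C D q.1 h3
    dsimp only at h5
    linarith
  by_cases hhi : Hom.coord f C D (x, -d) < τ
  · have ho : IsOpen {q : U × ℝ | Hom.coord f C D (q.1, -d) < q.2} :=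
      isOpen_lt (hF.comp (by fun_prop)) continuous_snd
    refine (contMDiffAt_const (c := 0)).congr_of_eventuallyEq ?_
    filter_upwards [ho.mem_nhds hhi, hfst.eventually hd] with q hq hqc
    by_contra hne
    obtain ⟨t, ht, hst⟩ := Hom.exists_of_ext0_ne_zero f C D hne
    have h3 : d < -1 * t := hqc t hst
    have h4 : Hom.coord f C D (q.1, -d) < q.2 := hq
    have h5 := Hom.strictMono_coord f C D q.1 (show t < -d by linarith)
    dsimp only at h5
    linarith
  -- In the middle case the intermediate value theorem provides a preimage of `τ`, and the extension
  -- is `s` composed with the smooth inverse.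
  obtain ⟨a, ha⟩ := mem_range_of_exists_le_of_exists_ge
    (f := fun t => Hom.coord f C D (x, t)) (c := τ) (hF.comp (by fun_prop))
    ⟨c, not_lt.1 hlo⟩ ⟨-d, not_lt.1 hhi⟩
  have ha' : Hom.coord f C D (x, a) = τ := ha
  subst ha'
  have hG := Hom.smooth_inverse f C D (x := x) a
  have hGa : Hom.ext0 f C.time (D.pt (x, Hom.coord f C D (x, a))) = a := by
    rw [Hom.ext0_coord, C.time_pt']
  have h3 : ContMDiffAt (mdl U) 𝓘(ℝ, ℂ × ℂ) ∞
      (fun q : U × ℝ => s.1 (C.pt (q.1, Hom.ext0 f C.time (D.pt q))))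
      (x, Hom.coord f C D (x, a)) := by
    refine ContMDiffAt.comp (x, Hom.coord f C D (x, a)) (g := fun q => s.1 (C.pt q))
      (f := fun q : U × ℝ => (q.1, Hom.ext0 f C.time (D.pt q))) ?_ (contMDiffAt_fst.prodMk hG)
    exact contMDiffOn_cyl_iff.1 (C.smooth_read s) x hx _
  refine h3.congr_of_eventuallyEq ?_
  have hmem : D.pt (x, Hom.coord f C D (x, a)) ∈ range (Hom.tot f) := by
    rw [Hom.pt_coord]
    exact mem_range_self _
  filter_upwards [D.smooth_pt'.continuous.continuousAt
    ((Hom.isOpen_range_tot f).mem_nhds hmem)] with q hq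
  obtain ⟨t, ht⟩ := Hom.exists_coord_of_mem_range f C D hq
  have hq' : q = (q.1, Hom.coord f C D (q.1, t)) := Prod.ext rfl ht.symm
  rw [hq', Hom.ext0_coord, Hom.ext0_coord, C.time_pt']

/-- The pushforward (extension by zero) of fields of vertically compact support. -/
theorem exists_push {s : X.Field W} (hs : X.IsVC s) :
    ∃ t : Y.Field W, Y.IsVC t ∧ s.IsPush f t ∧ ∀ x ∈ W, pairInt t x = pairInt s x := by
  let C := X.clock
  let D := Y.clock
  have hsm := Hom.smooth_ext0 f C D hs
  let t : Y.Field W := ⟨Hom.ext0 f s.1, by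
    refine (hsm.comp D.smooth_coord.contMDiffOn (s := Y.above W) fun p hp => ⟨hp, trivial⟩).congr ?_
    intro p _
    exact congrArg (Hom.ext0 f s.1) (D.pt_time' p).symm, fun p hp => by
    by_contra hne
    have hr : p ∈ range (Hom.tot f) := by
      by_contra hr
      exact hne (Hom.ext0_of_notMem f _ hr)
    obtain ⟨p', rfl⟩ := hr
    rw [Hom.ext0_tot] at hne
    exact hne (s.2.2 p' hp)⟩
  have ht : ∀ x τ, t.1 (D.pt (x, Hom.coord f C D (x, τ))) = s.1 (C.pt (x, τ)) := fun x τ =>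
    Hom.ext0_coord f C D s.1 x τ
  have hF := (Hom.smooth_coord f C D).continuous
  have hvc : Y.IsVC t := by
    obtain ⟨h1, h2⟩ := C.isVC_iff.1 hs
    refine D.isVC_iff.2 ⟨fun x hx => ?_, fun x hx => ?_⟩
    · obtain ⟨c, hc⟩ := h1 x hx
      -- Bounds are transported by the increasing map `coord`; the margin `1`, here and for the
      -- upper bound, absorbs its variation with the base point.
      refine ⟨Hom.coord f C D (x, c) - 1, ?_⟩
      have hcc : ContinuousAt (fun y => Hom.coord f C D (y, c)) x :=
        (hF.comp (by fun_prop)).continuousAt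
      filter_upwards [hc, hcc.eventually (lt_mem_nhds (sub_one_lt _))] with y hy hy' τ hτ
      obtain ⟨a, ha, hsa⟩ := Hom.exists_of_ext0_ne_zero f C D hτ
      have h3 : c < 1 * a := hy a hsa
      rw [one_mul] at h3
      have h5 := Hom.strictMono_coord f C D y h3
      dsimp only at h5
      linarith
    · obtain ⟨d, hd⟩ := h2 x hx
      refine ⟨-(Hom.coord f C D (x, -d) + 1), ?_⟩
      have hcc : ContinuousAt (fun y => Hom.coord f C D (y, -d)) x :=
        (hF.comp (by fun_prop)).continuousAt
      filter_upwards [hd, hcc.eventually (gt_mem_nhds (lt_add_one _))] with y hy hy' τ hτ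
      obtain ⟨a, ha, hsa⟩ := Hom.exists_of_ext0_ne_zero f C D hτ
      have h3 : d < -1 * a := hy a hsa
      have h5 := Hom.strictMono_coord f C D y (show a < -d by linarith)
      dsimp only at h5
      linarith
  refine ⟨t, hvc, ⟨Hom.ext0_tot f s.1, fun p hp => Hom.ext0_of_notMem f s.1 hp⟩, fun x hx => ?_⟩
  rw [D.pairInt_eq hvc hx, C.pairInt_eq hs hx]
  -- Substitution along `coord`: its derivative is the quotient of the densities, so the two
  -- integrands match, and the complement of the image contributes nothing.
  have key := integral_image_eq_integral_abs_deriv_smul MeasurableSet.univ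
    (fun τ _ => (Hom.hasDerivAt_coord f C D x τ).hasDerivWithinAt)
    (Hom.strictMono_coord f C D x).injective.injOn (fun τ => D.wt t (x, τ))
  rw [setIntegral_univ, setIntegral_eq_integral_of_forall_compl_eq_zero] at key
  · rw [key]
    refine integral_congr_ae (Eventually.of_forall fun τ => ?_)
    dsimp only [ClockOn.wt]
    rw [ht, smul_smul, abs_of_pos (Hom.deriv_coord_pos f C D x τ),
      div_mul_cancel₀ _ (D.rate_pos x trivial _).ne']
  · intro τ hτ
    by_contra hne
    have h0 : t.1 (D.pt (x, τ)) ≠ 0 := fun h0 => hne (by rw [ClockOn.wt, h0, smul_zero])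
    obtain ⟨a, ha, -⟩ := Hom.exists_of_ext0_ne_zero f C D h0
    exact hτ ⟨a, trivial, ha⟩

end Push

section Pull
variable {U U' : Man} (h : U ⟶ U') {X : LocObj U'} {W : Opens U'}

/-- A point of the pullback over `x`, from a point of the fiber over the image of `x`. -/
def pbPt (x : U) (p : X.Tot) (hp : p.1 = Hom.fn h x) : (pb h X).Tot :=
  ⟨x, (show X.Fib (Hom.fn h x) from hp ▸ p.2)⟩

theorem lift_pbPt (x : U) (p : X.Tot) (hp : p.1 = Hom.fn h x) : X.lift h (pbPt h x p hp) = p := by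
  obtain ⟨y, v⟩ := p
  dsimp only at hp
  subst hp
  rfl

theorem lift_ext {p q : (pb h X).Tot} (h1 : p.1 = q.1) (h2 : X.lift h p = X.lift h q) : p = q := by
  obtain ⟨x, a⟩ := p
  obtain ⟨y, b⟩ := q
  dsimp only at h1
  subst h1
  have e : a = b := (TotalSpace.mk_inj (F := ℝ) (E := X.Fib) (b := Hom.fn h x) (y := a) (y' := b)).1 h2
  rw [e]

/-- The pullback of a time function. -/
def ClockOn.pull (C : X.Clock) : (pb h X).Clock where
  time p := C.time (X.lift h p)
  pt q := pbPt h q.1 (C.pt (Hom.fn h q.1, q.2)) (C.proj_pt' _)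
  rate q := C.rate (Hom.fn h q.1, q.2)
  proj_pt _ _ _ := rfl
  time_pt x _ t := by rw [lift_pbPt, C.time_pt']
  pt_time p _ := lift_ext h rfl ((lift_pbPt h p.1 _ _).trans (C.pt_time' (X.lift h p)))
  smooth_time p _ := (C.smooth_time'.comp (X.contMDiff_lift h)) p
  smooth_pt x _ t := by
    have hs : ContMDiff (mdl U) (mdl U') ∞ (fun p : U × ℝ => (Hom.fn h p.1, p.2)) :=
      ((Man.Hom.smooth h).comp contMDiff_fst).prodMk contMDiff_snd
    refine X.contMDiff_to_pullback h contMDiff_fst ?_ (x, t)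
    refine (C.smooth_pt'.comp hs).congr fun q => ?_
    exact lift_pbPt h q.1 _ _
  smooth_rate x _ t := by
    have hs : ContMDiff (mdl U) (mdl U') ∞ (fun p : U × ℝ => (Hom.fn h p.1, p.2)) :=
      ((Man.Hom.smooth h).comp contMDiff_fst).prodMk contMDiff_snd
    exact (C.smooth_rate'.comp hs) (x, t)
  rate_pos x _ t := C.rate_pos _ trivial t
  ev_eq p _ v hv := by
    rw [ev_pb h X hv, C.ev_eq _ trivial _ (X.vert_lift h p hv)]
    refine congrArg (C.rate (Hom.fn h p.1, C.time (X.lift h p)) * ·) ?_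
    exact (congrArg (fun L => L v) (mfderiv_comp p (C.smooth_time'.mdifferentiable (by simp) _)
      (X.mdiff_lift h p))).symm

theorem ClockOn.pull_pt (C : X.Clock) (s : X.Field W) (q : U × ℝ) :
    (s.pull h).1 ((C.pull h).pt q) = s.1 (C.pt (Hom.fn h q.1, q.2)) :=
  congrArg s.1 (lift_pbPt h q.1 _ _)

theorem CylBdd.comap {ε : ℝ} {V : Type} [NormedAddCommGroup V] {g : U' × ℝ → V}
    (hg : CylBdd ε W g) : CylBdd ε ((pre h).obj W) fun q => g (Hom.fn h q.1, q.2) := by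
  intro x hx
  obtain ⟨c, hc⟩ := hg (Hom.fn h x) hx
  exact ⟨c, (Man.Hom.cont h).continuousAt.eventually hc⟩

theorem IsVC.pull {s : X.Field W} (hs : X.IsVC s) : (pb h X).IsVC (s.pull h) := by
  obtain ⟨h1, h2⟩ := X.clock.isVC_iff.1 hs
  refine (X.clock.pull h).isVC_iff.2 ⟨?_, ?_⟩
  · simp only [ClockOn.pull_pt]
    exact CylBdd.comap h h1
  · simp only [ClockOn.pull_pt]
    exact CylBdd.comap h h2

/-- In the pulled back clock the density and the field are literally those of the fiber over `h x`.
-/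
theorem pairInt_pull {s : X.Field W} (hs : X.IsVC s) {x : U} (hx : Hom.fn h x ∈ W) :
    pairInt (s.pull h) x = pairInt s (Hom.fn h x) := by
  rw [(X.clock.pull h).pairInt_eq (IsVC.pull h hs) (x := x) hx, X.clock.pairInt_eq hs hx]
  refine integral_congr_ae (Eventually.of_forall fun τ => ?_)
  dsimp only [ClockOn.wt]
  rw [ClockOn.pull_pt]
  rfl

end Pull

open Classical in
/-- The class of a field, as the smooth function given by its fiber integrals. -/
def quot {U : Man} (X : LocObj U) (W : Opens U) (s : X.Field W) : Sec (pairMod U) W :=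
  -- The value `0` on other fields is immaterial, as every clause of the presentation assumes
  -- vertically compact support.
  if h : X.IsVC s then pairMod.mk (fun x => pairInt s x.1)
    fun x => contMDiffAt_subtype_iff.2
      ((X.clock.smooth_pairInt h).contMDiffAt (W.isOpen.mem_nhds x.2)) else 0

theorem ev_quot {U : Man} {X : LocObj U} {W : Opens U} {s : X.Field W} (h : X.IsVC s) (x : W) :
    pairMod.ev (quot X W s) x = pairInt s x.1 := by
  rw [quot, dif_pos h]
  rfl

section
variable {U : Man} {X : LocObj U} {W W' : Opens U} {s t : X.Field W}

theorem quot_add (hs : X.IsVC s) (ht : X.IsVC t) :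
    quot X W (s + t) = quot X W s + quot X W t := pairMod.ext fun x => by
  rw [pairMod.ev_add, ev_quot (hs.add ht), ev_quot hs, ev_quot ht, pairInt_add hs ht x.2]

theorem quot_smul (a : Fn U W) (hs : X.IsVC s) :
    quot X W (s.smul a) = a • quot X W s := pairMod.ext fun x => by
  rw [pairMod.ev_smul, ev_quot (hs.smul a), ev_quot hs, pairInt_smul hs a x.2]

theorem quot_res (i : W' ≤ W) (hs : X.IsVC s) :
    quot X W' (s.rs i) = res _ i (quot X W s) := pairMod.ext fun x => by
  rw [pairMod.ev_res, ev_quot (hs.rs i), ev_quot hs, pairInt_rs hs i x.2]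

end

/-- The quotients by the image of the Dirac operator, as values of a stack morphism. -/
def presentation : DiracPresentation (fun X => X.diracGreen) pairMod.strongTrans where
  q X W s := quot X W s
  q_add X W s t hs ht := quot_add hs ht
  q_smul X W a s hs := quot_smul a hs
  q_res X W W' i s hs := quot_res i hs
  q_surj {U} X W v := by
    let w : Sec (pairMod U) W := v
    -- A section over `W` is a function on a subtype; it is extended by zero to `U`, which keeps it
    -- smooth on the open set `W`.
    have hg : ContMDiffOn (𝓡 U.dim) 𝓘(ℝ, ℂ × ℂ) ∞
        (Function.extend (Subtype.val : W → U) (pairMod.ev w) 0) W := fun x hx => by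
      refine (contMDiffAt_subtype_iff (x := (⟨x, hx⟩ : W))).1 ?_ |>.contMDiffWithinAt
      refine (pairMod.smooth w _).congr_of_eventuallyEq (Filter.Eventually.of_forall fun y => ?_)
      exact Subtype.val_injective.extend_apply _ _ y
    obtain ⟨s, hs, h⟩ := exists_pairInt (X := X) _ hg
    refine ⟨s, hs, pairMod.ext fun x => ?_⟩
    rw [ev_quot hs, h x.1 x.2]
    exact Subtype.val_injective.extend_apply _ _ x
  q_ker {U} X W s hs := by
    rw [← pairInt_eq_zero_iff hs]
    constructor
    · intro h x hx
      rw [← ev_quot hs ⟨x, hx⟩]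
      exact congrArg (fun v : Sec (pairMod U) W => pairMod.ev v ⟨x, hx⟩) h
    · intro h
      exact pairMod.ext (v := quot X W s) (w := 0) fun x => (ev_quot hs x).trans (h x.1 x.2)
  star X W s hs := pairMod.ext fun x => by
    refine (pairMod.ev_star (quot X W s) x).trans ?_
    rw [ev_quot hs, ev_quot hs.star, pairInt_star]
  pair X W s t hs ht x := by
    refine (pairMod.ev_fnMk _ _ x).trans ?_
    rw [ev_quot hs, ev_quot ht, fibInt_dens hs ht x.2]
  map {U X Y} f W s hs := by
    -- The stack morphism sends `f` to the identity, so the clause reduces to equality of the fiber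
    -- integrals of `s` and its extension.
    obtain ⟨t, ht, hp, h⟩ := exists_push f hs
    refine ⟨t, ht, hp, pairMod.ext (v := quot X W s) (w := quot Y W t) fun x => ?_⟩
    rw [ev_quot hs, ev_quot ht, h x.1 x.2]
  coh h X W s hs := ⟨IsVC.pull h hs, (pairMod.coh_eta h (quot X W s)).trans
    (pairMod.ext fun x => by
      rw [pairMod.ev_comap, ev_quot hs, ev_quot (IsVC.pull h hs), pairInt_pull h hs x.2])⟩

end LocObj

end SmoothAQFT

end

theorem mainTheorem4 :
    ∃ (S : ∀ {U : Man} (X : LocObj U), X.DiracGreen)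
      (L : LocObj.prestack.StrongTrans IPVec.prestack)
      (CAR : IPVec.prestack.StrongTrans StarAlg.prestack)
      (A : LocObj.prestack.StrongTrans StarAlg.prestack),
      Nonempty (DiracPresentation S L) ∧ Nonempty (CARPresentation CAR) ∧ A = L.vcomp CAR := by
  exact ⟨fun X => X.diracGreen, pairMod.strongTrans, car.strongTrans,
    pairMod.strongTrans.vcomp car.strongTrans, ⟨LocObj.presentation⟩, ⟨car.presentation⟩, rfl⟩
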